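/- \textbf{Setting.} Let $\Omega\subset\mathbb R^d$, $d\in\{1,2,3\}$, be a bounded domain, and let $C_p$ be a constant with $\|v\|_0\le C_p\|\nabla v\|_0$ for all $v\in H^1_0(\Omega)$, where $\|\cdot\|_0$ and $(\cdot,\cdot)$ are the norm and inner product of $L^2$. Let $\alpha_0<\alpha_L$, let $\alpha\in[\alpha_0,\alpha_L]\mapsto T^\alpha\in(0,\infty)$ be smooth, and for each $\alpha\in[\alpha_0,\alpha_L]$ let $\nu_\alpha>0$, let $g_\alpha:\mathbb R\to\mathbb R$ be Lipschitz with a constant $\Lambda$ independent of $\alpha$, let $f_\alpha(t)\in L^2(\Omega)$, and let $u_0^\alpha$ be a function on $\overline\Omega$. Let $V_h^k\subset H^1_0(\Omega)$, $k\ge1$, be the space of continuous piecewise polynomials of degree at most $k$ on a partition of $\Omega$ into simplices that vanish on $\partial\Omega$, and let $u_h^\alpha:[0,T^\alpha]\to V_h^k$ satisfy $$(u_{h,t}^\alpha,v)+\nu_\alpha(\nabla u_h^\alpha,\nabla v)+(g_\alpha(u_h^\alpha),v)=(f_\alpha,v)\qquad\forall v\in V_h^k,\ t\in(0,T^\alpha],$$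 with $u_h^\alpha(0)$ the Lagrange interpolant of $u_0^\alpha$. Let $q,m\ge2$ and assume that $(\alpha,t)\mapsto u_h^\alpha(t)$ is of class $C^{\max(q,m)+1}$ on $\{(\alpha,t):\alpha\in[\alpha_0,\alpha_L],\ t\in[0,T^\alpha]\}$. \textbf{Standard POD method.} Let $\Delta\alpha=(\alpha_L-\alpha_0)/L$, $\alpha_l=\alpha_0+l\Delta\alpha$ $(0\le l\le L)$, $T^l=T^{\alpha_l}$, $t_j^l=jT^l/M$ $(0\le j\le M)$, $\Delta t=\max_l T^l/M$, with $M\ge q$ and $L\ge m-1$. Let $N=(M+1)(L+1)$, let $y_1,\dots,y_N$ be the snapshots $u_h^{\alpha_l}(t_j^l)$, let $\tilde\lambda_1\ge\dots\ge\tilde\lambda_{d_r}>0$ be the positive eigenvalues (with multiplicity) of the matrix with entries $\frac1N(\nabla y_i,\nabla y_j)$, with orthonormal eigenvectors $v_1,\dots,v_{d_r}$, and let $\varphi_k=(N\tilde\lambda_k)^{-1/2}\sum_j v_k^j y_j$. For $1\le r\le d_r$ let $U^r=\mathrm{span}\{\varphi_1,\dots,\varphi_r\}$, let $P^r$ be the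 projection onto $U^r$ orthogonal for $(\nabla\cdot,\nabla\cdot)$, and let $u_r^\alpha:[0,T^\alpha]\to U^r$ be the solution of the same equation as $u_h^\alpha$ with test functions $v\in U^r$ and with $u_r^\alpha(0)=P^ru_h^\alpha(0)$. \textbf{Theorem.} Let $\gamma_m=\frac1m-\frac1{4m^2}$ and $\beta_m=\gamma_m+\frac1m-\frac{\gamma_m}m$. There is a constant $C>0$, depending only on the curve $\alpha\mapsto T^\alpha$ on $[\alpha_0,\alpha_L]$, $C_p$, $\Lambda$, $q$ and $m$, such that in every setting as above, for all $\alpha\in[\alpha_0,\alpha_L]$, all $t\in[0,T^\alpha]$ and every $l$ with $l+m-1\le L$ and $\alpha\in[\alpha_l,\alpha_{l+m-1}]$, $$\|u_r^\alpha(t)-u_h^\alpha(t)\|_0^2\le C_{m,q}\Bigl(c\,\bigl(\textstyle\sum_{k=r+1}^{d_r}\tilde\lambda_k\bigr)^{1-\gamma_m}+c'\,\bigl(\sum_{k=r+1}^{d_r}\tilde\lambda_k\bigr)^{1-\beta_m}\Bigr)+C^1_{u_h}(\Delta t)^{2q}+C^2_{u_h}(\Delta\alpha)^{2m-1},$$ where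 $C_{m,q}=C((m+1)+qm)$, $$c=A^{(1-\frac1{2m})\frac1m}B^{\frac1m},\quad c'=c^{\,1-\frac1m}B^{\frac2m},\quad A=\max_{0\le j\le M}\bigl\|\mu\mapsto u_h^\mu(jT^\mu/M)\bigr\|_{H^m(\alpha_0,\alpha_L;H^1_0)},\quad B=\max_{0\le l'\le L}\|u_h^{\alpha_{l'}}\|_{H^m(0,T^{l'};H^1_0)},$$ with $H^1_0$ normed by $\|\nabla\cdot\|_0$, and $$C^1_{u_h}=C\sum_{j=l}^{l+m-1}\Bigl(\max_{0\le s\le T^j}\|\partial_t^q\nabla u_h^{\alpha_j}(s)\|_0^2+\int_0^{T^j}\bigl(\|\partial_t^q\nabla u_h^{\alpha_j}\|_0^2+\|\partial_t^{q+1}\nabla u_h^{\alpha_j}\|_0^2\bigr)ds\Bigr),$$ $$C^2_{u_h}=C\int_{\alpha_l}^{\alpha_{l+m-1}}\!\int_0^{T^\mu}\sum_{i+j\le m}\bigl(\|\partial_t^{i+1}\partial_\mu^j\nabla u_h^\mu(s)\|_0^2+\|\partial_t^i\partial_\mu^j\nabla u_h^\mu(s)\|_0^2\bigr)ds\,d\mu+C\int_{\alpha_l}^{\alpha_{l+m-1}}\sum_{i+j\le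 m}\bigl\|\partial_t^i\partial_\mu^j\nabla u_h^\mu(T^\mu t/T^\alpha)\bigr\|_0^2\,d\mu.$$ -/

import Mathlib

open MeasureTheory Set
open scoped ContDiff InnerProductSpace

namespace PODROM

noncomputable section

/-! ### The spaces `L²(Ω)` and `H¹₀(Ω)` -/

/-- The Euclidean space `ℝ^d`. -/
abbrev Space (d : ℕ) : Type := EuclideanSpace ℝ (Fin d)

/-- The Hilbert space `L²(Ω)`. -/
abbrev L2 {d : ℕ} (Ω : Set (Space d)) : Type := Lp ℝ 2 (volume.restrict Ω)

/-- The Hilbert space `L²(Ω; ℝ^d)`. -/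
abbrev L2Vec {d : ℕ} (Ω : Set (Space d)) : Type := Lp (Space d) 2 (volume.restrict Ω)

/-- The pairs `(φ, ∇φ)` in `L²(Ω) × L²(Ω; ℝ^d)`, for `φ` a smooth function with compact support
in `Ω`. -/
def testPairs {d : ℕ} (Ω : Set (Space d)) : Set (WithLp 2 (L2 Ω × L2Vec Ω)) :=
  {p | ∃ φ : Space d → ℝ, ContDiff ℝ ∞ φ ∧ HasCompactSupport φ ∧ tsupport φ ⊆ Ω ∧
    (p.fst : Space d → ℝ) =ᵐ[volume.restrict Ω] φ ∧
    (p.snd : Space d → Space d) =ᵐ[volume.restrict Ω] gradient φ}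

/-- `H¹₀(Ω)`, the completion of the test functions in the `H¹` norm
`(‖φ‖² + ‖∇φ‖²)^(1/2)`. An element is a pair consisting of a function in `L²(Ω)` and its weak
gradient. -/
def H10 {d : ℕ} (Ω : Set (Space d)) : Submodule ℝ (WithLp 2 (L2 Ω × L2Vec Ω)) :=
  (Submodule.span ℝ (testPairs Ω)).topologicalClosure

/-- The underlying `L²(Ω)` function of an element of `H¹₀(Ω)`. -/
def toL2 {d : ℕ} {Ω : Set (Space d)} (v : H10 Ω) : L2 Ω := (v : WithLp 2 (L2 Ω × L2Vec Ω)).fst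

/-- The weak gradient of an element of `H¹₀(Ω)`. -/
def grad {d : ℕ} {Ω : Set (Space d)} (v : H10 Ω) : L2Vec Ω :=
  (v : WithLp 2 (L2 Ω × L2Vec Ω)).snd

/-- `Cp` is a constant in the Poincaré inequality on `H¹₀(Ω)`. -/
def IsPoincareConstant {d : ℕ} (Ω : Set (Space d)) (Cp : ℝ) : Prop :=
  ∀ v : H10 Ω, ‖toL2 v‖ ≤ Cp * ‖grad v‖

/-! ### Finite elements -/

/-- A partition of `Ω` into simplices: a finite geometric simplicial complex which covers the
closure of `Ω`. -/
def IsPartition {d : ℕ} (Ω : Set (Space d)) (K : Geometry.SimplicialComplex ℝ (Space d)) : Prop :=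
  K.faces.Finite ∧ K.space = closure Ω

/-- `w` is (on the closure of `Ω`) a continuous piecewise polynomial of degree at most `k`
that vanishes on the boundary of `Ω`. -/
def IsFEFunction {d : ℕ} (Ω : Set (Space d)) (K : Geometry.SimplicialComplex ℝ (Space d))
    (k : ℕ) (w : Space d → ℝ) : Prop :=
  ContinuousOn w (closure Ω) ∧
  (∀ s ∈ K.faces, ∃ p : MvPolynomial (Fin d) ℝ, p.totalDegree ≤ k ∧
    ∀ x ∈ convexHull ℝ (s : Set (Space d)), w x = MvPolynomial.eval (fun i => x i) p) ∧
  ∀ x ∈ frontier Ω, w x = 0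

/-- The finite element space `V_h^k` of continuous piecewise polynomials of degree at most `k`
with homogeneous Dirichlet boundary conditions, as a subspace of `H¹₀(Ω)`. -/
def feSpace {d : ℕ} (Ω : Set (Space d)) (K : Geometry.SimplicialComplex ℝ (Space d)) (k : ℕ) :
    Submodule ℝ (H10 Ω) where
  carrier := {v | ∃ w : Space d → ℝ, IsFEFunction Ω K k w ∧
    (toL2 v : Space d → ℝ) =ᵐ[volume.restrict Ω] w}
  zero_mem' := by
    refine ⟨0, ⟨continuousOn_const, fun s _ => ⟨0, by simp, by simp⟩, by simp⟩, ?_⟩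
    exact Lp.coeFn_zero ℝ 2 (volume.restrict Ω)
  add_mem' := by
    rintro u v ⟨w, ⟨hw1, hw2, hw3⟩, hw⟩ ⟨z, ⟨hz1, hz2, hz3⟩, hz⟩
    refine ⟨w + z, ⟨hw1.add hz1, fun s hs => ?_, fun x hx => by simp [hw3 x hx, hz3 x hx]⟩, ?_⟩
    · obtain ⟨p, hp, hp'⟩ := hw2 s hs
      obtain ⟨r, hr, hr'⟩ := hz2 s hs
      exact ⟨p + r, (MvPolynomial.totalDegree_add p r).trans (max_le hp hr),
        fun x hx => by simp [hp' x hx, hr' x hx]⟩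
    · exact (Lp.coeFn_add (toL2 u) (toL2 v)).trans (hw.add hz)
  smul_mem' := by
    rintro c v ⟨w, ⟨hw1, hw2, hw3⟩, hw⟩
    refine ⟨c • w, ⟨hw1.const_smul c, fun s hs => ?_, fun x hx => by simp [hw3 x hx]⟩, ?_⟩
    · obtain ⟨p, hp, hp'⟩ := hw2 s hs
      exact ⟨c • p, (MvPolynomial.totalDegree_smul_le c p).trans hp,
        fun x hx => by simp [hp' x hx, MvPolynomial.smul_eval]⟩
    · exact (Lp.coeFn_smul c (toL2 v)).trans (hw.const_smul c)

/-- The Lagrange nodes of degree `k` of the partition: the points `∑ (c_a / k) a` of a simplex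
with vertices `a`, where the `c_a` are natural numbers of sum `k`. -/
def lagrangeNodes {d : ℕ} (K : Geometry.SimplicialComplex ℝ (Space d)) (k : ℕ) : Set (Space d) :=
  {x | ∃ s ∈ K.faces, ∃ c : Space d → ℕ, ∑ a ∈ s, c a = k ∧
    x = ∑ a ∈ s, ((c a : ℝ) / (k : ℝ)) • a}

/-- `v` is the Lagrange interpolant of `φ` and belongs to the finite element space. -/
def IsLagrangeInterpolant {d : ℕ} {Ω : Set (Space d)}
    (K : Geometry.SimplicialComplex ℝ (Space d)) (k : ℕ) (φ : Space d → ℝ) (v : H10 Ω) : Prop :=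
  ∃ w : Space d → ℝ, IsFEFunction Ω K k w ∧
    (toL2 v : Space d → ℝ) =ᵐ[volume.restrict Ω] w ∧ ∀ x ∈ lagrangeNodes K k, w x = φ x

/-! ### Galerkin approximations in a subspace -/

/-- `u : [0, T] → V` solves, for all `t ∈ (0, T]` and all `v ∈ V`,
`(u_t, v) + ν (∇u, ∇v) + (g(u), v) = (f, v)`. -/
def IsGalerkinSolution {d : ℕ} {Ω : Set (Space d)} (V : Submodule ℝ (H10 Ω)) (ν : ℝ) (g : ℝ → ℝ)
    (f : ℝ → L2 Ω) (T : ℝ) (u : ℝ → H10 Ω) : Prop :=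
  (∀ t ∈ Icc 0 T, u t ∈ V) ∧ ContinuousOn u (Icc 0 T) ∧
  ∀ t ∈ Ioc 0 T, ∃ u' : H10 Ω, HasDerivWithinAt u u' (Icc 0 T) t ∧
    ∀ v ∈ V, ⟪toL2 u', toL2 v⟫_ℝ + ν * ⟪grad (u t), grad v⟫_ℝ
      + ∫ x in Ω, g (toL2 (u t) x) * toL2 v x = ⟪f t, toL2 v⟫_ℝ

/-- `w` is the `H¹₀`-orthogonal projection (for `(∇·, ∇·)`) of `v` onto `U`. -/
def IsH10Projection {d : ℕ} {Ω : Set (Space d)} (U : Submodule ℝ (H10 Ω)) (v w : H10 Ω) : Prop :=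
  w ∈ U ∧ ∀ z ∈ U, ⟪grad (v - w), grad z⟫_ℝ = 0

/-! ### Proper orthogonal decomposition -/

/-- The correlation matrix `s_{ij} = (1/N) (∇y_i, ∇y_j)` of `N` snapshots. -/
def correlationMatrix {d : ℕ} {Ω : Set (Space d)} {ι : Type} [Fintype ι] (y : ι → H10 Ω) :
    Matrix ι ι ℝ :=
  Matrix.of fun i j => (1 / (Fintype.card ι : ℝ)) * ⟪grad (y i), grad (y j)⟫_ℝ

/-- A spectral decomposition of a matrix: its eigenvalues in decreasing order, counted with
multiplicity, with orthonormal eigenvectors. -/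
structure SpectralData {ι : Type} [Fintype ι] (S : Matrix ι ι ℝ) where
  eigval : Fin (Fintype.card ι) → ℝ
  eigvec : OrthonormalBasis (Fin (Fintype.card ι)) ℝ (EuclideanSpace ℝ ι)
  antitone : Antitone eigval
  mulVec_eq : ∀ k, S.mulVec (eigvec k).ofLp = eigval k • (eigvec k).ofLp

/-- The number `d_r` of positive eigenvalues. -/
def SpectralData.numPos {ι : Type} [Fintype ι] {S : Matrix ι ι ℝ} (D : SpectralData S) : ℕ :=
  {k : Fin (Fintype.card ι) | 0 < D.eigval k}.ncard

/-- The sum `∑_{k=r+1}^{d_r} λ_k` (here the index starts at `0`). -/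
def SpectralData.tail {ι : Type} [Fintype ι] {S : Matrix ι ι ℝ} (D : SpectralData S) (r : ℕ) : ℝ :=
  ∑ k : Fin (Fintype.card ι), if r ≤ (k : ℕ) ∧ (k : ℕ) < D.numPos then D.eigval k else 0

/-- The POD basis function `φ_k = N^{-1/2} λ_k^{-1/2} ∑_j v_k^j y_j` (used for `λ_k > 0`). -/
def podMode {d : ℕ} {Ω : Set (Space d)} {ι : Type} [Fintype ι] (y : ι → H10 Ω)
    (D : SpectralData (correlationMatrix y)) (k : Fin (Fintype.card ι)) : H10 Ω :=
  (1 / (√(Fintype.card ι : ℝ) * √(D.eigval k))) • ∑ j, D.eigvec k j • y j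

/-- The POD space spanned by the first `r` POD basis functions. -/
def podSpace {d : ℕ} {Ω : Set (Space d)} {ι : Type} [Fintype ι] (y : ι → H10 Ω)
    (D : SpectralData (correlationMatrix y)) (r : ℕ) : Submodule ℝ (H10 Ω) :=
  Submodule.span ℝ {v | ∃ k : Fin (Fintype.card ι), (k : ℕ) < r ∧ v = podMode y D k}

/-! ### Grids and snapshots -/

/-- `Δα = (α_L - α_0) / L`. -/
def dAlpha (α₀ αL : ℝ) (L : ℕ) : ℝ := (αL - α₀) / L

/-- `α_l = α_0 + l Δα`. -/
def alphaNode (α₀ αL : ℝ) (L l : ℕ) : ℝ := α₀ + l * dAlpha α₀ αL L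

/-- `Δt = max_l T^{α_l} / M`. -/
def dTime (α₀ αL : ℝ) (T : ℝ → ℝ) (M L : ℕ) : ℝ :=
  ⨆ l : Fin (L + 1), T (alphaNode α₀ αL L l) / M

/-- The snapshots `u^{α_l}(t_j^l)`, where `t_j^l = j T^{α_l} / M`, `0 ≤ j ≤ M`, `0 ≤ l ≤ L`. -/
def snapshots {X : Type*} (α₀ αL : ℝ) (T : ℝ → ℝ) (M L : ℕ) (u : ℝ → ℝ → X)
    (p : Fin (M + 1) × Fin (L + 1)) : X :=
  u (alphaNode α₀ αL L p.2) ((p.1 : ℝ) * (T (alphaNode α₀ αL L p.2) / M))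

/-- The region `{(α, t) : α ∈ [α_0, α_L], t ∈ [0, T^α]}`. -/
def region (α₀ αL : ℝ) (T : ℝ → ℝ) : Set (ℝ × ℝ) :=
  {p | p.1 ∈ Icc α₀ αL ∧ p.2 ∈ Icc 0 (T p.1)}

/-! ### Derivatives and norms of `u_h` -/

/-- `∂_t^i u^α(t)` on `[0, T]`, for a fixed value of the parameter. -/
def timeDeriv {X : Type*} [NormedAddCommGroup X] [NormedSpace ℝ X] (T : ℝ) (i : ℕ) (u : ℝ → X)
    (t : ℝ) : X :=
  iteratedDerivWithin i u (Icc 0 T) t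

/-- The mixed derivative `∂_t^i ∂_α^j u^α(t)` on the region `I` of the `(α, t)` plane. -/
def mixedDeriv {X : Type*} [NormedAddCommGroup X] [NormedSpace ℝ X] (I : Set (ℝ × ℝ)) (i j : ℕ)
    (u : ℝ → ℝ → X) (α t : ℝ) : X :=
  iteratedFDerivWithin ℝ (i + j) (fun p : ℝ × ℝ => u p.1 p.2) I (α, t)
    (fun k : Fin (i + j) => if (k : ℕ) < i then ((0, 1) : ℝ × ℝ) else (1, 0))

/-- The norm of `H^m(a, b; H¹₀)`, where `H¹₀` has the norm `‖∇·‖`. -/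
def sobolevNorm {d : ℕ} {Ω : Set (Space d)} (m : ℕ) (a b : ℝ) (w : ℝ → H10 Ω) : ℝ :=
  √(∑ i ∈ Finset.range (m + 1), ∫ s in a..b, ‖grad (iteratedDerivWithin i w (Icc a b) s)‖ ^ 2)

/-- `max_l ‖u^{α_l}‖_{H^m(0, T^{α_l}; H¹₀)}`. -/
def timeNorm {d : ℕ} {Ω : Set (Space d)} (m : ℕ) (α₀ αL : ℝ) (T : ℝ → ℝ) (L : ℕ)
    (u : ℝ → ℝ → H10 Ω) : ℝ :=
  ⨆ l : Fin (L + 1),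
    sobolevNorm m 0 (T (alphaNode α₀ αL L l)) (u (alphaNode α₀ αL L l))

/-- `max_j ‖μ ↦ u^μ(j T^μ / M)‖_{H^m(α_0, α_L; H¹₀)}`. -/
def paramNorm {d : ℕ} {Ω : Set (Space d)} (m : ℕ) (α₀ αL : ℝ) (T : ℝ → ℝ) (M : ℕ)
    (u : ℝ → ℝ → H10 Ω) : ℝ :=
  ⨆ j : Fin (M + 1), sobolevNorm m α₀ αL (fun μ => u μ ((j : ℝ) * (T μ / M)))

/-- The exponent `γ_m = 1/m - 1/(4m²)`. -/
def gammaExp (m : ℕ) : ℝ := 1 / (m : ℝ) - 1 / (4 * (m : ℝ) ^ 2)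

/-- The exponent `β_m = γ_m + 1/m - γ_m/m`. -/
def betaExp (m : ℕ) : ℝ := gammaExp m + 1 / (m : ℝ) - gammaExp m / (m : ℝ)

/-- The factor `A^{(1 - 1/(2m))/m} B^{1/m}` of the bound for the snapshots, where `A` and `B` are
the norms of `u` with respect to the parameter and to time. -/
def snapshotFactor {d : ℕ} {Ω : Set (Space d)} (m : ℕ) (α₀ αL : ℝ) (T : ℝ → ℝ) (M L : ℕ)
    (u : ℝ → ℝ → H10 Ω) : ℝ :=
  paramNorm m α₀ αL T M u ^ ((1 - 1 / (2 * (m : ℝ))) * (1 / (m : ℝ)))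
    * timeNorm m α₀ αL T L u ^ (1 / (m : ℝ))

/-- The factor `c^{1 - 1/m} B^{2/m}` of the bound for the difference quotients in time, where `c`
is the factor of the bound for the snapshots. -/
def quotientFactor {d : ℕ} {Ω : Set (Space d)} (m : ℕ) (α₀ αL : ℝ) (T : ℝ → ℝ) (M L : ℕ)
    (u : ℝ → ℝ → H10 Ω) : ℝ :=
  snapshotFactor m α₀ αL T M L u ^ (1 - 1 / (m : ℝ)) * timeNorm m α₀ αL T L u ^ (2 / (m : ℝ))

/-- The norms that multiply `(Δt)^{2q}`: the sum over the nodes `α_j`, `l ≤ j ≤ l + m - 1`, of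
`max_t ‖∂_t^q ∇u^{α_j}(t)‖² + ∫ (‖∂_t^q ∇u^{α_j}‖² + ‖∂_t^{q+1} ∇u^{α_j}‖²) dt`. -/
def timeConst {d : ℕ} {Ω : Set (Space d)} (q m l : ℕ) (α₀ αL : ℝ) (T : ℝ → ℝ) (L : ℕ)
    (u : ℝ → ℝ → H10 Ω) : ℝ :=
  ∑ j ∈ Finset.Icc l (l + m - 1),
    ((⨆ t : Icc (0 : ℝ) (T (alphaNode α₀ αL L j)),
        ‖grad (timeDeriv (T (alphaNode α₀ αL L j)) q (u (alphaNode α₀ αL L j)) t)‖ ^ 2)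
      + ∫ t in (0 : ℝ)..T (alphaNode α₀ αL L j),
        (‖grad (timeDeriv (T (alphaNode α₀ αL L j)) q (u (alphaNode α₀ αL L j)) t)‖ ^ 2
          + ‖grad (timeDeriv (T (alphaNode α₀ αL L j)) (q + 1)
              (u (alphaNode α₀ αL L j)) t)‖ ^ 2))

/-- The norms that multiply `(Δα)^{2m-1}`: the integral over `μ ∈ [α_l, α_{l+m-1}]` and
`t ∈ [0, T^μ]` of `∑_{i+j≤m} (‖∂_t^{i+1} ∂_μ^j ∇u^μ(t)‖² + ‖∂_t^i ∂_μ^j ∇u^μ(t)‖²)`, plus the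
integral over `μ ∈ [α_l, α_{l+m-1}]` of `∑_{i+j≤m} ‖∂_t^i ∂_μ^j ∇u^μ(T^μ s / T^α)‖²`. -/
def paramConst {d : ℕ} {Ω : Set (Space d)} (m l : ℕ) (α₀ αL : ℝ) (T : ℝ → ℝ) (L : ℕ)
    (u : ℝ → ℝ → H10 Ω) (α s : ℝ) : ℝ :=
  (∫ μ in alphaNode α₀ αL L l..alphaNode α₀ αL L (l + m - 1), ∫ t in (0 : ℝ)..T μ,
    ∑ i ∈ Finset.range (m + 1), ∑ j ∈ Finset.range (m + 1 - i),
      (‖grad (mixedDeriv (region α₀ αL T) (i + 1) j u μ t)‖ ^ 2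
        + ‖grad (mixedDeriv (region α₀ αL T) i j u μ t)‖ ^ 2))
  + ∫ μ in alphaNode α₀ αL L l..alphaNode α₀ αL L (l + m - 1),
    ∑ i ∈ Finset.range (m + 1), ∑ j ∈ Finset.range (m + 1 - i),
      ‖grad (mixedDeriv (region α₀ αL T) i j u μ (T μ * s / T α))‖ ^ 2

end

end PODROM

/-!
The error `u_r - u_h` is split with the projection `P` onto the reduced space as
`(u_r - P u_h) + (P u_h - u_h)`. The first part lies in the reduced space and vanishes at time `0`.
Testing the difference of the two equations with it, the term `ν (∇(I - P)u_h, ∇·)` drops out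
because `∇(I - P)u_h` is orthogonal to the gradients of the reduced space; Poincaré and Gronwall
then give, uniformly in `ν` (`norm_sq_galerkin_error_le`), a bound by the norm in `L²(0, T)` of
`Y = ∇(I - P)u_h` and of `∂_t Y`.

What remains is a statement on interpolation for a smooth function `Y` of `(α, t)`
(`exists_projection_error_bound`), in which `I - P` enters in two ways only: it does not increase
`‖∇·‖`, and the mean of `‖Y‖²` over all snapshots is at most the tail `τ` of the eigenvalues
(`mean_norm_sq_sub_podProj_le`). Four steps bound `Y` and `∂_t Y`.

* A discrete Agmon inequality (`exists_discrete_agmon`): the maximum over a uniform grid of a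
  function is bounded by a product of powers of its mean square over the grid and of its `H^m` norm.
  It comes from local interpolation by polynomials on windows of the grid of a length that is
  optimized at the end. Used in the parameter and then in time it bounds every snapshot
  (`exists_snapshot_bound`) by a multiple of `τ^(1 - γ_m)`.
* For a grid parameter, interpolation of degree `q` in time passes from the time nodes to all times,
  at the cost of a remainder with `(Δt)^(2q)` (`exists_pointwise_bound`).
* A discrete Gagliardo–Nirenberg inequality (`exists_discrete_gagliardoNirenberg`) bounds the
  `L²` norm of `∂_t Y` by the values at the nodes and the `H^m` norm, which produces the exponent
  `1 - β_m`.
* For the remaining parameters, `Y` is interpolated at `m` neighbouring grid parameters along the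
  curves `μ ↦ (μ, T^μ s / T^α)`, which stay in the domain. The chain rule bounds the `m`-th
  derivative along the curve by mixed derivatives (`exists_norm_comp_curve_le`), and integration over
  `s` turns the remainder into the double integral that multiplies `(Δα)^(2m-1)`
  (`exists_parameter_interpolation`).
-/

namespace PODROM

/-! ### Interpolation on an interval -/

/-- `F 0, F 1, …, F n` are a function on `[A, B]` and its successive (one-sided at the end points)
derivatives up to order `n`, the last one being continuous. -/
structure IsDerivChain {X : Type*} [NormedAddCommGroup X] [NormedSpace ℝ X]
    (n : ℕ) (F : ℕ → ℝ → X) (A B : ℝ) : Prop where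
  deriv : ∀ i < n, ∀ t ∈ Icc A B, HasDerivWithinAt (F i) (F (i + 1) t) (Icc A B) t
  cont : ContinuousOn (F n) (Icc A B)

namespace IsDerivChain

variable {X : Type*} [NormedAddCommGroup X] [NormedSpace ℝ X] {n : ℕ} {F : ℕ → ℝ → X} {A B : ℝ}

theorem continuousOn (h : IsDerivChain n F A B) {i : ℕ} (hi : i ≤ n) :
    ContinuousOn (F i) (Icc A B) := by
  rcases hi.lt_or_eq with hi | rfl
  · exact fun t ht => (h.deriv i hi t ht).continuousWithinAt
  · exact h.cont

theorem mono (h : IsDerivChain n F A B) {A' B' : ℝ} (hs : Icc A' B' ⊆ Icc A B) :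
    IsDerivChain n F A' B' :=
  ⟨fun i hi t ht => (h.deriv i hi t (hs ht)).mono hs, h.cont.mono hs⟩

theorem tail (h : IsDerivChain (n + 1) F A B) : IsDerivChain n (fun i => F (i + 1)) A B :=
  ⟨fun i hi t ht => h.deriv (i + 1) (by omega) t ht, h.cont⟩

theorem of_le (h : IsDerivChain n F A B) {k : ℕ} (hk : k ≤ n) : IsDerivChain k F A B :=
  ⟨fun i hi t ht => h.deriv i (by omega) t ht, h.continuousOn hk⟩

theorem of_contDiffOn {f : ℝ → X} (hAB : A < B) (h : ContDiffOn ℝ n f (Icc A B)) :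
    IsDerivChain n (fun i => iteratedDerivWithin i f (Icc A B)) A B := by
  refine ⟨fun i hi t ht => ?_, ?_⟩
  · have := (h.differentiableOn_iteratedDerivWithin (m := i) (by exact_mod_cast hi)
      (uniqueDiffOn_Icc hAB)) t ht
    rw [iteratedDerivWithin_succ]
    exact this.hasDerivWithinAt
  · exact h.continuousOn_iteratedDerivWithin le_rfl (uniqueDiffOn_Icc hAB)

theorem integrable_norm_sq (h : IsDerivChain n F A B) {i : ℕ} (hi : i ≤ n) {a b : ℝ}
    (hs : uIcc a b ⊆ Icc A B) : IntervalIntegrable (fun t => ‖F i t‖ ^ 2) volume a b :=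
  (((h.continuousOn hi).mono hs).norm.pow 2).intervalIntegrable

variable [CompleteSpace X]

theorem norm_sub_le (h : IsDerivChain n F A B) (hn : 0 < n) {s t : ℝ} (hs : s ∈ Icc A B)
    (ht : t ∈ Icc A B) : ‖F 0 t - F 0 s‖ ≤ ∫ x in A..B, ‖F 1 x‖ := by
  have hAB : A ≤ B := hs.1.trans hs.2
  wlog hst : s ≤ t generalizing s t
  · rw [norm_sub_rev]; exact this ht hs (le_of_not_ge hst)
  have hsub : Icc s t ⊆ Icc A B := Icc_subset_Icc hs.1 ht.2
  have hc : ContinuousOn (F 1) (Icc A B) := h.continuousOn hn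
  have key : ∫ x in s..t, F 1 x = F 0 t - F 0 s := by
    apply intervalIntegral.integral_eq_sub_of_hasDeriv_right_of_le hst
      ((h.continuousOn (Nat.zero_le n)).mono hsub)
    · intro x hx
      have hxAB : x ∈ Icc A B := hsub (Ioo_subset_Icc_self hx)
      have : HasDerivAt (F 0) (F 1 x) x := (h.deriv 0 hn x hxAB).hasDerivAt
        (Icc_mem_nhds (hs.1.trans_lt hx.1) (hx.2.trans_le ht.2))
      exact this.hasDerivWithinAt
    · exact (hc.mono (by rw [uIcc_of_le hst]; exact hsub)).intervalIntegrable
  rw [← key]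
  refine (intervalIntegral.norm_integral_le_integral_norm hst).trans ?_
  apply intervalIntegral.integral_mono_interval hs.1 hst ht.2
  · exact Filter.Eventually.of_forall fun x => norm_nonneg _
  · exact (hc.norm.mono (by rw [uIcc_of_le hAB])).intervalIntegrable

/-- The remainder of the Taylor polynomial of degree `n` at the left end point is controlled by
the `L¹` norm of the derivative of order `n + 1`. -/
theorem norm_sub_taylor_le (h : IsDerivChain (n + 1) F A B) {t : ℝ} (ht : t ∈ Icc A B) :
    ‖F 0 t - ∑ i ∈ Finset.range (n + 1), ((t - A) ^ i / i.factorial) • F i A‖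
      ≤ (B - A) ^ n * ∫ x in A..B, ‖F (n + 1) x‖ := by
  have hAB : A ≤ B := ht.1.trans ht.2
  induction n generalizing F t with
  | zero => simpa using h.norm_sub_le (by omega) ⟨le_rfl, hAB⟩ ht
  | succ n ih =>
    have IH := fun s hs => ih (t := s) h.tail hs
    set R : ℝ → X :=
      fun t => F 0 t - ∑ i ∈ Finset.range (n + 1 + 1), ((t - A) ^ i / i.factorial) • F i A
    have hR : ∀ s ∈ Icc A B, HasDerivWithinAt R (F 1 s - ∑ i ∈ Finset.range (n + 1),
        ((s - A) ^ i / i.factorial) • F (i + 1) A) (Icc A B) s := by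
      intro s hs
      have h0 := h.deriv 0 (by omega) s hs
      have h1 : HasDerivWithinAt (fun t => ∑ i ∈ Finset.range (n + 1 + 1),
          ((t - A) ^ i / i.factorial) • F i A)
          (∑ i ∈ Finset.range (n + 1), ((s - A) ^ i / i.factorial) • F (i + 1) A)
          (Icc A B) s := by
        simp_rw [Finset.sum_range_succ' _ (n + 1)]
        have : HasDerivWithinAt (fun t => ∑ i ∈ Finset.range (n + 1),
          ((t - A) ^ (i + 1) / (i + 1).factorial) • F (i + 1) A)
          (∑ i ∈ Finset.range (n + 1), ((s - A) ^ i / i.factorial) • F (i + 1) A)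
          (Icc A B) s := by
          apply HasDerivWithinAt.fun_sum
          intro i _
          have h2 : HasDerivAt (fun t : ℝ => (t - A) ^ (i + 1) / (i + 1).factorial)
              ((s - A) ^ i / i.factorial) s := by
            have h3 := (((hasDerivAt_id s).sub_const A).pow (i + 1)).div_const
              ((i + 1).factorial : ℝ)
            refine h3.congr_deriv ?_
            rw [Nat.factorial_succ]
            have : (i.factorial : ℝ) ≠ 0 := by positivity
            have : (i : ℝ) + 1 ≠ 0 := by positivity
            push_cast
            simp only [id]
            field_simp
          exact (h2.hasDerivWithinAt).smul_const _
        simpa using this.add_const (((s - A) ^ 0 / (Nat.factorial 0 : ℝ)) • F 0 A)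
      exact h0.sub h1
    have hb := Convex.norm_image_sub_le_of_norm_hasDerivWithin_le (s := Icc A B) (f := R)
      (C := (B - A) ^ n * ∫ x in A..B, ‖F (n + 1 + 1) x‖) hR (fun s hs => IH s hs)
      (convex_Icc A B) (x := A) (y := t) ⟨le_rfl, hAB⟩ ht
    have hRA : R A = 0 := by
      simp only [R]
      rw [Finset.sum_range_succ']
      simp
    rw [hRA, sub_zero] at hb
    refine hb.trans ?_
    have hI : 0 ≤ ∫ x in A..B, ‖F (n + 1 + 1) x‖ :=
      intervalIntegral.integral_nonneg hAB fun x _ => norm_nonneg _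
    rw [Real.norm_of_nonneg (by linarith [ht.1]), pow_succ]
    have : 0 ≤ (B - A) ^ n := by have : 0 ≤ B - A := by linarith
                                 positivity
    have h4 : t - A ≤ B - A := by linarith [ht.2]
    have := mul_le_mul_of_nonneg_left h4 (mul_nonneg this hI)
    linarith

end IsDerivChain

/-- The values and the derivatives of the Lagrange basis polynomials for the nodes
`0, 1, …, n - 1` are bounded on `[-n, n]`. -/
theorem exists_bound_lagrangeBasis (n : ℕ) : ∃ K : ℝ, 1 ≤ K ∧ ∀ i < n, ∀ s ∈ Icc (-n : ℝ) n,
    |(Lagrange.basis (Finset.range n) (fun j : ℕ => (j : ℝ)) i).eval s| ≤ K ∧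
    |(Lagrange.basis (Finset.range n) (fun j : ℕ => (j : ℝ)) i).derivative.eval s| ≤ K := by
  have h1 : ∀ p : Polynomial ℝ, ∃ K : ℝ, 0 ≤ K ∧ ∀ s ∈ Icc (-n : ℝ) n, |p.eval s| ≤ K := by
    intro p
    obtain ⟨K, hK⟩ := isCompact_Icc.exists_bound_of_continuousOn
      (s := Icc (-n : ℝ) n) (f := fun s => p.eval s) p.continuous.continuousOn
    exact ⟨|K|, abs_nonneg K, fun s hs => (hK s hs).trans (le_abs_self K)⟩
  choose k hk0 hk using h1
  set b := Lagrange.basis (Finset.range n) (fun j : ℕ => (j : ℝ))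
  have hpos : ∀ i, 0 ≤ k (b i) + k (b i).derivative := fun i => add_nonneg (hk0 _) (hk0 _)
  refine ⟨1 + ∑ i ∈ Finset.range n, (k (b i) + k (b i).derivative), ?_, ?_⟩
  · have := Finset.sum_nonneg (s := Finset.range n) fun i _ => hpos i
    linarith
  · intro i hi s hs
    have := Finset.single_le_sum (s := Finset.range n) (fun i _ => hpos i) (Finset.mem_range.2 hi)
    have h2 := hk0 (b i)
    have h3 := hk0 (b i).derivative
    exact ⟨(hk _ s hs).trans (by linarith), (hk _ s hs).trans (by linarith)⟩

/-- Lagrange interpolation with equidistant nodes reproduces the polynomials of degree less than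
the number of nodes, together with their derivatives. -/
theorem lagrange_reproduce {X : Type*} [NormedAddCommGroup X] [NormedSpace ℝ X] (n : ℕ)
    (A y k : ℝ) (v : ℕ → X) (c : ℕ → ℝ) (s : ℝ) :
    (∑ j ∈ Finset.range n, ((y + k * s - A) ^ j * c j) • v j =
      ∑ i ∈ Finset.range n,
        (Lagrange.basis (Finset.range n) (fun j : ℕ => (j : ℝ)) i).eval s •
          ∑ j ∈ Finset.range n, ((y + k * i - A) ^ j * c j) • v j) ∧
    (∑ j ∈ Finset.range n, (k * (j * (y + k * s - A) ^ (j - 1) * c j)) • v j =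
      ∑ i ∈ Finset.range n,
        (Lagrange.basis (Finset.range n) (fun j : ℕ => (j : ℝ)) i).derivative.eval s •
          ∑ j ∈ Finset.range n, ((y + k * i - A) ^ j * c j) • v j) := by
  set b := Lagrange.basis (Finset.range n) (fun j : ℕ => (j : ℝ))
  let p : ℕ → Polynomial ℝ := fun j =>
    (Polynomial.C (y - A) + Polynomial.C k * Polynomial.X) ^ j
  have hp : ∀ j ∈ Finset.range n, p j = ∑ i ∈ Finset.range n,
      Polynomial.C ((y + k * i - A) ^ j) * b i := by
    intro j hj
    have hdeg : (p j).degree < (Finset.range n).card := by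
      rw [Finset.card_range]
      have : (Polynomial.C (y - A) + Polynomial.C k * Polynomial.X).degree ≤ 1 := by
        rw [add_comm]; exact Polynomial.degree_linear_le
      refine (Polynomial.degree_pow_le_of_le j this).trans_lt ?_
      simpa using Finset.mem_range.1 hj
    have hinj : Set.InjOn (fun j : ℕ => (j : ℝ)) (Finset.range n : Set ℕ) :=
      fun a _ b _ hab => by simpa using hab
    have := Lagrange.eq_interpolate (v := fun j : ℕ => (j : ℝ)) hinj hdeg
    rw [Lagrange.interpolate_apply] at this
    rw [this]
    refine Finset.sum_congr rfl fun i _ => ?_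
    congr 2
    simp only [p, Polynomial.eval_pow, Polynomial.eval_add, Polynomial.eval_C, Polynomial.eval_mul,
      Polynomial.eval_X]
    ring
  have e1 : ∀ j ∈ Finset.range n, (y + k * s - A) ^ j =
      ∑ i ∈ Finset.range n, (y + k * i - A) ^ j * (b i).eval s := by
    intro j hj
    have := congrArg (Polynomial.eval s) (hp j hj)
    simp only [p, Polynomial.eval_finsetSum, Polynomial.eval_pow, Polynomial.eval_add,
      Polynomial.eval_C, Polynomial.eval_mul, Polynomial.eval_X] at this
    rw [← this]; ring
  have e2 : ∀ j ∈ Finset.range n, k * (j * (y + k * s - A) ^ (j - 1)) =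
      ∑ i ∈ Finset.range n, (y + k * i - A) ^ j * (b i).derivative.eval s := by
    intro j hj
    have := congrArg (fun q : Polynomial ℝ => q.derivative.eval s) (hp j hj)
    simp only [p, Polynomial.derivative_sum, Polynomial.derivative_C_mul,
      Polynomial.derivative_pow, Polynomial.derivative_add, Polynomial.derivative_C,
      Polynomial.derivative_X, Polynomial.eval_finsetSum, Polynomial.eval_pow, Polynomial.eval_add,
      Polynomial.eval_C, Polynomial.eval_mul, Polynomial.eval_X,
      zero_add, mul_one] at this
    rw [← this]; ring
  constructor
  · rw [Finset.sum_congr rfl fun j hj => by rw [e1 j hj]]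
    simp_rw [Finset.smul_sum, Finset.sum_mul, Finset.sum_smul, smul_smul]
    rw [Finset.sum_comm]
    refine Finset.sum_congr rfl fun i _ => Finset.sum_congr rfl fun j _ => ?_
    congr 1; ring
  · rw [Finset.sum_congr rfl fun j hj => by rw [← mul_assoc, e2 j hj]]
    simp_rw [Finset.smul_sum, Finset.sum_mul, Finset.sum_smul, smul_smul]
    rw [Finset.sum_comm]
    refine Finset.sum_congr rfl fun i _ => Finset.sum_congr rfl fun j _ => ?_
    congr 1; ring

/-- Cauchy–Schwarz for the integral of a continuous function against the constant `1`. -/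
theorem sq_integral_le {f : ℝ → ℝ} {A B : ℝ} (hAB : A ≤ B) (hf : ContinuousOn f (Icc A B)) :
    (∫ t in A..B, f t) ^ 2 ≤ (B - A) * ∫ t in A..B, f t ^ 2 := by
  rcases hAB.eq_or_lt with rfl | hlt
  · simp
  rw [← uIcc_of_le hAB] at hf
  have hi : IntervalIntegrable f volume A B := hf.intervalIntegrable
  have hi2 : IntervalIntegrable (fun t => f t ^ 2) volume A B := (hf.pow 2).intervalIntegrable
  set I := ∫ t in A..B, f t
  have h0 : 0 ≤ ∫ t in A..B, ((B - A) * f t - I) ^ 2 :=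
    intervalIntegral.integral_nonneg hAB fun _ _ => sq_nonneg _
  have h1 : ∫ t in A..B, ((B - A) * f t - I) ^ 2 =
      (B - A) ^ 2 * (∫ t in A..B, f t ^ 2) - (2 * (B - A) * I) * I + (B - A) * I ^ 2 := by
    have : ∀ t, ((B - A) * f t - I) ^ 2 =
        (B - A) ^ 2 * f t ^ 2 - (2 * (B - A) * I) * f t + I ^ 2 := fun t => by ring
    simp_rw [this]
    rw [intervalIntegral.integral_add ((hi2.const_mul _).sub (hi.const_mul _)) (by simp),
      intervalIntegral.integral_sub (hi2.const_mul _) (hi.const_mul _),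
      intervalIntegral.integral_const_mul, intervalIntegral.integral_const_mul]
    simp [I]
  have hpos : 0 < B - A := sub_pos.2 hlt
  rw [h1] at h0
  have h2 : 0 ≤ (B - A) * ((B - A) * (∫ t in A..B, f t ^ 2) - I ^ 2) := by nlinarith
  have := nonneg_of_mul_nonneg_right h2 hpos
  linarith

/-- Interpolation error: a function with `n` derivatives, and `k` times its first derivative, are
controlled on an interval of length at most `n * k` by the values at `n` equidistant nodes with
step `k` and by the derivative of order `n`. -/
theorem exists_interpolation_bound (n : ℕ) (hn : 2 ≤ n) : ∃ K : ℝ, 0 < K ∧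
    ∀ {X : Type} [NormedAddCommGroup X] [NormedSpace ℝ X] [CompleteSpace X]
      {F : ℕ → ℝ → X} {A B y k x : ℝ}, IsDerivChain n F A B → 0 < k → B - A ≤ n * k →
      (∀ i < n, y + k * i ∈ Icc A B) → x ∈ Icc A B →
      ‖F 0 x‖ ^ 2 + k ^ 2 * ‖F 1 x‖ ^ 2 ≤
        K * (∑ i ∈ Finset.range n, ‖F 0 (y + k * i)‖ ^ 2
          + k ^ (2 * n - 1) * ∫ t in A..B, ‖F n t‖ ^ 2) := by
  obtain ⟨K, hK1, hK⟩ := exists_bound_lagrangeBasis n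
  obtain ⟨N, rfl⟩ : ∃ N, n = N + 2 := ⟨n - 2, by omega⟩
  set n := N + 2 with hndef
  refine ⟨2 * (2 * K ^ 2 * n) + 2 * (2 * (1 + n * K) ^ 2 * (n : ℝ) ^ (2 * N + 3)), by positivity,
    ?_⟩
  intro X _ _ _ F A B y k x hF hk hAB hy hx
  have hle : A ≤ B := hx.1.trans hx.2
  set ρ := ∫ t in A..B, ‖F n t‖
  have hρ : 0 ≤ ρ := intervalIntegral.integral_nonneg hle fun _ _ => norm_nonneg _
  set E := ((n : ℝ) * k) ^ (N + 1) * ρ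
  have hE : 0 ≤ E := by positivity
  have hBA : 0 ≤ B - A := by linarith
  -- the Taylor polynomial at `A`, and `k` times its derivative
  let P : ℝ → X := fun t => ∑ j ∈ Finset.range n, ((t - A) ^ j * (1 / (j.factorial : ℝ))) • F j A
  let P' : ℝ → X := fun t =>
    ∑ j ∈ Finset.range n, (k * (j * (t - A) ^ (j - 1) * (1 / (j.factorial : ℝ)))) • F j A
  have hP : ∀ t ∈ Icc A B, ‖F 0 t - P t‖ ≤ E := by
    intro t ht
    have h1 := IsDerivChain.norm_sub_taylor_le (n := N + 1) hF ht
    simp only [div_eq_mul_one_div (_ ^ _ : ℝ)] at h1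
    refine h1.trans (mul_le_mul_of_nonneg_right ?_ hρ)
    exact pow_le_pow_left₀ hBA hAB _
  have hP' : ‖k • F 1 x - P' x‖ ≤ E := by
    have h1 := IsDerivChain.norm_sub_taylor_le (n := N) (F := fun i => F (i + 1)) hF.tail hx
    have h2 : P' x = k • ∑ i ∈ Finset.range (N + 1), ((x - A) ^ i / i.factorial) • F (i + 1) A := by
      simp only [P']
      rw [hndef, Finset.sum_range_succ' _ (N + 1), Finset.smul_sum]
      simp only [Nat.cast_zero, zero_mul, mul_zero, zero_smul, add_zero, smul_smul]
      refine Finset.sum_congr rfl fun i _ => ?_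
      congr 1
      rw [Nat.factorial_succ]
      have : (i.factorial : ℝ) ≠ 0 := by positivity
      have : (i : ℝ) + 1 ≠ 0 := by positivity
      push_cast
      field_simp
    rw [h2, ← smul_sub, norm_smul, Real.norm_of_nonneg hk.le]
    have h3 : (B - A) ^ N ≤ ((n : ℝ) * k) ^ N := pow_le_pow_left₀ hBA hAB _
    have hn1 : (1 : ℝ) ≤ n := by rw [hndef]; push_cast; linarith [(Nat.cast_nonneg N : (0:ℝ) ≤ N)]
    calc k * _ ≤ k * ((B - A) ^ N * ρ) := mul_le_mul_of_nonneg_left h1 hk.le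
      _ ≤ (n * k) * (((n : ℝ) * k) ^ N * ρ) := by gcongr; nlinarith
      _ = E := by simp only [E]; ring
  -- the position of `x` relative to the nodes, in units of the step
  set s := (x - y) / k
  have hxs : y + k * s = x := by simp only [s]; field_simp; ring
  have hs : s ∈ Icc (-n : ℝ) n := by
    have hy0 := hy 0 (by omega)
    simp only [Nat.cast_zero, mul_zero, add_zero] at hy0
    constructor
    · rw [le_div_iff₀ hk]; linarith [hy0.2, hx.1]
    · rw [div_le_iff₀ hk]; linarith [hy0.1, hx.2]
  obtain ⟨e1, e2⟩ := lagrange_reproduce n A y k (fun j => F j A)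
    (fun j => 1 / (j.factorial : ℝ)) s
  rw [hxs] at e1 e2
  set S := ∑ i ∈ Finset.range n, ‖F 0 (y + k * i)‖
  -- both quantities are linear combinations with bounded coefficients of the nodal values
  have hcomb : ∀ (z : X) (a : ℕ → ℝ), (∀ i < n, |a i| ≤ K) →
      ‖z - ∑ i ∈ Finset.range n, a i • P (y + k * i)‖ ≤ E →
      ‖z‖ ^ 2 ≤ 2 * (K * S) ^ 2 + 2 * ((1 + n * K) * E) ^ 2 := by
    intro z a ha hz
    have h1 : ‖∑ i ∈ Finset.range n, a i • P (y + k * i)‖ ≤ K * S + n * K * E := by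
      refine (norm_sum_le _ _).trans ?_
      have : ∀ i ∈ Finset.range n, ‖a i • P (y + k * i)‖ ≤ K * ‖F 0 (y + k * i)‖ + K * E := by
        intro i hi
        have hi' := Finset.mem_range.1 hi
        rw [norm_smul, ← mul_add]
        have h2 : ‖P (y + k * i)‖ ≤ ‖F 0 (y + k * i)‖ + E := by
          have h3 := hP _ (hy i hi')
          have h4 := norm_sub_norm_le (P (y + k * i)) (F 0 (y + k * i))
          rw [norm_sub_rev] at h4
          linarith
        exact mul_le_mul (ha i hi') h2 (norm_nonneg _) (by linarith)
      refine (Finset.sum_le_sum this).trans ?_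
      rw [Finset.sum_add_distrib, ← Finset.mul_sum]
      simp [S, mul_assoc]
    have h2 : ‖z‖ ≤ K * S + (1 + n * K) * E := by
      have := norm_sub_norm_le z (∑ i ∈ Finset.range n, a i • P (y + k * i))
      linarith
    have h3 : ‖z‖ ^ 2 ≤ (K * S + (1 + n * K) * E) ^ 2 := pow_le_pow_left₀ (norm_nonneg _) h2 2
    nlinarith [sq_nonneg (K * S - (1 + n * K) * E)]
  have b1 := hcomb (F 0 x) _ (fun i hi => (hK i hi s hs).1) (by rw [← e1]; exact hP x hx)
  have b2 := hcomb (k • F 1 x) _ (fun i hi => (hK i hi s hs).2) (by rw [← e2]; exact hP')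
  rw [norm_smul, Real.norm_of_nonneg hk.le, mul_pow] at b2
  have hS : S ^ 2 ≤ n * ∑ i ∈ Finset.range n, ‖F 0 (y + k * i)‖ ^ 2 := by
    simpa using sq_sum_le_card_mul_sum_sq (s := Finset.range n)
      (f := fun i : ℕ => ‖F 0 (y + k * i)‖)
  set Q := ∑ i ∈ Finset.range n, ‖F 0 (y + k * i)‖ ^ 2
  set R := ∫ t in A..B, ‖F n t‖ ^ 2
  have hR : 0 ≤ R := intervalIntegral.integral_nonneg hle fun _ _ => sq_nonneg _
  have hQ : 0 ≤ Q := Finset.sum_nonneg fun _ _ => sq_nonneg _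
  have hρ2 : ρ ^ 2 ≤ (n * k) * R :=
    (sq_integral_le hle hF.cont.norm).trans (mul_le_mul_of_nonneg_right hAB hR)
  have hE2 : E ^ 2 ≤ (n : ℝ) ^ (2 * N + 3) * (k ^ (2 * n - 1) * R) := by
    calc E ^ 2 = ((n : ℝ) * k) ^ (2 * N + 2) * ρ ^ 2 := by simp only [E]; ring
      _ ≤ ((n : ℝ) * k) ^ (2 * N + 2) * ((n * k) * R) := by gcongr
      _ = _ := by
        rw [show 2 * n - 1 = 2 * N + 3 by omega]; ring
  calc ‖F 0 x‖ ^ 2 + k ^ 2 * ‖F 1 x‖ ^ 2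
      ≤ 2 * (2 * K ^ 2) * S ^ 2 + 2 * (2 * (1 + n * K) ^ 2) * E ^ 2 := by nlinarith
    _ ≤ 2 * (2 * K ^ 2) * (n * Q) + 2 * (2 * (1 + n * K) ^ 2) *
          ((n : ℝ) ^ (2 * N + 3) * (k ^ (2 * n - 1) * R)) := by gcongr
    _ ≤ _ := by
        have h1 : 0 ≤ (2 * (2 * K ^ 2 * n)) * (k ^ (2 * n - 1) * R) := by positivity
        have h2 : 0 ≤ (2 * (2 * (1 + n * K) ^ 2 * (n : ℝ) ^ (2 * N + 3))) * Q := by positivity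
        linarith

/-! ### Interpolation inequalities on a grid -/

/-- If `y ≤ K (x / δ ^ e + δ ^ (n - e) b)` for all small `δ`, the choice of the best `δ` bounds `y`
by a multiple of `x ^ (1 - e / n) * b ^ (e / n)`; the relation `x ≤ K b` covers the case in which
the best `δ` is not small. -/
theorem le_rpow_mul_rpow_of_forall_le {e n : ℕ} (hen : e < n) {κ K x b y : ℝ}
    (hκ : 0 < κ) (hK : 0 ≤ K) (hx : 0 ≤ x) (hb : 0 ≤ b) (hxb : x ≤ K * b)
    (h : ∀ δ, 0 < δ → δ ≤ κ → y ≤ K * (x / δ ^ e + δ ^ (n - e) * b)) :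
    y ≤ K * (2 + K ^ ((e : ℝ) / n) / κ ^ e) *
      (x ^ (1 - (e : ℝ) / n) * b ^ ((e : ℝ) / n)) := by
  have hn0 : (0 : ℝ) < n := by exact_mod_cast (Nat.zero_le e).trans_lt hen
  set θ : ℝ := (e : ℝ) / n
  have hθ0 : 0 ≤ θ := by positivity
  have hθ1 : θ < 1 := (div_lt_one hn0).2 (by exact_mod_cast hen)
  have hcoef : 0 ≤ K * (2 + K ^ θ / κ ^ e) := by positivity
  rcases hx.eq_or_lt with rfl | hx
  · have hlim : Filter.Tendsto (fun δ : ℝ => K * (0 / δ ^ e + δ ^ (n - e) * b))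
        (nhdsWithin 0 (Ioi 0)) (nhds 0) := by
      have hc : Continuous fun δ : ℝ => K * (δ ^ (n - e) * b) := by fun_prop
      have := (hc.tendsto 0).mono_left (nhdsWithin_le_nhds (s := Ioi 0))
      simpa [zero_pow (show n - e ≠ 0 by omega)] using this
    have : y ≤ 0 := by
      refine ge_of_tendsto hlim ?_
      filter_upwards [Ioc_mem_nhdsGT hκ] with δ hδ using h δ hδ.1 hδ.2
    exact this.trans (by positivity)
  · have hb : 0 < b := by
      by_contra hb0
      have : b = 0 := le_antisymm (not_lt.1 hb0) hb
      rw [this, mul_zero] at hxb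
      linarith
    -- the minimiser of the right hand side, up to a constant
    set δ' := (x / b) ^ (1 / (n : ℝ))
    have hδ' : 0 < δ' := by positivity
    set δ := min κ δ'
    have hδ : 0 < δ := lt_min hκ hδ'
    set G := x ^ (1 - θ) * b ^ θ
    have hp : ∀ j : ℕ, δ' ^ j = (x / b) ^ ((j : ℝ) / n) := by
      intro j
      rw [← Real.rpow_natCast, ← Real.rpow_mul (by positivity)]
      congr 1; ring
    have h1 : x / δ' ^ e = G := by
      rw [hp, Real.div_rpow hx.le hb.le]
      simp only [G]
      rw [Real.rpow_sub hx, Real.rpow_one, div_div_eq_mul_div]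
      ring
    have h2 : δ' ^ (n - e) * b = G := by
      have : ((n - e : ℕ) : ℝ) / n = 1 - θ := by
        rw [Nat.cast_sub hen.le]; simp only [θ]; field_simp
      rw [hp, this, Real.div_rpow hx.le hb.le]
      simp only [G]
      rw [Real.rpow_sub hb, Real.rpow_one]
      have := (Real.rpow_pos_of_pos hb θ).ne'
      field_simp
    have h3 : x / δ ^ e ≤ x / κ ^ e + x / δ' ^ e := by
      rcases min_choice κ δ' with hc | hc <;> simp only [δ, hc]
      · exact le_add_of_nonneg_right (by positivity)
      · exact le_add_of_nonneg_left (by positivity)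
    have h4 : δ ^ (n - e) * b ≤ δ' ^ (n - e) * b := by
      gcongr
      exact min_le_right _ _
    have h5 : x ≤ K ^ θ * G := by
      calc x = x ^ (1 - θ) * x ^ θ := by
            rw [← Real.rpow_add hx]; simp
        _ ≤ x ^ (1 - θ) * (K * b) ^ θ := by gcongr
        _ = K ^ θ * G := by rw [Real.mul_rpow hK hb.le]; simp only [G]; ring
    have h6 : x / κ ^ e ≤ K ^ θ * G / κ ^ e := by gcongr
    have := h δ hδ (min_le_left _ _)
    calc y ≤ K * (x / δ ^ e + δ ^ (n - e) * b) := this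
      _ ≤ K * (K ^ θ * G / κ ^ e + G + G) := by
          gcongr
          · linarith
          · linarith
      _ = _ := by ring

/-- A bound on the integrals over all windows of `W` cells of a grid with `M` cells gives a bound on
the whole integral, as the grid is covered by disjoint windows and one more. -/
theorem integral_le_of_windows {f g : ℝ → ℝ} {M W : ℕ} {h c ε : ℝ} (hW : 1 ≤ W) (hWM : W ≤ M)
    (hh : 0 < h) (hf : ContinuousOn f (Icc 0 (M * h))) (hg : ContinuousOn g (Icc 0 (M * h)))
    (hf0 : ∀ t, 0 ≤ f t) (hg0 : ∀ t, 0 ≤ g t) (hc : 0 ≤ c) (hε : 0 ≤ ε)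
    (hwin : ∀ w : ℕ, w + W ≤ M → ∫ t in (w * h : ℝ)..((w + W : ℕ) * h), f t ≤
      c + ε * ∫ t in (w * h : ℝ)..((w + W : ℕ) * h), g t) :
    ∫ t in (0 : ℝ)..(M * h), f t ≤ 2 * M / W * c + 2 * ε * ∫ t in (0 : ℝ)..(M * h), g t := by
  have hint : ∀ {φ : ℝ → ℝ}, ContinuousOn φ (Icc 0 (M * h)) → ∀ a b : ℕ, a ≤ M → b ≤ M →
      IntervalIntegrable φ volume (a * h) (b * h) := by
    intro φ hφ a b ha hb
    apply ContinuousOn.intervalIntegrable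
    refine hφ.mono ?_
    have : ∀ a : ℕ, a ≤ M → (a * h : ℝ) ∈ Icc 0 (M * h) := fun a ha =>
      ⟨by positivity, by gcongr⟩
    exact uIcc_subset_Icc (this a ha) (this b hb)
  have hmono : ∀ {φ : ℝ → ℝ}, ContinuousOn φ (Icc 0 (M * h)) → (∀ t, 0 ≤ φ t) →
      ∀ a b c d : ℕ, a ≤ b → b ≤ c → c ≤ d → d ≤ M →
      ∫ t in (b * h : ℝ)..(c * h), φ t ≤ ∫ t in (a * h : ℝ)..(d * h), φ t := by
    intro φ hφ h0 a b c d hab hbc hcd hd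
    apply intervalIntegral.integral_mono_interval
    · gcongr
    · gcongr
    · gcongr
    · exact Filter.Eventually.of_forall h0
    · exact hint hφ _ _ (by omega) hd
  set P := M / W
  have hPW : P * W ≤ M := Nat.div_mul_le_self M W
  have hlt : M < (P + 1) * W := by
    rw [add_mul, one_mul]; exact Nat.lt_div_mul_add (by omega)
  have hsum : ∀ {φ : ℝ → ℝ}, ContinuousOn φ (Icc 0 (M * h)) →
      ∑ p ∈ Finset.range P, ∫ t in ((p * W : ℕ) * h : ℝ)..((p * W + W : ℕ) * h), φ t =
        ∫ t in (0 : ℝ)..((P * W : ℕ) * h), φ t := by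
    intro φ hφ
    have := intervalIntegral.sum_integral_adjacent_intervals (f := φ) (μ := volume)
      (a := fun p : ℕ => ((p * W : ℕ) * h : ℝ)) (n := P) (fun k hk => by
        have : (k + 1) * W ≤ P * W := Nat.mul_le_mul_right _ hk
        exact hint hφ _ _ (by nlinarith) (by omega))
    simp only [zero_mul, Nat.cast_zero] at this
    rw [← this]
    refine Finset.sum_congr rfl fun p _ => ?_
    rw [Nat.succ_mul]
  have hz : ∀ φ : ℝ → ℝ, ∫ t in (0 : ℝ)..(M * h), φ t =
      ∫ t in ((0 : ℕ) * h : ℝ)..(M * h), φ t := fun φ => by simp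
  have h1 : ∫ t in (0 : ℝ)..(M * h), f t =
      (∫ t in (0 : ℝ)..((P * W : ℕ) * h), f t) + ∫ t in ((P * W : ℕ) * h : ℝ)..(M * h), f t := by
    rw [intervalIntegral.integral_add_adjacent_intervals]
    · simpa using hint hf 0 (P * W) (by omega) hPW
    · exact hint hf _ _ hPW le_rfl
  have h2 : ∫ t in ((P * W : ℕ) * h : ℝ)..(M * h), f t ≤
      ∫ t in ((M - W : ℕ) * h : ℝ)..(M * h), f t :=
    hmono hf hf0 _ _ _ _ (by rw [add_mul, one_mul] at hlt; omega) hPW le_rfl le_rfl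
  have h3 := hwin (M - W) (by omega)
  rw [Nat.sub_add_cancel hWM] at h3
  have h4 : ∫ t in ((M - W : ℕ) * h : ℝ)..(M * h), g t ≤ ∫ t in (0 : ℝ)..(M * h), g t := by
    rw [hz g]
    exact hmono hg hg0 _ _ _ _ (by omega) (by omega) le_rfl le_rfl
  have h5 : ∫ t in (0 : ℝ)..((P * W : ℕ) * h), f t ≤
      P * c + ε * ∫ t in (0 : ℝ)..(M * h), g t := by
    rw [← hsum hf]
    have : ∀ p ∈ Finset.range P, ∫ t in ((p * W : ℕ) * h : ℝ)..((p * W + W : ℕ) * h), f t ≤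
        c + ε * ∫ t in ((p * W : ℕ) * h : ℝ)..((p * W + W : ℕ) * h), g t := by
      intro p hp
      have : (p + 1) * W ≤ P * W := Nat.mul_le_mul_right _ (Finset.mem_range.1 hp)
      exact hwin (p * W) (by nlinarith)
    refine (Finset.sum_le_sum this).trans ?_
    rw [Finset.sum_add_distrib, ← Finset.mul_sum, hsum hg]
    have h6 : ∫ t in (0 : ℝ)..((P * W : ℕ) * h), g t ≤ ∫ t in (0 : ℝ)..(M * h), g t := by
      rw [hz g]
      simpa using hmono hg hg0 0 0 (P * W) M le_rfl (by omega) hPW le_rfl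
    have := mul_le_mul_of_nonneg_left h6 hε
    simpa using this
  have h7 : (P : ℝ) + 1 ≤ 2 * M / W := by
    have hW0 : (0 : ℝ) < W := by exact_mod_cast hW
    rw [le_div_iff₀ hW0]
    have h8 : ((P * W : ℕ) : ℝ) ≤ M := by exact_mod_cast hPW
    have h9 : (W : ℝ) ≤ M := by exact_mod_cast hWM
    push_cast at h8
    linarith
  have h8 := mul_le_mul_of_nonneg_right h7 hc
  have h9 := mul_le_mul_of_nonneg_left h4 hε
  rw [h1]
  linarith

/-- Sobolev's embedding of `H¹` into the bounded functions on an interval. -/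
theorem norm_sq_le_integral {X : Type} [NormedAddCommGroup X] [NormedSpace ℝ X] [CompleteSpace X]
    {n : ℕ} {F : ℕ → ℝ → X} {A B x : ℝ} (hF : IsDerivChain n F A B) (hn : 0 < n) (hAB : A < B)
    (hx : x ∈ Icc A B) :
    ‖F 0 x‖ ^ 2 ≤ 2 / (B - A) * (∫ t in A..B, ‖F 0 t‖ ^ 2)
      + 2 * (B - A) * ∫ t in A..B, ‖F 1 t‖ ^ 2 := by
  set R := ∫ t in A..B, ‖F 1 t‖ ^ 2
  have hpos : 0 < B - A := sub_pos.2 hAB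
  have h1 : ∀ t ∈ Icc A B, ‖F 0 x‖ ^ 2 ≤ 2 * ‖F 0 t‖ ^ 2 + 2 * (B - A) * R := by
    intro t ht
    have h2 := hF.norm_sub_le hn ht hx
    have h3 := sq_integral_le hAB.le (hF.continuousOn (i := 1) hn).norm
    have h4 := norm_sub_norm_le (F 0 x) (F 0 t)
    set ρ := ∫ t in A..B, ‖F 1 t‖
    have h5 : ‖F 0 x‖ ^ 2 ≤ (‖F 0 t‖ + ρ) ^ 2 :=
      pow_le_pow_left₀ (norm_nonneg _) (by linarith) 2
    nlinarith [sq_nonneg (‖F 0 t‖ - ρ)]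
  have hsub : uIcc A B ⊆ Icc A B := by rw [uIcc_of_le hAB.le]
  have h2 : ∫ _ in A..B, ‖F 0 x‖ ^ 2 ≤ ∫ t in A..B, (2 * ‖F 0 t‖ ^ 2 + 2 * (B - A) * R) :=
    intervalIntegral.integral_mono_on hAB.le (by simp)
      (((hF.integrable_norm_sq (Nat.zero_le _) hsub).const_mul 2).add (by simp)) h1
  rw [intervalIntegral.integral_add
    ((hF.integrable_norm_sq (Nat.zero_le _) hsub).const_mul 2) (by simp),
    intervalIntegral.integral_const_mul, intervalIntegral.integral_const,
    intervalIntegral.integral_const, smul_eq_mul, smul_eq_mul] at h2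
  have h3 : ‖F 0 x‖ ^ 2 ≤ (2 * (∫ t in A..B, ‖F 0 t‖ ^ 2) + (B - A) * (2 * (B - A) * R))
      / (B - A) := by
    rw [le_div_iff₀ hpos]; linarith
  refine h3.trans (le_of_eq ?_)
  field_simp

/-- The first derivative in `L²` from the values at the nodes of a grid of step `T / M`, using
interpolation with `n` nodes of step `S * (T / M)`. -/
theorem exists_integral_deriv_bound (n : ℕ) (hn : 2 ≤ n) : ∃ K : ℝ, 0 < K ∧
    ∀ {X : Type} [NormedAddCommGroup X] [NormedSpace ℝ X] [CompleteSpace X]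
      {F : ℕ → ℝ → X} {h x : ℝ} {M S : ℕ}, IsDerivChain n F 0 (M * h) → 0 < h → 1 ≤ S →
      (n - 1) * S ≤ M → (∀ j ≤ M, ‖F 0 (j * h)‖ ^ 2 ≤ x) →
      ∫ t in (0 : ℝ)..(M * h), ‖F 1 t‖ ^ 2 ≤
        K * ((M * h) * (x / (S * h) ^ 2)
          + (S * h) ^ (2 * n - 2) * ∫ t in (0 : ℝ)..(M * h), ‖F n t‖ ^ 2) := by
  obtain ⟨K, hK0, hK⟩ := exists_interpolation_bound n hn
  refine ⟨2 * K * n, by positivity, ?_⟩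
  intro X _ _ _ F h x M S hF hh hS hSM hx
  have hx0 : 0 ≤ x := (sq_nonneg _).trans (hx 0 (Nat.zero_le _))
  set k : ℝ := S * h
  have hk : 0 < k := by have : (0 : ℝ) < S := by exact_mod_cast hS
                        positivity
  set W := (n - 1) * S
  have hW : 1 ≤ W := Nat.mul_pos (by omega) hS
  have hW0 : (0 : ℝ) < W := by exact_mod_cast hW
  have hWn : (W : ℝ) * h = (n - 1) * k := by
    simp only [W, k]; rw [Nat.cast_mul, Nat.cast_sub (by omega)]; push_cast; ring
  have hn0 : (0 : ℝ) < n := by exact_mod_cast (by omega : 0 < n)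
  have hf : ContinuousOn (fun t => ‖F 1 t‖ ^ 2) (Icc 0 (M * h)) :=
    (hF.continuousOn (by omega)).norm.pow 2
  have hg : ContinuousOn (fun t => ‖F n t‖ ^ 2) (Icc 0 (M * h)) := hF.cont.norm.pow 2
  have main := integral_le_of_windows (f := fun t => ‖F 1 t‖ ^ 2) (g := fun t => ‖F n t‖ ^ 2)
    (c := W * h * (K * (n * x) / k ^ 2)) (ε := W * h * (K * k ^ (2 * n - 1) / k ^ 2)) hW hSM hh
    hf hg (fun _ => sq_nonneg _) (fun _ => sq_nonneg _) (by positivity) (by positivity) ?_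
  · refine main.trans ?_
    set R := ∫ t in (0 : ℝ)..(M * h), ‖F n t‖ ^ 2
    have hR : 0 ≤ R := intervalIntegral.integral_nonneg (by positivity) fun _ _ => sq_nonneg _
    have e1 : 2 * (M : ℝ) / W * (W * h * (K * (n * x) / k ^ 2)) =
        2 * K * n * ((M * h) * (x / k ^ 2)) := by field_simp
    have e2 : 2 * (W * h * (K * k ^ (2 * n - 1) / k ^ 2)) * R =
        2 * K * (n - 1) * (k ^ (2 * n - 2) * R) := by
      rw [hWn, show 2 * n - 1 = (2 * n - 2) + 1 by omega]; field_simp; ring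
    rw [e1, e2, mul_add]
    gcongr
    linarith
  · intro w hw
    set a : ℝ := w * h
    set b : ℝ := (w + W : ℕ) * h
    have hab : b - a = W * h := by simp only [a, b]; push_cast; ring
    have hle : a ≤ b := by have : 0 ≤ W * h := by positivity
                           linarith
    have hsub : Icc a b ⊆ Icc 0 (M * h) := Icc_subset_Icc (by positivity) (by
      simp only [b]; gcongr)
    have hFw := hF.mono hsub
    set R := ∫ t in a..b, ‖F n t‖ ^ 2
    have hpt : ∀ t ∈ Icc a b, ‖F 1 t‖ ^ 2 ≤ (K * (n * x + k ^ (2 * n - 1) * R)) / k ^ 2 := by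
      intro t ht
      have h1 := hK (y := a) hFw hk (by rw [hab, hWn]; nlinarith) (fun i hi => by
        have h2 : (i : ℝ) ≤ n - 1 := by
          have : i + 1 ≤ n := hi
          have : (i : ℝ) + 1 ≤ n := by exact_mod_cast this
          linarith
        refine ⟨by have : 0 ≤ k * i := by positivity
                   linarith, ?_⟩
        have : k * i ≤ k * (n - 1) := by gcongr
        linarith) ht
      have h2 : ∑ i ∈ Finset.range n, ‖F 0 (a + k * i)‖ ^ 2 ≤ n * x := by
        have : ∀ i ∈ Finset.range n, ‖F 0 (a + k * i)‖ ^ 2 ≤ x := by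
          intro i hi
          have hi' := Finset.mem_range.1 hi
          have h3 := hx (w + S * i) (by
            have : S * i ≤ (n - 1) * S := by
              rw [mul_comm]; exact Nat.mul_le_mul_right _ (by omega)
            omega)
          convert h3 using 4
          simp only [a, k]; push_cast; ring
        simpa using Finset.sum_le_sum this
      rw [le_div_iff₀ (by positivity)]
      have h3 : K * (∑ i ∈ Finset.range n, ‖F 0 (a + k * i)‖ ^ 2 + k ^ (2 * n - 1) * R) ≤
          K * (n * x + k ^ (2 * n - 1) * R) := by gcongr
      nlinarith [sq_nonneg ‖F 0 t‖]
    have h4 := intervalIntegral.integral_mono_on hle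
      (hFw.integrable_norm_sq (i := 1) (by omega) (by rw [uIcc_of_le hle])) (by simp) hpt
    rw [intervalIntegral.integral_const, smul_eq_mul, hab] at h4
    refine h4.trans (le_of_eq ?_)
    ring

/-- Discrete Gagliardo–Nirenberg inequality with an interpolation remainder: the `L²` norm of the
first derivative from the values at the nodes of the grid and the norm in `H^m`. The first
interpolation uses steps of the optimal size when this is larger than the step of the grid, and
otherwise interpolation of degree `q` on the grid itself is used. -/
theorem exists_discrete_gagliardoNirenberg (q m : ℕ) (hq : 2 ≤ q) (hm : 2 ≤ m) {T₀ T₁ : ℝ}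
    (hT₀ : 0 < T₀) : ∃ K : ℝ, 0 < K ∧
    ∀ {X : Type} [NormedAddCommGroup X] [NormedSpace ℝ X] [CompleteSpace X]
      {F : ℕ → ℝ → X} {h x b : ℝ} {M : ℕ}, IsDerivChain (max q m + 1) F 0 (M * h) → 0 < h →
      T₀ ≤ M * h → M * h ≤ T₁ → q ≤ M → 0 ≤ x →
      (∀ j ≤ M, ‖F 0 (j * h)‖ ^ 2 ≤ x) →
      (∑ i ∈ Finset.range (m + 1), ∫ t in (0 : ℝ)..(M * h), ‖F i t‖ ^ 2) ≤ b →
      ∫ t in (0 : ℝ)..(M * h), ‖F 1 t‖ ^ 2 ≤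
        K * (x ^ (1 - 1 / (m : ℝ)) * b ^ (1 / (m : ℝ))
          + h ^ (2 * q) * ∫ t in (0 : ℝ)..(M * h), ‖F (q + 1) t‖ ^ 2) := by
  obtain ⟨K₁, hK₁0, hK₁⟩ := exists_integral_deriv_bound m hm
  obtain ⟨K₂, hK₂0, hK₂⟩ := exists_integral_deriv_bound (q + 1) (by omega)
  have hm0 : (0 : ℝ) < m := by exact_mod_cast (by omega : 0 < m)
  set T₂ := max T₁ T₀
  have hT₂ : 0 < T₂ := hT₀.trans_le (le_max_right _ _)
  set K₃ := 2 / T₀ + 2 * T₂ + 4 * K₁ * T₂ + K₁ + K₂ * T₂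
  have hK₃ : 0 < K₃ := by positivity
  set κ := T₀ / m
  have hκ : 0 < κ := by positivity
  set K₄ := K₃ * (2 + K₃ ^ (((2 : ℕ) : ℝ) / ((2 * m : ℕ) : ℝ)) / κ ^ 2)
  have hK₄ : 0 < K₄ := by positivity
  refine ⟨K₄ + K₂, by positivity, ?_⟩
  intro X _ _ _ F h x b M hF hh hT0 hT1 hqM hx0 hx hb
  have hT2 : M * h ≤ T₂ := hT1.trans (le_max_left _ _)
  have hTpos : 0 < M * h := hT₀.trans_le hT0
  have hn0 : ∀ i, 0 ≤ ∫ t in (0 : ℝ)..(M * h), ‖F i t‖ ^ 2 := fun i =>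
    intervalIntegral.integral_nonneg hTpos.le fun _ _ => sq_nonneg _
  have hib : ∀ i ≤ m, ∫ t in (0 : ℝ)..(M * h), ‖F i t‖ ^ 2 ≤ b := fun i hi =>
    (Finset.single_le_sum (f := fun i => ∫ t in (0 : ℝ)..(M * h), ‖F i t‖ ^ 2)
      (fun i _ => hn0 i) (Finset.mem_range.2 (by omega))).trans hb
  have hb0 : 0 ≤ b := (hn0 0).trans (hib 0 (by omega))
  -- the largest nodal value is comparable with the `H¹` norm
  obtain ⟨j₀, hj₀, hmax⟩ := Finset.exists_max_image (Finset.range (M + 1))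
    (fun j : ℕ => ‖F 0 (j * h)‖ ^ 2) ⟨0, by simp⟩
  set x₀ := ‖F 0 (j₀ * h)‖ ^ 2
  have hx₀ : ∀ j ≤ M, ‖F 0 (j * h)‖ ^ 2 ≤ x₀ := fun j hj =>
    hmax j (Finset.mem_range.2 (by omega))
  have hj₀' : j₀ ≤ M := by have := Finset.mem_range.1 hj₀; omega
  have hx₀x : x₀ ≤ x := hx j₀ hj₀'
  have hx₀0 : 0 ≤ x₀ := sq_nonneg _
  have hx₀b : x₀ ≤ K₃ * b := by
    have h1 := norm_sq_le_integral hF (by omega) hTpos (x := j₀ * h)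
      ⟨by positivity, by gcongr⟩
    rw [sub_zero] at h1
    have h2 : 2 / (M * h) ≤ 2 / T₀ := by gcongr
    calc x₀ ≤ 2 / (M * h) * (∫ t in (0 : ℝ)..(M * h), ‖F 0 t‖ ^ 2)
          + 2 * (M * h) * ∫ t in (0 : ℝ)..(M * h), ‖F 1 t‖ ^ 2 := h1
      _ ≤ 2 / T₀ * b + 2 * T₂ * b := by
          gcongr
          · exact hn0 0
          · exact hib 0 (by omega)
          · exact hn0 1
          · exact hib 1 (by omega)
      _ ≤ K₃ * b := by
          have : 0 ≤ (4 * K₁ * T₂ + K₁ + K₂ * T₂) * b := by positivity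
          simp only [K₃]; linarith
  set y := ∫ t in (0 : ℝ)..(M * h), ‖F 1 t‖ ^ 2
  set R := ∫ t in (0 : ℝ)..(M * h), ‖F (q + 1) t‖ ^ 2
  have hR0 : 0 ≤ R := hn0 _
  -- `δ` is the step of the interpolation; below the step `h` of the grid, interpolation on the grid
  -- itself is used, whose remainder is the term that is subtracted
  have hopt : ∀ δ, 0 < δ → δ ≤ κ → y - K₂ * (h ^ (2 * q) * R) ≤
      K₃ * (x₀ / δ ^ 2 + δ ^ (2 * m - 2) * b) := by
    intro δ hδ hδκ
    have hP : 0 ≤ x₀ / δ ^ 2 := by positivity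
    have hQ : 0 ≤ δ ^ (2 * m - 2) * b := by positivity
    rcases lt_or_ge δ h with hlt | hge
    · have h1 := hK₂ (S := 1) (hF.of_le (by omega)) hh le_rfl (by omega) hx₀
      simp only [Nat.cast_one, one_mul] at h1
      rw [show 2 * (q + 1) - 2 = 2 * q by omega, mul_add] at h1
      have h2 : x₀ / h ^ 2 ≤ x₀ / δ ^ 2 := by gcongr
      have h3 : K₂ * (M * h * (x₀ / h ^ 2)) ≤ K₂ * (T₂ * (x₀ / δ ^ 2)) := by gcongr
      have h4 : 0 ≤ (2 / T₀ + 2 * T₂ + 4 * K₁ * T₂ + K₁) * (x₀ / δ ^ 2) := by positivity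
      have h5 : 0 ≤ K₃ * (δ ^ (2 * m - 2) * b) := by positivity
      simp only [K₃] at h5 ⊢
      linarith
    · set S := ⌊δ / h⌋₊
      have hS1 : 1 ≤ S := Nat.le_floor (by rw [Nat.cast_one, le_div_iff₀ hh]; linarith)
      have hS0 : (1 : ℝ) ≤ S := by exact_mod_cast hS1
      have hSle : S * h ≤ δ := by
        have := Nat.floor_le (show 0 ≤ δ / h by positivity)
        rwa [le_div_iff₀ hh] at this
      have hSge : δ / 2 ≤ S * h := by
        have := Nat.lt_floor_add_one (δ / h)
        rw [div_lt_iff₀ hh] at this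
        have h2 : ((⌊δ / h⌋₊ : ℕ) : ℝ) = S := rfl
        rw [h2] at this
        nlinarith
      have hSM : (m - 1) * S ≤ M := by
        have h1 : (m : ℝ) * (S * h) ≤ M * h := by
          calc (m : ℝ) * (S * h) ≤ m * κ := by gcongr; linarith
            _ = T₀ := by simp only [κ]; field_simp
            _ ≤ M * h := hT0
        have h2 : (m : ℝ) * S ≤ M := by
          rw [← mul_assoc] at h1
          exact le_of_mul_le_mul_right h1 hh
        have h3 : m * S ≤ M := by exact_mod_cast h2
        exact (Nat.mul_le_mul_right _ (by omega)).trans h3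
      have h1 := hK₁ (S := S) (hF.of_le (by omega)) hh hS1 hSM hx₀
      have h2 : x₀ / (S * h) ^ 2 ≤ 4 * (x₀ / δ ^ 2) := by
        calc x₀ / (S * h) ^ 2 ≤ x₀ / (δ / 2) ^ 2 := by gcongr
          _ = _ := by field_simp; ring
      have h3 : y ≤ K₁ * (T₂ * (4 * (x₀ / δ ^ 2)) + δ ^ (2 * m - 2) * b) := by
        refine h1.trans ?_
        gcongr
        · exact hn0 m
        · exact hib m le_rfl
      have h4 : 0 ≤ (2 / T₀ + 2 * T₂ + K₁ + K₂ * T₂) * (x₀ / δ ^ 2) := by positivity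
      have h5 : 0 ≤ (2 / T₀ + 2 * T₂ + 4 * K₁ * T₂ + K₂ * T₂) * (δ ^ (2 * m - 2) * b) := by
        positivity
      have h6 : 0 ≤ K₂ * (h ^ (2 * q) * R) := by positivity
      simp only [K₃]
      linarith
  have hfin := le_rpow_mul_rpow_of_forall_le (e := 2) (n := 2 * m) (by omega) hκ hK₃.le hx₀0 hb0
    hx₀b hopt
  have he : ((2 : ℕ) : ℝ) / ((2 * m : ℕ) : ℝ) = 1 / (m : ℝ) := by push_cast; field_simp
  change y - K₂ * (h ^ (2 * q) * R) ≤ K₄ * _ at hfin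
  rw [he] at hfin
  have hexp : 0 ≤ 1 - 1 / (m : ℝ) := by
    rw [sub_nonneg, div_le_one hm0]; exact_mod_cast (by omega : 1 ≤ m)
  have h1 : K₄ * (x₀ ^ (1 - 1 / (m : ℝ)) * b ^ (1 / (m : ℝ))) ≤
      K₄ * (x ^ (1 - 1 / (m : ℝ)) * b ^ (1 / (m : ℝ))) := by gcongr
  have h2 : 0 ≤ K₄ * (h ^ (2 * q) * R) := by positivity
  have h3 : 0 ≤ K₂ * (x ^ (1 - 1 / (m : ℝ)) * b ^ (1 / (m : ℝ))) := by positivity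
  linarith

/-- Interpolation in time: the values at all times from those at the nodes of the grid. -/
theorem exists_pointwise_bound (q : ℕ) (hq : 2 ≤ q) (T₁ : ℝ) : ∃ K : ℝ, 0 < K ∧
    ∀ {X : Type} [NormedAddCommGroup X] [NormedSpace ℝ X] [CompleteSpace X]
      {F : ℕ → ℝ → X} {h x t : ℝ} {M : ℕ}, IsDerivChain (q + 1) F 0 (M * h) → 0 < h →
      M * h ≤ T₁ → q ≤ M → (∀ j ≤ M, ‖F 0 (j * h)‖ ^ 2 ≤ x) → t ∈ Icc 0 (M * h) →
      ‖F 0 t‖ ^ 2 ≤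
        K * (x + h ^ (2 * q) * ∫ t in (0 : ℝ)..(M * h), ‖F (q + 1) t‖ ^ 2) := by
  obtain ⟨K, hK0, hK⟩ := exists_interpolation_bound (q + 1) (by omega)
  set T₂ := max T₁ 1
  have hT₂ : 0 < T₂ := one_pos.trans_le (le_max_right _ _)
  refine ⟨K * ((q + 1 : ℕ) + T₂), by positivity, ?_⟩
  intro X _ _ _ F h x t M hF hh hT1 hqM hx ht
  have hx0 : 0 ≤ x := (sq_nonneg _).trans (hx 0 (Nat.zero_le _))
  have hhT : h ≤ T₂ := by
    have : (1 : ℝ) ≤ M := by exact_mod_cast (by omega : 1 ≤ M)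
    calc h ≤ M * h := by nlinarith
      _ ≤ T₂ := hT1.trans (le_max_left _ _)
  -- a window of `q` cells that contains `t`
  obtain ⟨w, hw, hwt⟩ : ∃ w : ℕ, w + q ≤ M ∧ t ∈ Icc (w * h : ℝ) ((w + q : ℕ) * h) := by
    have hfl := Nat.floor_le (show 0 ≤ t / h from div_nonneg ht.1 hh.le)
    have hlt := Nat.lt_floor_add_one (t / h)
    rw [le_div_iff₀ hh] at hfl
    rw [div_lt_iff₀ hh] at hlt
    rcases le_total ⌊t / h⌋₊ (M - q) with hc | hc
    · refine ⟨⌊t / h⌋₊, by omega, hfl, hlt.le.trans ?_⟩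
      have : (1 : ℝ) ≤ q := by exact_mod_cast (by omega : 1 ≤ q)
      push_cast
      gcongr
    · refine ⟨M - q, by omega, ?_, ?_⟩
      · refine le_trans ?_ hfl
        gcongr
      · rw [Nat.sub_add_cancel hqM]; exact ht.2
  set a : ℝ := w * h
  set b : ℝ := (w + q : ℕ) * h
  have hab : b - a = q * h := by simp only [a, b]; push_cast; ring
  have hsub : Icc a b ⊆ Icc 0 (M * h) := Icc_subset_Icc (by positivity) (by
    simp only [b]; gcongr)
  have h1 := hK (y := a) (hF.mono hsub) hh (by rw [hab]; push_cast; linarith) (fun i hi => by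
    have h2 : (i : ℝ) ≤ q := by exact_mod_cast (by omega : i ≤ q)
    refine ⟨by have : 0 ≤ h * i := by positivity
               linarith, ?_⟩
    have : h * i ≤ h * q := by gcongr
    linarith) hwt
  have h2 : ∑ i ∈ Finset.range (q + 1), ‖F 0 (a + h * i)‖ ^ 2 ≤ (q + 1 : ℕ) * x := by
    have : ∀ i ∈ Finset.range (q + 1), ‖F 0 (a + h * i)‖ ^ 2 ≤ x := by
      intro i hi
      have h3 := hx (w + i) (by have := Finset.mem_range.1 hi; omega)
      convert h3 using 4
      simp only [a]; push_cast; ring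
    simpa using Finset.sum_le_sum this
  have hle : a ≤ b := hwt.1.trans hwt.2
  have h3 : ∫ t in a..b, ‖F (q + 1) t‖ ^ 2 ≤ ∫ t in (0 : ℝ)..(M * h), ‖F (q + 1) t‖ ^ 2 := by
    apply intervalIntegral.integral_mono_interval (by positivity) hle
      (by simp only [b]; gcongr)
    · exact Filter.Eventually.of_forall fun _ => sq_nonneg _
    · exact hF.integrable_norm_sq le_rfl (by rw [uIcc_of_le (by positivity)])
  set R := ∫ t in (0 : ℝ)..(M * h), ‖F (q + 1) t‖ ^ 2
  have hR : 0 ≤ R := intervalIntegral.integral_nonneg (by positivity) fun _ _ => sq_nonneg _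
  have h4 : h ^ (2 * (q + 1) - 1) ≤ T₂ * h ^ (2 * q) := by
    rw [show 2 * (q + 1) - 1 = 2 * q + 1 by omega, pow_succ, mul_comm]
    gcongr
  have hI0 : 0 ≤ ∫ t in a..b, ‖F (q + 1) t‖ ^ 2 :=
    intervalIntegral.integral_nonneg hle fun _ _ => sq_nonneg _
  calc ‖F 0 t‖ ^ 2 ≤ ‖F 0 t‖ ^ 2 + h ^ 2 * ‖F 1 t‖ ^ 2 := le_add_of_nonneg_right (by positivity)
    _ ≤ _ := h1
    _ ≤ K * ((q + 1 : ℕ) * x + (T₂ * h ^ (2 * q)) * R) := by gcongr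
    _ ≤ _ := by
      have h5 : 0 ≤ K * ((q + 1 : ℕ) * (h ^ (2 * q) * R)) := by positivity
      have h6 : 0 ≤ K * (T₂ * x) := by positivity
      linarith

/-- A nodal value from the average of all of them, using interpolation with `m` nodes of
step `S * h`, averaged over the `S` possible positions of the first node. -/
theorem exists_node_bound (m : ℕ) (hm : 2 ≤ m) : ∃ K : ℝ, 0 < K ∧
    ∀ {X : Type} [NormedAddCommGroup X] [NormedSpace ℝ X] [CompleteSpace X]
      {F : ℕ → ℝ → X} {A h : ℝ} {M S j : ℕ}, IsDerivChain m F A (A + M * h) → 0 < h → 1 ≤ S →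
      m * S ≤ M → j ≤ M →
      ‖F 0 (A + j * h)‖ ^ 2 ≤
        K * ((1 / S) * (∑ i ∈ Finset.range (M + 1), ‖F 0 (A + i * h)‖ ^ 2)
          + (S * h) ^ (2 * m - 1) * ∫ t in A..(A + M * h), ‖F m t‖ ^ 2) := by
  obtain ⟨K, hK0, hK⟩ := exists_interpolation_bound m hm
  refine ⟨K, hK0, ?_⟩
  intro X _ _ _ F A h M S j hF hh hS hSM hj
  have hS0 : (0 : ℝ) < S := by exact_mod_cast hS
  set k : ℝ := S * h
  have hk : 0 < k := by positivity
  -- a window of `m * S` cells that contains the node `j`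
  set w := min j (M - m * S)
  have hw1 : w ≤ j := min_le_left _ _
  have hw2 : w + m * S ≤ M := by
    have := min_le_right j (M - m * S)
    omega
  have hw3 : j ≤ w + m * S := by
    rcases min_choice j (M - m * S) with hc | hc
    · have : w = j := hc
      omega
    · have : w = M - m * S := hc
      omega
  set a : ℝ := A + w * h
  set b : ℝ := A + (w + m * S : ℕ) * h
  have hab : b - a = m * k := by simp only [a, b, k]; push_cast; ring
  have hsub : Icc a b ⊆ Icc A (A + M * h) :=
    Icc_subset_Icc (by simp only [a]; linarith [show 0 ≤ w * h by positivity])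
      (by simp only [b]; gcongr)
  have hle : a ≤ b := by have : 0 ≤ m * k := by positivity
                         linarith
  set R := ∫ t in A..(A + M * h), ‖F m t‖ ^ 2
  have hRw : ∫ t in a..b, ‖F m t‖ ^ 2 ≤ R := by
    have hMh : 0 ≤ M * h := by positivity
    apply intervalIntegral.integral_mono_interval
      (by simp only [a]; linarith [show 0 ≤ w * h by positivity]) hle
      (by simp only [b]; gcongr)
    · exact Filter.Eventually.of_forall fun _ => sq_nonneg _
    · exact hF.integrable_norm_sq le_rfl (by rw [uIcc_of_le (by linarith)])
  have hnode : ∀ i ≤ m * S, A + (w + i : ℕ) * h ∈ Icc a b := by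
    intro i hi
    constructor
    · simp only [a]; gcongr; omega
    · simp only [b]; gcongr
  have hstep : ∀ o ∈ Finset.range S, ‖F 0 (A + j * h)‖ ^ 2 ≤
      K * (∑ i ∈ Finset.range m, ‖F 0 (A + (w + (o + S * i) : ℕ) * h)‖ ^ 2
        + k ^ (2 * m - 1) * R) := by
    intro o ho
    have ho' := Finset.mem_range.1 ho
    have hidx : ∀ i < m, o + S * i ≤ m * S := by
      intro i hi
      have : S * (i + 1) ≤ S * m := Nat.mul_le_mul_left _ hi
      rw [mul_comm m S]
      nlinarith
    have hval : ∀ i : ℕ, A + (w + o : ℕ) * h + k * i = A + (w + (o + S * i) : ℕ) * h := by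
      intro i; simp only [k]; push_cast; ring
    have h1 := hK (y := A + (w + o : ℕ) * h) (x := A + j * h) (hF.mono hsub) hk hab.le
      (fun i hi => by rw [hval]; exact hnode _ (hidx i hi)) (by
        have := hnode (j - w) (by omega)
        rwa [show w + (j - w) = j by omega] at this)
    simp_rw [hval] at h1
    have h2 : 0 ≤ k ^ 2 * ‖F 1 (A + j * h)‖ ^ 2 := by positivity
    refine (le_add_of_nonneg_right h2).trans (h1.trans ?_)
    gcongr
  have hsum := Finset.sum_le_sum hstep
  rw [Finset.sum_const, Finset.card_range, nsmul_eq_mul, ← Finset.mul_sum,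
    Finset.sum_add_distrib, Finset.sum_const, Finset.card_range, nsmul_eq_mul] at hsum
  -- the nodes used for different positions of the first one are all different
  have hcount : ∑ o ∈ Finset.range S, ∑ i ∈ Finset.range m,
      ‖F 0 (A + (w + (o + S * i) : ℕ) * h)‖ ^ 2 ≤
      ∑ i ∈ Finset.range (M + 1), ‖F 0 (A + i * h)‖ ^ 2 := by
    rw [← Finset.sum_product' (f := fun o i => ‖F 0 (A + (w + (o + S * i) : ℕ) * h)‖ ^ 2)]
    have hinj : Set.InjOn (fun p : ℕ × ℕ => w + (p.1 + S * p.2))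
        (Finset.range S ×ˢ Finset.range m : Finset (ℕ × ℕ)) := by
      rintro ⟨o, i⟩ hp ⟨o', i'⟩ hp' heq
      simp only [Finset.coe_product, Set.mem_prod, Finset.mem_coe, Finset.mem_range] at hp hp'
      simp only [add_right_inj] at heq
      have h1 : o = o' := by
        have := congrArg (· % S) heq
        simpa [Nat.add_mul_mod_self_left, Nat.mod_eq_of_lt hp.1, Nat.mod_eq_of_lt hp'.1] using this
      subst h1
      have h2 : S * i = S * i' := by omega
      rw [Nat.eq_of_mul_eq_mul_left hS h2]
    rw [← Finset.sum_image (f := fun i : ℕ => ‖F 0 (A + i * h)‖ ^ 2) hinj]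
    refine Finset.sum_le_sum_of_subset_of_nonneg ?_ fun _ _ _ => sq_nonneg _
    intro i hi
    obtain ⟨⟨o, i⟩, hp, rfl⟩ := Finset.mem_image.1 hi
    simp only [Finset.mem_product, Finset.mem_range] at hp ⊢
    have : S * (i + 1) ≤ S * m := Nat.mul_le_mul_left _ hp.2
    have : o + S * i ≤ m * S := by rw [mul_comm m S]; nlinarith [hp.1]
    omega
  have hfin : S * ‖F 0 (A + j * h)‖ ^ 2 ≤
      K * ((∑ i ∈ Finset.range (M + 1), ‖F 0 (A + i * h)‖ ^ 2) + S * (k ^ (2 * m - 1) * R)) :=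
    hsum.trans (by gcongr)
  calc ‖F 0 (A + j * h)‖ ^ 2 = (1 / S) * (S * ‖F 0 (A + j * h)‖ ^ 2) := by field_simp
    _ ≤ (1 / S) * (K * ((∑ i ∈ Finset.range (M + 1), ‖F 0 (A + i * h)‖ ^ 2)
          + S * (k ^ (2 * m - 1) * R))) := by gcongr
    _ = _ := by
      rw [mul_left_comm, mul_add, ← mul_assoc (1 / (S : ℝ)) S, one_div_mul_cancel hS0.ne', one_mul]

/-- Discrete Agmon inequality: the nodal values from their mean square and the norm in `H^m`. -/
theorem exists_discrete_agmon (m : ℕ) (hm : 2 ≤ m) {T₀ T₁ : ℝ} (hT₀ : 0 < T₀) : ∃ K : ℝ, 0 < K ∧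
    ∀ {X : Type} [NormedAddCommGroup X] [NormedSpace ℝ X] [CompleteSpace X]
      {F : ℕ → ℝ → X} {A h b : ℝ} {M j : ℕ}, IsDerivChain m F A (A + M * h) → 0 < h →
      T₀ ≤ M * h → M * h ≤ T₁ → 1 ≤ M → j ≤ M →
      (∑ i ∈ Finset.range (m + 1), ∫ t in A..(A + M * h), ‖F i t‖ ^ 2) ≤ b →
      ‖F 0 (A + j * h)‖ ^ 2 ≤
        K * (((1 / (M + 1 : ℝ)) * ∑ i ∈ Finset.range (M + 1), ‖F 0 (A + i * h)‖ ^ 2)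
          ^ (1 - 1 / (2 * m : ℝ)) * b ^ (1 / (2 * m : ℝ))) := by
  obtain ⟨K₁, hK₁0, hK₁⟩ := exists_node_bound m hm
  have hm0 : (0 : ℝ) < m := by exact_mod_cast (by omega : 0 < m)
  set T₂ := max T₁ T₀
  have hT₂ : 0 < T₂ := hT₀.trans_le (le_max_right _ _)
  set K₃ := 2 / T₀ + 2 * T₂ + 4 * K₁ * T₂ + K₁ + 2 * T₂
  have hK₃ : 0 < K₃ := by positivity
  set κ := T₀ / m
  have hκ : 0 < κ := by positivity
  set K₄ := K₃ * (2 + K₃ ^ (((1 : ℕ) : ℝ) / ((2 * m : ℕ) : ℝ)) / κ ^ 1)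
  have hK₄ : 0 < K₄ := by positivity
  refine ⟨K₄, hK₄, ?_⟩
  intro X _ _ _ F A h b M j hF hh hT0 hT1 hM hj hb
  have hT2 : M * h ≤ T₂ := hT1.trans (le_max_left _ _)
  have hTpos : 0 < M * h := hT₀.trans_le hT0
  have hM0 : (1 : ℝ) ≤ M := by exact_mod_cast hM
  have hAB : A < A + M * h := by linarith
  have hn0 : ∀ i, 0 ≤ ∫ t in A..(A + M * h), ‖F i t‖ ^ 2 := fun i =>
    intervalIntegral.integral_nonneg hAB.le fun _ _ => sq_nonneg _
  have hib : ∀ i ≤ m, ∫ t in A..(A + M * h), ‖F i t‖ ^ 2 ≤ b := fun i hi =>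
    (Finset.single_le_sum (f := fun i => ∫ t in A..(A + M * h), ‖F i t‖ ^ 2)
      (fun i _ => hn0 i) (Finset.mem_range.2 (by omega))).trans hb
  have hb0 : 0 ≤ b := (hn0 0).trans (hib 0 (by omega))
  set Q := ∑ i ∈ Finset.range (M + 1), ‖F 0 (A + i * h)‖ ^ 2
  have hQ0 : 0 ≤ Q := Finset.sum_nonneg fun _ _ => sq_nonneg _
  set x := (1 / (M + 1 : ℝ)) * Q
  have hx0 : 0 ≤ x := by positivity
  have hQx : Q = (M + 1) * x := by simp only [x]; field_simp
  have hnode : ∀ i ≤ M, ‖F 0 (A + i * h)‖ ^ 2 ≤ K₃ * b := by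
    intro i hi
    have h1 := norm_sq_le_integral hF (by omega) hAB (x := A + i * h)
      ⟨by linarith [show 0 ≤ i * h by positivity], by gcongr⟩
    rw [add_sub_cancel_left] at h1
    have h2 : 2 / (M * h) ≤ 2 / T₀ := by gcongr
    calc _ ≤ _ := h1
      _ ≤ 2 / T₀ * b + 2 * T₂ * b := by
          gcongr
          · exact hn0 0
          · exact hib 0 (by omega)
          · exact hn0 1
          · exact hib 1 (by omega)
      _ ≤ K₃ * b := by
          have : 0 ≤ (4 * K₁ * T₂ + K₁ + 2 * T₂) * b := by positivity
          simp only [K₃]; linarith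
  have hxb : x ≤ K₃ * b := by
    have h1 : Q ≤ (M + 1) * (K₃ * b) := by
      have := Finset.sum_le_sum (s := Finset.range (M + 1)) fun i hi =>
        hnode i (by have := Finset.mem_range.1 hi; omega)
      simpa using this
    rw [hQx] at h1
    exact le_of_mul_le_mul_left h1 (by positivity)
  set y := ‖F 0 (A + j * h)‖ ^ 2
  -- `δ` is the step of the interpolation, up to a factor of at most two
  have hopt : ∀ δ, 0 < δ → δ ≤ κ → y ≤ K₃ * (x / δ ^ 1 + δ ^ (2 * m - 1) * b) := by
    intro δ hδ hδκ
    rw [pow_one]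
    have hP : 0 ≤ x / δ := by positivity
    have hM1 : (M + 1 : ℝ) ≤ 2 * M := by linarith
    rcases lt_or_ge δ h with hlt | hge
    -- below the step of the grid, each term is bounded by the sum
    · have h1 : y ≤ Q := Finset.single_le_sum (f := fun i : ℕ => ‖F 0 (A + i * h)‖ ^ 2)
        (fun _ _ => sq_nonneg _) (Finset.mem_range.2 (by omega))
      have h2 : Q ≤ 2 * T₂ * (x / δ) := by
        calc Q = (M + 1) * x := hQx
          _ ≤ (2 * M) * x := by gcongr
          _ = 2 * (M * h) * (x / h) := by field_simp
          _ ≤ 2 * T₂ * (x / δ) := by gcongr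
      have h4 : 0 ≤ (2 / T₀ + 2 * T₂ + 4 * K₁ * T₂ + K₁) * (x / δ) := by positivity
      have h5 : 0 ≤ K₃ * (δ ^ (2 * m - 1) * b) := by positivity
      simp only [K₃] at h5 ⊢
      linarith
    · set S := ⌊δ / h⌋₊
      have hS1 : 1 ≤ S := Nat.le_floor (by rw [Nat.cast_one, le_div_iff₀ hh]; linarith)
      have hS0 : (1 : ℝ) ≤ S := by exact_mod_cast hS1
      have hSle : S * h ≤ δ := by
        have := Nat.floor_le (show 0 ≤ δ / h by positivity)
        rwa [le_div_iff₀ hh] at this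
      have hSge : δ / 2 ≤ S * h := by
        have := Nat.lt_floor_add_one (δ / h)
        rw [div_lt_iff₀ hh] at this
        have h2 : ((⌊δ / h⌋₊ : ℕ) : ℝ) = S := rfl
        rw [h2] at this
        nlinarith
      have hSM : m * S ≤ M := by
        have h1 : (m : ℝ) * (S * h) ≤ M * h := by
          calc (m : ℝ) * (S * h) ≤ m * κ := by gcongr; linarith
            _ = T₀ := by simp only [κ]; field_simp
            _ ≤ M * h := hT0
        have h2 : (m : ℝ) * S ≤ M := by
          rw [← mul_assoc] at h1
          exact le_of_mul_le_mul_right h1 hh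
        exact_mod_cast h2
      have h1 := hK₁ (S := S) (j := j) hF hh hS1 hSM hj
      have h2 : 1 / S * Q ≤ T₂ * (4 * (x / δ)) := by
        calc 1 / S * Q = (M + 1) * x / S := by rw [hQx]; ring
          _ ≤ (2 * M) * x / S := by gcongr
          _ = 2 * (M * h) * (x / (S * h)) := by field_simp
          _ ≤ 2 * T₂ * (x / (δ / 2)) := by gcongr
          _ = _ := by field_simp; ring
      have h3 : y ≤ K₁ * (T₂ * (4 * (x / δ)) + δ ^ (2 * m - 1) * b) := by
        refine h1.trans ?_
        gcongr
        · exact hn0 m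
        · exact hib m le_rfl
      have h4 : 0 ≤ (2 / T₀ + 2 * T₂ + K₁ + 2 * T₂) * (x / δ) := by positivity
      have h5 : 0 ≤ (2 / T₀ + 2 * T₂ + 4 * K₁ * T₂ + 2 * T₂) * (δ ^ (2 * m - 1) * b) := by
        positivity
      simp only [K₃]
      linarith
  have hfin := le_rpow_mul_rpow_of_forall_le (e := 1) (n := 2 * m) (by omega) hκ hK₃.le hx0 hb0
    hxb hopt
  have he : ((1 : ℕ) : ℝ) / ((2 * m : ℕ) : ℝ) = 1 / (2 * m : ℝ) := by push_cast; rfl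
  change y ≤ K₄ * _ at hfin
  rw [he] at hfin
  exact hfin

/-! ### The region of the parameter and the time -/

section Region

variable {α₀ αL : ℝ} {T : ℝ → ℝ}

/-- The map which straightens the region: it sends the rectangle `[α₀, αL] × [0, 1]` to it. -/
def regionMap (T : ℝ → ℝ) (p : ℝ × ℝ) : ℝ × ℝ := (p.1, T p.1 * p.2)

theorem regionMap_mem (hTpos : ∀ α ∈ Icc α₀ αL, 0 < T α) {p : ℝ × ℝ}
    (hp : p ∈ Icc α₀ αL ×ˢ Icc (0 : ℝ) 1) : regionMap T p ∈ region α₀ αL T := by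
  have h := hTpos p.1 hp.1
  exact ⟨hp.1, mul_nonneg h.le hp.2.1, mul_le_of_le_one_right h.le hp.2.2⟩

theorem image_regionMap (hTpos : ∀ α ∈ Icc α₀ αL, 0 < T α) :
    regionMap T '' (Icc α₀ αL ×ˢ Icc (0 : ℝ) 1) = region α₀ αL T := by
  apply Subset.antisymm
  · rintro _ ⟨p, hp, rfl⟩
    exact regionMap_mem hTpos hp
  · rintro ⟨a, t⟩ ⟨ha, ht⟩
    have h := hTpos a ha
    refine ⟨(a, t / T a), ⟨ha, div_nonneg ht.1 h.le, (div_le_one h).2 ht.2⟩, ?_⟩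
    simp only [regionMap]
    rw [mul_div_cancel₀ _ h.ne']

theorem continuousOn_regionMap (hT : ContinuousOn T (Icc α₀ αL)) :
    ContinuousOn (regionMap T) (Icc α₀ αL ×ˢ Icc (0 : ℝ) 1) :=
  continuousOn_fst.prodMk ((hT.comp continuousOn_fst fun _ hp => hp.1).mul continuousOn_snd)

/-- The region is the image of a rectangle under a map whose derivative is onto, as `T` does not
vanish. -/
theorem uniqueDiffOn_region (hα : α₀ < αL) (hT : ContDiffOn ℝ ∞ T (Icc α₀ αL))
    (hTpos : ∀ α ∈ Icc α₀ αL, 0 < T α) : UniqueDiffOn ℝ (region α₀ αL T) := by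
  rw [← image_regionMap hTpos]
  have hderiv : ∀ p ∈ Icc α₀ αL ×ˢ Icc (0 : ℝ) 1, HasFDerivWithinAt (regionMap T)
      ((ContinuousLinearMap.fst ℝ ℝ ℝ).prod
        (T p.1 • ContinuousLinearMap.snd ℝ ℝ ℝ +
          p.2 • (fderivWithin ℝ T (Icc α₀ αL) p.1).comp (ContinuousLinearMap.fst ℝ ℝ ℝ)))
      (Icc α₀ αL ×ˢ Icc (0 : ℝ) 1) p := by
    intro p hp
    have h1 : HasFDerivWithinAt T (fderivWithin ℝ T (Icc α₀ αL) p.1) (Icc α₀ αL) p.1 :=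
      ((hT.differentiableOn (by simp)) p.1 hp.1).hasFDerivWithinAt
    have h2 : HasFDerivWithinAt (fun p : ℝ × ℝ => T p.1)
        ((fderivWithin ℝ T (Icc α₀ αL) p.1).comp (ContinuousLinearMap.fst ℝ ℝ ℝ))
        (Icc α₀ αL ×ˢ Icc (0 : ℝ) 1) p :=
      HasFDerivWithinAt.comp p h1 hasFDerivWithinAt_fst fun _ hq => hq.1
    exact hasFDerivWithinAt_fst.prodMk (h2.mul hasFDerivWithinAt_snd)
  refine UniqueDiffOn.image ((uniqueDiffOn_Icc hα).prod (uniqueDiffOn_Icc one_pos)) hderiv ?_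
  intro p hp
  refine Function.Surjective.denseRange fun y => ?_
  have h := (hTpos p.1 hp.1).ne'
  refine ⟨(y.1, (y.2 - p.2 * fderivWithin ℝ T (Icc α₀ αL) p.1 y.1) / T p.1), ?_⟩
  ext
  · simp
  · simp only [ContinuousLinearMap.prod_apply, _root_.add_apply,
      _root_.smul_apply, ContinuousLinearMap.comp_apply,
      ContinuousLinearMap.coe_fst', ContinuousLinearMap.coe_snd', smul_eq_mul]
    field_simp
    ring

/-- Symmetry of the second derivatives at the boundary points of the region rests on this. -/
theorem region_subset_closure_interior (hα : α₀ < αL) (hT : ContinuousOn T (Icc α₀ αL))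
    (hTpos : ∀ α ∈ Icc α₀ αL, 0 < T α) :
    region α₀ αL T ⊆ closure (interior (region α₀ αL T)) := by
  have hopen : IsOpen {p : ℝ × ℝ | p.1 ∈ Ioo α₀ αL ∧ p.2 ∈ Ioo 0 (T p.1)} := by
    have hc : ContinuousOn (fun p : ℝ × ℝ => T p.1 - p.2) (Ioo α₀ αL ×ˢ univ) :=
      ((hT.mono Ioo_subset_Icc_self).comp continuousOn_fst fun _ hp => hp.1).sub continuousOn_snd
    have h1 := hc.isOpen_inter_preimage (isOpen_Ioo.prod isOpen_univ) (isOpen_Ioi (a := (0 : ℝ)))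
    have h2 : IsOpen {p : ℝ × ℝ | 0 < p.2} := isOpen_lt continuous_const continuous_snd
    convert h1.inter h2 using 1
    ext p
    simp only [mem_ofPred_eq, mem_inter_iff, mem_prod, mem_univ, and_true, mem_preimage, mem_Ioi,
      sub_pos, mem_Ioo]
    tauto
  have hsub : {p : ℝ × ℝ | p.1 ∈ Ioo α₀ αL ∧ p.2 ∈ Ioo 0 (T p.1)} ⊆ interior (region α₀ αL T) :=
    interior_maximal (fun p hp => ⟨Ioo_subset_Icc_self hp.1, Ioo_subset_Icc_self hp.2⟩) hopen
  have hcl : closure (Ioo α₀ αL ×ˢ Ioo (0 : ℝ) 1) = Icc α₀ αL ×ˢ Icc (0 : ℝ) 1 := by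
    rw [closure_prod_eq, closure_Ioo hα.ne, closure_Ioo one_pos.ne]
  rw [← image_regionMap hTpos, ← hcl]
  have hc := continuousOn_regionMap hT
  rw [← hcl] at hc
  refine hc.image_closure.trans (closure_mono ?_)
  rw [hcl, image_regionMap hTpos]
  refine Subset.trans ?_ hsub
  rintro _ ⟨p, hp, rfl⟩
  have h := hTpos p.1 (Ioo_subset_Icc_self hp.1)
  exact ⟨hp.1, mul_pos h hp.2.1, mul_lt_of_lt_one_right h hp.2.2⟩

/-- Rescaling the integral over a time interval to `[0, 1]`. -/
theorem integral_eq_mul_integral_unit (f : ℝ → ℝ) (c : ℝ) :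
    ∫ t in (0 : ℝ)..c, f t = c * ∫ s in (0 : ℝ)..1, f (c * s) := by
  have := intervalIntegral.mul_integral_comp_mul_left (a := 0) (b := 1) (f := f) (c := c)
  rw [this]; simp

/-- A continuous function on the region, transported to the rectangle, extends to a continuous
function on the plane. -/
theorem exists_continuous_extension (hα : α₀ ≤ αL) (hT : ContinuousOn T (Icc α₀ αL))
    (hTpos : ∀ α ∈ Icc α₀ αL, 0 < T α)
    {Φ : ℝ × ℝ → ℝ} (hΦ : ContinuousOn Φ (region α₀ αL T)) :
    ∃ Ψ : ℝ × ℝ → ℝ, Continuous Ψ ∧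
      ∀ μ ∈ Icc α₀ αL, ∀ s ∈ Icc (0 : ℝ) 1, Ψ (μ, s) = Φ (μ, T μ * s) := by
  refine ⟨fun p => Φ (regionMap T ((projIcc α₀ αL hα p.1 : ℝ), (projIcc 0 1 zero_le_one p.2 : ℝ))),
    ?_, ?_⟩
  · have h1 : ContinuousOn (Φ ∘ regionMap T) (Icc α₀ αL ×ˢ Icc (0 : ℝ) 1) :=
      hΦ.comp (continuousOn_regionMap hT) fun p hp => regionMap_mem hTpos hp
    refine h1.comp_continuous (f := fun p : ℝ × ℝ =>
      ((projIcc α₀ αL hα p.1 : ℝ), (projIcc 0 1 zero_le_one p.2 : ℝ))) ?_ fun p => ?_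
    · exact ((continuous_subtype_val.comp continuous_projIcc).comp continuous_fst).prodMk
        ((continuous_subtype_val.comp continuous_projIcc).comp continuous_snd)
    · exact ⟨(projIcc α₀ αL hα p.1).2, (projIcc 0 1 zero_le_one p.2).2⟩
  · intro μ hμ s hs
    simp only [regionMap, projIcc_of_mem hα hμ, projIcc_of_mem zero_le_one hs]

theorem continuousOn_integral_time (hα : α₀ ≤ αL) (hT : ContinuousOn T (Icc α₀ αL))
    (hTpos : ∀ α ∈ Icc α₀ αL, 0 < T α)
    {Φ : ℝ × ℝ → ℝ} (hΦ : ContinuousOn Φ (region α₀ αL T)) :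
    ContinuousOn (fun μ => ∫ t in (0 : ℝ)..T μ, Φ (μ, t)) (Icc α₀ αL) := by
  obtain ⟨Ψ, hΨ, hΨΦ⟩ := exists_continuous_extension hα hT hTpos hΦ
  have h1 : Continuous fun μ => ∫ s in (0 : ℝ)..1, Ψ (μ, s) :=
    intervalIntegral.continuous_parametric_intervalIntegral_of_continuous'
      (f := fun μ s => Ψ (μ, s)) hΨ 0 1
  refine (hT.mul h1.continuousOn).congr fun μ hμ => ?_
  rw [integral_eq_mul_integral_unit, Pi.mul_apply]
  congr 1
  refine intervalIntegral.integral_congr fun s hs => ?_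
  rw [uIcc_of_le zero_le_one] at hs
  exact (hΨΦ μ hμ s hs).symm

theorem continuousOn_comp_curve (hT : ContinuousOn T (Icc α₀ αL))
    (hTpos : ∀ α ∈ Icc α₀ αL, 0 < T α)
    {Φ : ℝ × ℝ → ℝ} (hΦ : ContinuousOn Φ (region α₀ αL T)) {α s : ℝ}
    (hα' : α ∈ Icc α₀ αL) (hs : s ∈ Icc 0 (T α)) :
    ContinuousOn (fun μ => Φ (μ, T μ * s / T α)) (Icc α₀ αL) := by
  have h := hTpos α hα'
  refine hΦ.comp (continuousOn_id.prodMk ((hT.mul continuousOn_const).div_const _)) fun μ hμ => ?_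
  have := regionMap_mem hTpos (p := (μ, s / T α))
    ⟨hμ, div_nonneg hs.1 h.le, (div_le_one h).2 hs.2⟩
  simpa only [regionMap, mul_div_assoc, id, Pi.mul_apply] using this

/-- Fubini's theorem for the family of curves `μ ↦ (μ, T μ * s / T α)`, `s ∈ [0, T α]`, which
fill the region. -/
theorem exists_integral_curves_le (hα : α₀ ≤ αL) (hT : ContinuousOn T (Icc α₀ αL))
    (hTpos : ∀ α ∈ Icc α₀ αL, 0 < T α) : ∃ K : ℝ, 0 < K ∧ ∀ {Φ : ℝ × ℝ → ℝ} {α a b : ℝ},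
    ContinuousOn Φ (region α₀ αL T) → (∀ p, 0 ≤ Φ p) → α ∈ Icc α₀ αL → a ≤ b →
    Icc a b ⊆ Icc α₀ αL →
    IntervalIntegrable (fun s => ∫ μ in a..b, Φ (μ, T μ * s / T α)) volume 0 (T α) ∧
    ∫ s in (0 : ℝ)..T α, ∫ μ in a..b, Φ (μ, T μ * s / T α) ≤
      K * ∫ μ in a..b, ∫ t in (0 : ℝ)..T μ, Φ (μ, t) := by
  obtain ⟨μ₀, hμ₀, hmin⟩ := isCompact_Icc.exists_isMinOn (nonempty_Icc.2 hα) hT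
  obtain ⟨μ₁, hμ₁, hmax⟩ := isCompact_Icc.exists_isMaxOn (nonempty_Icc.2 hα) hT
  have h0 := hTpos μ₀ hμ₀
  have h1 := hTpos μ₁ hμ₁
  refine ⟨T μ₁ / T μ₀, by positivity, ?_⟩
  intro Φ α a b hΦ hΦ0 hα' hab hsub
  obtain ⟨Ψ, hΨ, hΨΦ⟩ := exists_continuous_extension hα hT hTpos hΦ
  have hTα := hTpos α hα'
  have hinner : ∀ s ∈ Icc (0 : ℝ) (T α), ∫ μ in a..b, Φ (μ, T μ * s / T α) =
      ∫ μ in a..b, Ψ (μ, s / T α) := by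
    intro s hs
    refine intervalIntegral.integral_congr fun μ hμ => ?_
    rw [uIcc_of_le hab] at hμ
    rw [hΨΦ μ (hsub hμ) _ ⟨div_nonneg hs.1 hTα.le, (div_le_one hTα).2 hs.2⟩, mul_div_assoc]
  have hcont : Continuous fun s => ∫ μ in a..b, Ψ (μ, s / T α) :=
    intervalIntegral.continuous_parametric_intervalIntegral_of_continuous'
      (f := fun s μ => Ψ (μ, s / T α)) (by
        refine hΨ.comp (continuous_snd.prodMk ?_)
        exact continuous_fst.div_const _) a b
  constructor
  · apply ContinuousOn.intervalIntegrable
    rw [uIcc_of_le hTα.le]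
    exact hcont.continuousOn.congr hinner
  have e1 : ∫ s in (0 : ℝ)..T α, ∫ μ in a..b, Φ (μ, T μ * s / T α) =
      T α * ∫ s in (0 : ℝ)..1, ∫ μ in a..b, Ψ (μ, s) := by
    rw [intervalIntegral.integral_congr (g := fun s => ∫ μ in a..b, Ψ (μ, s / T α))
      (fun s hs => hinner s (by rwa [uIcc_of_le hTα.le] at hs)), integral_eq_mul_integral_unit]
    simp_rw [mul_div_cancel_left₀ _ hTα.ne']
  have e2 : ∫ s in (0 : ℝ)..1, ∫ μ in a..b, Ψ (μ, s) = ∫ μ in a..b, ∫ s in (0 : ℝ)..1, Ψ (μ, s) := by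
    refine MeasureTheory.intervalIntegral_intervalIntegral_swap (F := fun s μ => Ψ (μ, s)) ?_
    have hc : Continuous (Function.uncurry fun s μ => Ψ (μ, s)) :=
      hΨ.comp (continuous_snd.prodMk continuous_fst)
    have hI := hc.continuousOn.integrableOn_compact (μ := volume)
      (isCompact_uIcc.prod isCompact_uIcc : IsCompact (uIcc (0 : ℝ) 1 ×ˢ uIcc a b))
    exact hI.mono_set (prod_mono (uIoc_subset_uIcc (a := (0 : ℝ)) (b := 1))
      (uIoc_subset_uIcc (a := a) (b := b)))
  have e3 : ∀ μ ∈ Icc a b, ∫ t in (0 : ℝ)..T μ, Φ (μ, t) = T μ * ∫ s in (0 : ℝ)..1, Ψ (μ, s) := by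
    intro μ hμ
    rw [integral_eq_mul_integral_unit]
    congr 1
    refine intervalIntegral.integral_congr fun s hs => ?_
    rw [uIcc_of_le zero_le_one] at hs
    exact (hΨΦ μ (hsub hμ) s hs).symm
  have hcont2 : Continuous fun μ => ∫ s in (0 : ℝ)..1, Ψ (μ, s) :=
    intervalIntegral.continuous_parametric_intervalIntegral_of_continuous'
      (f := fun μ s => Ψ (μ, s)) hΨ 0 1
  rw [e1, e2, ← intervalIntegral.integral_const_mul, ← intervalIntegral.integral_const_mul]
  refine intervalIntegral.integral_mono_on hab ((hcont2.intervalIntegrable a b).const_mul (T α))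
    ?_ ?_
  · apply ContinuousOn.intervalIntegrable
    rw [uIcc_of_le hab]
    exact continuousOn_const.mul ((continuousOn_integral_time hα hT hTpos hΦ).mono hsub)
  · intro μ hμ
    have hTμ := hTpos μ (hsub hμ)
    have hpos : 0 ≤ ∫ s in (0 : ℝ)..1, Ψ (μ, s) :=
      intervalIntegral.integral_nonneg zero_le_one fun s hs => by
        rw [hΨΦ μ (hsub hμ) s hs]; exact hΦ0 _
    rw [e3 μ hμ]
    have h2 : T α ≤ T μ₁ := hmax hα'
    have h3 : T μ₀ ≤ T μ := hmin (hsub hμ)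
    calc T α * ∫ s in (0 : ℝ)..1, Ψ (μ, s) ≤ T μ₁ * ∫ s in (0 : ℝ)..1, Ψ (μ, s) := by gcongr
      _ = T μ₁ / T μ₀ * (T μ₀ * ∫ s in (0 : ℝ)..1, Ψ (μ, s)) := by field_simp
      _ ≤ _ := by gcongr

end Region

/-! ### Mixed derivatives -/

section Mixed

variable {X : Type} [NormedAddCommGroup X] [NormedSpace ℝ X] {I : Set (ℝ × ℝ)}

/-- The directions of differentiation in `∂_t^i ∂_μ^(n-i)`: first `i` times the direction of the
time, then the direction of the parameter. -/
def mixedDir (n i : ℕ) : Fin n → ℝ × ℝ := fun k => if (k : ℕ) < i then (0, 1) else (1, 0)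

theorem mixedDir_succ_zero (n : ℕ) :
    mixedDir (n + 1) 0 = Fin.cons ((1, 0) : ℝ × ℝ) (mixedDir n 0) := by
  ext k : 1
  refine Fin.cases ?_ (fun k => ?_) k <;> simp [mixedDir]

theorem mixedDir_succ_succ (n i : ℕ) :
    mixedDir (n + 1) (i + 1) = Fin.cons ((0, 1) : ℝ × ℝ) (mixedDir n i) := by
  ext k : 1
  refine Fin.cases ?_ (fun k => ?_) k <;> simp [mixedDir]

theorem iteratedFDerivWithin_cons {n : ℕ} {V : ℝ × ℝ → X} (hI : UniqueDiffOn ℝ I)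
    (hV : ContDiffOn ℝ ((n + 1 : ℕ) : WithTop ℕ∞) V I) {p : ℝ × ℝ} (hp : p ∈ I) (a : ℝ × ℝ)
    (w : Fin n → ℝ × ℝ) :
    iteratedFDerivWithin ℝ (n + 1) V I p (Fin.cons a w) =
      fderivWithin ℝ (fun x => iteratedFDerivWithin ℝ n V I x w) I p a := by
  have hd : DifferentiableWithinAt ℝ (iteratedFDerivWithin ℝ n V I) I p :=
    hV.differentiableOn_iteratedFDerivWithin (by exact_mod_cast Nat.lt_succ_self n) hI p hp
  have h := ((ContinuousMultilinearMap.apply ℝ (fun _ : Fin n => ℝ × ℝ) X w).hasFDerivAt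
    (x := iteratedFDerivWithin ℝ n V I p)).comp_hasFDerivWithinAt p hd.hasFDerivWithinAt
  have h2 : fderivWithin ℝ (fun x => iteratedFDerivWithin ℝ n V I x w) I p = _ :=
    h.fderivWithin (hI p hp)
  rw [h2, iteratedFDerivWithin_succ_apply_left]
  simp

/-- Neighbouring directions can be exchanged. -/
theorem iteratedFDerivWithin_cons_cons {n : ℕ} {V : ℝ × ℝ → X} (hI : UniqueDiffOn ℝ I)
    (hcl : I ⊆ closure (interior I)) (hV : ContDiffOn ℝ ((n + 1 + 1 : ℕ) : WithTop ℕ∞) V I)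
    {p : ℝ × ℝ} (hp : p ∈ I) (a b : ℝ × ℝ) (w : Fin n → ℝ × ℝ) :
    iteratedFDerivWithin ℝ (n + 1 + 1) V I p (Fin.cons a (Fin.cons b w)) =
      iteratedFDerivWithin ℝ (n + 1 + 1) V I p (Fin.cons b (Fin.cons a w)) := by
  have hV1 : ContDiffOn ℝ ((n + 1 : ℕ) : WithTop ℕ∞) V I :=
    hV.of_le (by exact_mod_cast Nat.le_succ _)
  set U : ℝ × ℝ → X := fun x => iteratedFDerivWithin ℝ n V I x w
  have hU : ContDiffOn ℝ 2 U I := by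
    have h1 : ContDiffOn ℝ 2 (iteratedFDerivWithin ℝ n V I) I :=
      fun x hx => ContDiffWithinAt.iteratedFDerivWithin_right (hV x hx) hI (by
        have : ((2 + n : ℕ) : WithTop ℕ∞) ≤ ((n + 1 + 1 : ℕ) : WithTop ℕ∞) := by
          exact_mod_cast (by omega : 2 + n ≤ n + 1 + 1)
        exact_mod_cast this) hx
    exact (ContinuousMultilinearMap.apply ℝ (fun _ : Fin n => ℝ × ℝ) X w).contDiff.comp_contDiffOn h1
  have hstep : ∀ a b : ℝ × ℝ,
      iteratedFDerivWithin ℝ (n + 1 + 1) V I p (Fin.cons a (Fin.cons b w)) =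
        fderivWithin ℝ (fderivWithin ℝ U I) I p a b := by
    intro a b
    rw [iteratedFDerivWithin_cons hI hV hp]
    have h1 : fderivWithin ℝ
        (fun x => iteratedFDerivWithin ℝ (n + 1) V I x (Fin.cons b w)) I p =
        fderivWithin ℝ (fun x => fderivWithin ℝ U I x b) I p :=
      fderivWithin_congr (fun x hx => iteratedFDerivWithin_cons hI hV1 hx b w)
        (iteratedFDerivWithin_cons hI hV1 hp b w)
    rw [h1]
    have hd : DifferentiableWithinAt ℝ (fderivWithin ℝ U I) I p :=
      (hU.fderivWithin hI (m := 1) (by norm_num)).differentiableOn (by simp) p hp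
    have h := ((ContinuousLinearMap.apply ℝ X b).hasFDerivAt
      (x := fderivWithin ℝ U I p)).comp_hasFDerivWithinAt p hd.hasFDerivWithinAt
    have h2 : fderivWithin ℝ (fun x => fderivWithin ℝ U I x b) I p = _ :=
      h.fderivWithin (hI p hp)
    rw [h2]
    simp
  rw [hstep, hstep]
  exact (hU p hp).isSymmSndFDerivWithinAt (by simp) hI (hcl hp) hp a b

/-- By symmetry of the derivatives, a derivative in the parameter may be taken last. -/
theorem iteratedFDerivWithin_cons_mixedDir {n : ℕ} {V : ℝ × ℝ → X} (hI : UniqueDiffOn ℝ I)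
    (hcl : I ⊆ closure (interior I)) (hV : ContDiffOn ℝ ((n + 1 : ℕ) : WithTop ℕ∞) V I)
    {i : ℕ} (hi : i ≤ n) {p : ℝ × ℝ} (hp : p ∈ I) :
    iteratedFDerivWithin ℝ (n + 1) V I p (Fin.cons (1, 0) (mixedDir n i)) =
      iteratedFDerivWithin ℝ (n + 1) V I p (mixedDir (n + 1) i) := by
  induction i generalizing n p with
  | zero => rw [mixedDir_succ_zero]
  | succ i ih =>
    obtain ⟨n, rfl⟩ : ∃ k, n = k + 1 := ⟨n - 1, by omega⟩
    have hV1 : ContDiffOn ℝ ((n + 1 : ℕ) : WithTop ℕ∞) V I :=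
      hV.of_le (by exact_mod_cast Nat.le_succ _)
    have h := fun x hx => ih (n := n) hV1 (by omega) (p := x) hx
    rw [mixedDir_succ_succ n i, iteratedFDerivWithin_cons_cons hI hcl hV hp,
      mixedDir_succ_succ (n + 1) i, iteratedFDerivWithin_cons hI hV hp,
      iteratedFDerivWithin_cons hI hV hp, fderivWithin_congr h (h p hp)]

/-- By symmetry, every derivative along the coordinate directions is one of the mixed ones. -/
theorem exists_eq_mixedDir {n : ℕ} {V : ℝ × ℝ → X} (hI : UniqueDiffOn ℝ I)
    (hcl : I ⊆ closure (interior I)) (hV : ContDiffOn ℝ (n : WithTop ℕ∞) V I)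
    (w : Fin n → ℝ × ℝ) (hw : ∀ k, w k = (0, 1) ∨ w k = (1, 0)) :
    ∃ i ≤ n, ∀ p ∈ I, iteratedFDerivWithin ℝ n V I p w =
      iteratedFDerivWithin ℝ n V I p (mixedDir n i) := by
  induction n with
  | zero => exact ⟨0, le_rfl, fun p _ => by rw [Subsingleton.elim w (mixedDir 0 0)]⟩
  | succ n ih =>
    obtain ⟨i, hi, h⟩ := ih (hV.of_le (by exact_mod_cast Nat.le_succ _)) (Fin.tail w)
      fun k => hw k.succ
    have hcons : ∀ p ∈ I, iteratedFDerivWithin ℝ (n + 1) V I p w =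
        iteratedFDerivWithin ℝ (n + 1) V I p (Fin.cons (w 0) (mixedDir n i)) := by
      intro p hp
      rw [← Fin.cons_self_tail w, iteratedFDerivWithin_cons hI hV hp,
        iteratedFDerivWithin_cons hI hV hp, fderivWithin_congr h (h p hp), Fin.cons_zero]
    rcases hw 0 with h0 | h0
    · refine ⟨i + 1, by omega, fun p hp => ?_⟩
      rw [hcons p hp, h0, mixedDir_succ_succ]
    · refine ⟨i, by omega, fun p hp => ?_⟩
      rw [hcons p hp, h0, iteratedFDerivWithin_cons_mixedDir hI hcl hV hi hp]

/-- The norm of the derivative of order `n` is controlled by the mixed partial derivatives. -/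
theorem norm_iteratedFDerivWithin_le_of_mixedDir {n : ℕ} {V : ℝ × ℝ → X} (hI : UniqueDiffOn ℝ I)
    (hcl : I ⊆ closure (interior I)) (hV : ContDiffOn ℝ (n : WithTop ℕ∞) V I) {p : ℝ × ℝ}
    (hp : p ∈ I) {c : ℝ} (hc0 : 0 ≤ c)
    (hc : ∀ i ≤ n, ‖iteratedFDerivWithin ℝ n V I p (mixedDir n i)‖ ≤ c) :
    ‖iteratedFDerivWithin ℝ n V I p‖ ≤ 2 ^ n * c := by
  classical
  set f := iteratedFDerivWithin ℝ n V I p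
  refine ContinuousMultilinearMap.opNorm_le_bound (by positivity) fun v => ?_
  have hv : v = (fun k => (v k).2 • ((0, 1) : ℝ × ℝ)) + fun k => (v k).1 • ((1, 0) : ℝ × ℝ) := by
    ext k <;> simp
  have hterm : ∀ s : Finset (Fin n), ‖f (s.piecewise (fun k => (v k).2 • ((0, 1) : ℝ × ℝ))
      fun k => (v k).1 • ((1, 0) : ℝ × ℝ))‖ ≤ c * ∏ k, ‖v k‖ := by
    intro s
    set w : Fin n → ℝ × ℝ := s.piecewise (fun _ => (0, 1)) fun _ => (1, 0)
    set a : Fin n → ℝ := s.piecewise (fun k => (v k).2) fun k => (v k).1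
    have h1 : (s.piecewise (fun k => (v k).2 • ((0, 1) : ℝ × ℝ))
        fun k => (v k).1 • ((1, 0) : ℝ × ℝ)) = fun k => a k • w k := by
      ext k : 1
      by_cases hk : k ∈ s <;> simp [a, w, hk]
    obtain ⟨i, hi, h⟩ := exists_eq_mixedDir hI hcl hV w fun k => by
      by_cases hk : k ∈ s <;> simp [w, hk]
    rw [h1, f.map_smul_univ, norm_smul, h p hp, norm_prod, mul_comm]
    refine mul_le_mul (hc i hi) ?_ (Finset.prod_nonneg fun _ _ => norm_nonneg _) hc0
    refine Finset.prod_le_prod (fun _ _ => norm_nonneg _) fun k _ => ?_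
    by_cases hk : k ∈ s
    · simpa [a, hk] using norm_snd_le (v k)
    · simpa [a, hk] using norm_fst_le (v k)
  rw [hv, show f ((fun k => (v k).2 • ((0, 1) : ℝ × ℝ)) + fun k => (v k).1 • ((1, 0) : ℝ × ℝ)) = _
    from f.toMultilinearMap.map_add_univ _ _, ← hv]
  refine (norm_sum_le _ _).trans ((Finset.sum_le_sum fun s _ => hterm s).trans ?_)
  simp [mul_assoc]

/-- The mixed derivatives of the time derivative. -/
theorem iteratedFDerivWithin_timeDeriv {n : ℕ} {V : ℝ × ℝ → X} (hI : UniqueDiffOn ℝ I)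
    (hcl : I ⊆ closure (interior I)) (hV : ContDiffOn ℝ ((n + 1 : ℕ) : WithTop ℕ∞) V I)
    {i : ℕ} (hi : i ≤ n) {p : ℝ × ℝ} (hp : p ∈ I) :
    iteratedFDerivWithin ℝ n (fun x => fderivWithin ℝ V I x (0, 1)) I p (mixedDir n i) =
      iteratedFDerivWithin ℝ (n + 1) V I p (mixedDir (n + 1) (i + 1)) := by
  induction n generalizing i p with
  | zero =>
    obtain rfl : i = 0 := by omega
    rw [mixedDir_succ_succ, iteratedFDerivWithin_cons hI hV hp]
    simp only [iteratedFDerivWithin_zero_apply]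
  | succ n ih =>
    have hV1 : ContDiffOn ℝ ((n + 1 : ℕ) : WithTop ℕ∞) V I :=
      hV.of_le (by exact_mod_cast Nat.le_succ _)
    have hW : ContDiffOn ℝ ((n + 1 : ℕ) : WithTop ℕ∞)
        (fun x => fderivWithin ℝ V I x (0, 1)) I :=
      (hV.fderivWithin hI (by exact_mod_cast le_rfl)).clm_apply contDiffOn_const
    rcases i with _ | i
    · have h := fun x hx => ih (i := 0) hV1 (by omega) (p := x) hx
      rw [mixedDir_succ_zero, iteratedFDerivWithin_cons hI hW hp, fderivWithin_congr h (h p hp),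
        ← iteratedFDerivWithin_cons hI hV hp,
        iteratedFDerivWithin_cons_mixedDir hI hcl hV (by omega) hp]
    · have h := fun x hx => ih (i := i) hV1 (by omega) (p := x) hx
      rw [mixedDir_succ_succ n i, iteratedFDerivWithin_cons hI hW hp,
        fderivWithin_congr h (h p hp), ← iteratedFDerivWithin_cons hI hV hp,
        ← mixedDir_succ_succ]

end Mixed

/-! ### Interpolation in the parameter -/

/-- Chain rule along the curves `μ ↦ (μ, T μ * s / T α)`. -/
theorem exists_norm_comp_curve_le (m : ℕ) {α₀ αL : ℝ} (hα : α₀ < αL) {T : ℝ → ℝ}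
    (hT : ContDiffOn ℝ ∞ T (Icc α₀ αL)) (hTpos : ∀ α ∈ Icc α₀ αL, 0 < T α) :
    ∃ K : ℝ, 0 < K ∧ ∀ {X : Type} [NormedAddCommGroup X] [NormedSpace ℝ X] {V : ℝ × ℝ → X}
      {c α s μ : ℝ}, ContDiffOn ℝ m V (region α₀ αL T) → α ∈ Icc α₀ αL → s ∈ Icc 0 (T α) →
      μ ∈ Icc α₀ αL →
      (∀ n ≤ m, ‖iteratedFDerivWithin ℝ n V (region α₀ αL T) (μ, T μ * s / T α)‖ ^ 2 ≤ c) →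
      ContDiffOn ℝ m (fun μ => V (μ, T μ * s / T α)) (Icc α₀ αL) ∧
      ‖iteratedDerivWithin m (fun μ => V (μ, T μ * s / T α)) (Icc α₀ αL) μ‖ ^ 2 ≤ K * c := by
  have hψ : ContDiffOn ℝ ∞ (fun μ => (μ, T μ)) (Icc α₀ αL) := contDiffOn_id.prodMk hT
  have hb : ∀ i : ℕ, ∃ D : ℝ, 1 ≤ D ∧ ∀ μ ∈ Icc α₀ αL,
      ‖iteratedFDerivWithin ℝ i (fun μ => (μ, T μ)) (Icc α₀ αL) μ‖ ≤ D := by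
    intro i
    obtain ⟨D, hD⟩ := isCompact_Icc.exists_bound_of_continuousOn
      (hψ.continuousOn_iteratedFDerivWithin (m := i) (by exact_mod_cast le_top)
        (uniqueDiffOn_Icc hα))
    exact ⟨max D 1, le_max_right _ _, fun μ hμ => (hD μ hμ).trans (le_max_left _ _)⟩
  choose D hD1 hD using hb
  set D' := ∑ i ∈ Finset.range (m + 1), D i
  have hDle : ∀ i ≤ m, D i ≤ D' := fun i hi =>
    Finset.single_le_sum (fun i _ => zero_le_one.trans (hD1 i)) (Finset.mem_range.2 (by omega))
  have hD'1 : 1 ≤ D' := (hD1 0).trans (hDle 0 (by omega))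
  refine ⟨((m.factorial : ℝ) * D' ^ m) ^ 2, by positivity, ?_⟩
  intro X _ _ V c α s μ hV hα' hs hμ hc
  have hTα := hTpos α hα'
  have hs1 : s / T α ∈ Icc (0 : ℝ) 1 := ⟨div_nonneg hs.1 hTα.le, (div_le_one hTα).2 hs.2⟩
  -- the curve is a linear image, under a contraction, of the graph of `T`
  let Lin : ℝ × ℝ →L[ℝ] ℝ × ℝ := (ContinuousLinearMap.fst ℝ ℝ ℝ).prod
    ((s / T α) • ContinuousLinearMap.snd ℝ ℝ ℝ)
  have hLin : ‖Lin‖ ≤ 1 := by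
    refine ContinuousLinearMap.opNorm_le_bound _ zero_le_one fun v => ?_
    rw [one_mul, Prod.norm_def]
    refine max_le (norm_fst_le v) ?_
    have h1 : ‖(Lin v).2‖ = (s / T α) * ‖v.2‖ := by
      simp only [Lin, ContinuousLinearMap.prod_apply, _root_.smul_apply,
        ContinuousLinearMap.coe_snd', norm_smul, Real.norm_of_nonneg hs1.1]
    rw [h1]
    exact (mul_le_of_le_one_left (norm_nonneg _) hs1.2).trans (norm_snd_le v)
  have hcurve : (fun μ => (μ, T μ * s / T α)) = Lin ∘ fun μ => (μ, T μ) := by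
    ext μ
    · simp [Lin]
    · simp [Lin]; ring
  have hmaps : MapsTo (fun μ => (μ, T μ * s / T α)) (Icc α₀ αL) (region α₀ αL T) := by
    intro μ hμ
    have := regionMap_mem hTpos (p := (μ, s / T α)) ⟨hμ, hs1⟩
    simpa only [regionMap, mul_div_assoc] using this
  have hcd : ContDiffOn ℝ ∞ (fun μ => (μ, T μ * s / T α)) (Icc α₀ αL) := by
    rw [hcurve]; exact Lin.contDiff.comp_contDiffOn hψ
  have hcdm : ContDiffOn ℝ m (fun μ => (μ, T μ * s / T α)) (Icc α₀ αL) :=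
    hcd.of_le (by exact_mod_cast le_top)
  refine ⟨hV.comp hcdm hmaps, ?_⟩
  have hc0 : 0 ≤ c := (sq_nonneg _).trans (hc 0 (Nat.zero_le _))
  have key := norm_iteratedFDerivWithin_comp_le hV hcdm le_rfl
    (uniqueDiffOn_region hα hT hTpos) (uniqueDiffOn_Icc hα) hmaps hμ (C := √c) (D := D')
    (fun i hi => Real.le_sqrt_of_sq_le (hc i hi)) (fun i hi1 hi => by
      rw [hcurve]
      refine (Lin.norm_iteratedFDerivWithin_comp_left (hψ μ hμ) (uniqueDiffOn_Icc hα) hμ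
        (by exact_mod_cast le_top)).trans ?_
      calc _ ≤ 1 * D i := mul_le_mul hLin (hD i μ hμ) (norm_nonneg _) zero_le_one
        _ ≤ D' := by rw [one_mul]; exact hDle i hi
        _ ≤ D' ^ i := le_self_pow₀ hD'1 (by omega))
  rw [norm_iteratedFDerivWithin_eq_norm_iteratedDerivWithin] at key
  calc _ ≤ ((m.factorial : ℝ) * √c * D' ^ m) ^ 2 := pow_le_pow_left₀ (norm_nonneg _) key 2
    _ = _ := by rw [mul_pow, mul_pow, Real.sq_sqrt hc0]; ring

theorem alphaNode_add {α₀ αL : ℝ} {L : ℕ} (l i : ℕ) :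
    alphaNode α₀ αL L (l + i) = alphaNode α₀ αL L l + dAlpha α₀ αL L * i := by
  simp only [alphaNode]; push_cast; ring

theorem dAlpha_pos {α₀ αL : ℝ} (hα : α₀ < αL) {L : ℕ} (hL : 0 < L) : 0 < dAlpha α₀ αL L :=
  div_pos (sub_pos.2 hα) (by exact_mod_cast hL)

theorem alphaNode_mem {α₀ αL : ℝ} (hα : α₀ < αL) {L l : ℕ} (hl : l ≤ L) :
    alphaNode α₀ αL L l ∈ Icc α₀ αL := by
  rcases Nat.eq_zero_or_pos L with rfl | hL
  · simp [alphaNode, dAlpha, hα.le]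
  have h := dAlpha_pos hα hL
  have hL0 : (0 : ℝ) < L := by exact_mod_cast hL
  have h2 : L * dAlpha α₀ αL L = αL - α₀ := by simp only [dAlpha]; field_simp
  constructor
  · simp only [alphaNode]; linarith [show 0 ≤ l * dAlpha α₀ αL L by positivity]
  · have : l * dAlpha α₀ αL L ≤ L * dAlpha α₀ αL L := by gcongr
    simp only [alphaNode]; linarith

/-- The error of the interpolation in the parameter, along the curves `μ ↦ (μ, T μ * s / T α)`, at
one time and in `L²` with respect to time. Here `S` controls all derivatives up to order `m`. -/
theorem exists_parameter_interpolation (m : ℕ) (hm : 2 ≤ m) {α₀ αL : ℝ} (hα : α₀ < αL) {T : ℝ → ℝ}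
    (hT : ContDiffOn ℝ ∞ T (Icc α₀ αL)) (hTpos : ∀ α ∈ Icc α₀ αL, 0 < T α) :
    ∃ K : ℝ, 0 < K ∧ ∀ {X : Type} [NormedAddCommGroup X] [NormedSpace ℝ X] [CompleteSpace X]
      {V : ℝ × ℝ → X} {S : ℝ × ℝ → ℝ} {α : ℝ} {l L : ℕ}, ContDiffOn ℝ m V (region α₀ αL T) →
      ContinuousOn S (region α₀ αL T) → (∀ p, 0 ≤ S p) →
      (∀ n ≤ m, ∀ p ∈ region α₀ αL T,
        ‖iteratedFDerivWithin ℝ n V (region α₀ αL T) p‖ ^ 2 ≤ S p) →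
      l + m ≤ L + 1 → α ∈ Icc α₀ αL →
      α ∈ Icc (alphaNode α₀ αL L l) (alphaNode α₀ αL L (l + m - 1)) →
      (∀ s ∈ Icc 0 (T α), ‖V (α, s)‖ ^ 2 ≤ K * (∑ i ∈ Finset.range m,
          ‖V (alphaNode α₀ αL L (l + i), T (alphaNode α₀ αL L (l + i)) * s / T α)‖ ^ 2
        + dAlpha α₀ αL L ^ (2 * m - 1) *
          ∫ μ in alphaNode α₀ αL L l..alphaNode α₀ αL L (l + m - 1), S (μ, T μ * s / T α))) ∧
      ∫ s in (0 : ℝ)..T α, ‖V (α, s)‖ ^ 2 ≤ K * ((∑ i ∈ Finset.range m,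
          ∫ s in (0 : ℝ)..T (alphaNode α₀ αL L (l + i)), ‖V (alphaNode α₀ αL L (l + i), s)‖ ^ 2)
        + dAlpha α₀ αL L ^ (2 * m - 1) *
          ∫ μ in alphaNode α₀ αL L l..alphaNode α₀ αL L (l + m - 1),
            ∫ t in (0 : ℝ)..T μ, S (μ, t)) := by
  obtain ⟨K₁, hK₁0, hK₁⟩ := exists_interpolation_bound m hm
  obtain ⟨K₂, hK₂0, hK₂⟩ := exists_norm_comp_curve_le m hα hT hTpos
  obtain ⟨K₃, hK₃0, hK₃⟩ := exists_integral_curves_le hα.le hT.continuousOn hTpos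
  obtain ⟨μ₀, hμ₀, hmin⟩ := isCompact_Icc.exists_isMinOn (nonempty_Icc.2 hα.le) hT.continuousOn
  obtain ⟨μ₁, hμ₁, hmax⟩ := isCompact_Icc.exists_isMaxOn (nonempty_Icc.2 hα.le) hT.continuousOn
  have hT0 := hTpos μ₀ hμ₀
  have hT1 := hTpos μ₁ hμ₁
  set K := K₁ * (1 + K₂)
  have hK : 0 < K := by positivity
  set κ := T μ₁ / T μ₀
  have hκ : 0 < κ := by positivity
  refine ⟨K * (1 + κ + K₃), by positivity, ?_⟩
  intro X _ _ _ V S α l L hV hS hS0 hVS hl hα' hαl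
  have hTα := hTpos α hα'
  have hL : 0 < L := by omega
  have hd := dAlpha_pos hα hL
  set a := alphaNode α₀ αL L l
  set b := alphaNode α₀ αL L (l + m - 1)
  have ha : a ∈ Icc α₀ αL := alphaNode_mem hα (by omega)
  have hb : b ∈ Icc α₀ αL := alphaNode_mem hα (by omega)
  have hsub : Icc a b ⊆ Icc α₀ αL := Icc_subset_Icc ha.1 hb.2
  have hab : a ≤ b := hαl.1.trans hαl.2
  have hm1 : ((m - 1 : ℕ) : ℝ) = m - 1 := by rw [Nat.cast_sub (by omega)]; simp
  have hba : b - a = dAlpha α₀ αL L * (m - 1) := by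
    simp only [a, b]
    rw [show l + m - 1 = l + (m - 1) by omega, alphaNode_add, hm1]; ring
  have hnode : ∀ i < m, alphaNode α₀ αL L (l + i) ∈ Icc a b := by
    intro i hi
    have : (i : ℝ) ≤ m - 1 := by rw [← hm1]; exact_mod_cast (by omega : i ≤ m - 1)
    rw [alphaNode_add]
    refine ⟨le_add_of_nonneg_right (by positivity), ?_⟩
    have : dAlpha α₀ αL L * i ≤ dAlpha α₀ αL L * (m - 1) := by gcongr
    linarith
  set R : ℝ → ℝ := fun s => ∫ μ in a..b, S (μ, T μ * s / T α)
  set Q : ℝ → ℝ := fun s => ∑ i ∈ Finset.range m,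
    ‖V (alphaNode α₀ αL L (l + i), T (alphaNode α₀ αL L (l + i)) * s / T α)‖ ^ 2
  have hR0 : ∀ s, 0 ≤ R s := fun s => intervalIntegral.integral_nonneg hab fun _ _ => hS0 _
  have hQ0 : ∀ s, 0 ≤ Q s := fun s => Finset.sum_nonneg fun _ _ => sq_nonneg _
  have hmem : ∀ s ∈ Icc 0 (T α), ∀ μ ∈ Icc α₀ αL, (μ, T μ * s / T α) ∈ region α₀ αL T := by
    intro s hs μ hμ
    have := regionMap_mem hTpos (p := (μ, s / T α))
      ⟨hμ, div_nonneg hs.1 hTα.le, (div_le_one hTα).2 hs.2⟩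
    simpa only [regionMap, mul_div_assoc] using this
  -- interpolation along the curve `μ ↦ (μ, T μ * s / T α)`, which passes through `(α, s)`
  have hpt : ∀ s ∈ Icc 0 (T α), ‖V (α, s)‖ ^ 2 ≤
      K * (Q s + dAlpha α₀ αL L ^ (2 * m - 1) * R s) := by
    intro s hs
    have hcurve := fun μ hμ => hK₂ (V := V) (c := S (μ, T μ * s / T α)) hV hα' hs (μ := μ) hμ
      fun n hn => hVS n hn _ (hmem s hs μ hμ)
    set G : ℝ → X := fun μ => V (μ, T μ * s / T α)
    have hG : ContDiffOn ℝ m G (Icc α₀ αL) := (hcurve α hα').1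
    have hchain := (IsDerivChain.of_contDiffOn hα hG).mono hsub
    have h1 := hK₁ (y := a) (x := α) (k := dAlpha α₀ αL L) hchain hd
      (by rw [hba]; nlinarith) (fun i hi => by rw [← alphaNode_add]; exact hnode i hi) hαl
    simp only [iteratedDerivWithin_zero] at h1
    have h2 : ∑ i ∈ Finset.range m, ‖G (a + dAlpha α₀ αL L * i)‖ ^ 2 = Q s := by
      simp only [Q, alphaNode_add, G, a]
    have h3 : G α = V (α, s) := by simp only [G]; rw [mul_div_cancel_left₀ _ hTα.ne']
    have h4 : ∫ μ in a..b, ‖iteratedDerivWithin m G (Icc α₀ αL) μ‖ ^ 2 ≤ K₂ * R s := by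
      simp only [R]
      rw [← intervalIntegral.integral_const_mul]
      refine intervalIntegral.integral_mono_on hab
        (hchain.integrable_norm_sq le_rfl (by rw [uIcc_of_le hab])) ?_
        fun μ hμ => (hcurve μ (hsub hμ)).2
      apply ContinuousOn.intervalIntegrable
      rw [uIcc_of_le hab]
      exact continuousOn_const.mul
        ((continuousOn_comp_curve hT.continuousOn hTpos hS hα' hs).mono hsub)
    rw [h2, h3] at h1
    have hp : 0 ≤ dAlpha α₀ αL L ^ (2 * m - 1) := by positivity
    calc ‖V (α, s)‖ ^ 2 ≤ _ := (le_add_of_nonneg_right (by positivity)).trans h1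
      _ ≤ K₁ * (Q s + dAlpha α₀ αL L ^ (2 * m - 1) * (K₂ * R s)) := by gcongr
      _ ≤ K * (Q s + dAlpha α₀ αL L ^ (2 * m - 1) * R s) := by
        have h5 : 0 ≤ K₁ * (K₂ * Q s) := mul_nonneg hK₁0.le (mul_nonneg hK₂0.le (hQ0 s))
        have h6 : 0 ≤ K₁ * (dAlpha α₀ αL L ^ (2 * m - 1) * R s) :=
          mul_nonneg hK₁0.le (mul_nonneg hp (hR0 s))
        simp only [K]; linarith
  have hp : 0 ≤ dAlpha α₀ αL L ^ (2 * m - 1) := by positivity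
  constructor
  · intro s hs
    refine (hpt s hs).trans ?_
    have : 0 ≤ Q s + dAlpha α₀ αL L ^ (2 * m - 1) * R s :=
      add_nonneg (hQ0 s) (mul_nonneg hp (hR0 s))
    refine mul_le_mul_of_nonneg_right ?_ this
    nlinarith
  · have hVc : ContinuousOn (fun p => ‖V p‖ ^ 2) (region α₀ αL T) := hV.continuousOn.norm.pow 2
    have hcurvec : ∀ i < m, ContinuousOn (fun s =>
        ‖V (alphaNode α₀ αL L (l + i), T (alphaNode α₀ αL L (l + i)) * s / T α)‖ ^ 2)
        (Icc 0 (T α)) := by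
      intro i hi
      refine hVc.comp (f := fun s => (alphaNode α₀ αL L (l + i),
        T (alphaNode α₀ αL L (l + i)) * s / T α)) ?_ fun s hs => hmem s hs _ (hsub (hnode i hi))
      fun_prop
    have hint : ∀ i < m, IntervalIntegrable (fun s =>
        ‖V (alphaNode α₀ αL L (l + i), T (alphaNode α₀ αL L (l + i)) * s / T α)‖ ^ 2)
        volume 0 (T α) := fun i hi =>
      ContinuousOn.intervalIntegrable (by rw [uIcc_of_le hTα.le]; exact hcurvec i hi)
    have hQint : IntervalIntegrable Q volume 0 (T α) := by
      apply ContinuousOn.intervalIntegrable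
      rw [uIcc_of_le hTα.le]
      exact continuousOn_finsetSum _ fun i hi => hcurvec i (Finset.mem_range.1 hi)
    -- Fubini: the remainders along the curves integrate to a multiple of the double integral
    obtain ⟨hRint, hR⟩ := hK₃ hS hS0 hα' hab hsub
    have hVint : IntervalIntegrable (fun s => ‖V (α, s)‖ ^ 2) volume 0 (T α) := by
      apply ContinuousOn.intervalIntegrable
      rw [uIcc_of_le hTα.le]
      exact hVc.comp (f := fun s => (α, s)) (by fun_prop) fun s hs => ⟨hα', hs⟩
    have h1 := intervalIntegral.integral_mono_on hTα.le hVint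
      ((hQint.add (hRint.const_mul _)).const_mul K) hpt
    rw [intervalIntegral.integral_const_mul, intervalIntegral.integral_add hQint
      (hRint.const_mul _), intervalIntegral.integral_const_mul,
      intervalIntegral.integral_finsetSum fun i hi => hint i (Finset.mem_range.1 hi)] at h1
    set J := ∫ μ in a..b, ∫ t in (0 : ℝ)..T μ, S (μ, t)
    have hJ0 : 0 ≤ J := intervalIntegral.integral_nonneg hab fun μ hμ =>
      intervalIntegral.integral_nonneg (hTpos μ (hsub hμ)).le fun _ _ => hS0 _
    set P := ∑ i ∈ Finset.range m, ∫ s in (0 : ℝ)..T (alphaNode α₀ αL L (l + i)),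
      ‖V (alphaNode α₀ αL L (l + i), s)‖ ^ 2
    have hPi : ∀ i < m, 0 ≤ ∫ s in (0 : ℝ)..T (alphaNode α₀ αL L (l + i)),
        ‖V (alphaNode α₀ αL L (l + i), s)‖ ^ 2 := fun i hi =>
      intervalIntegral.integral_nonneg (hTpos _ (hsub (hnode i hi))).le fun _ _ => sq_nonneg _
    have hP0 : 0 ≤ P := Finset.sum_nonneg fun i hi => hPi i (Finset.mem_range.1 hi)
    have h2 : ∑ i ∈ Finset.range m, ∫ s in (0 : ℝ)..T α,
        ‖V (alphaNode α₀ αL L (l + i), T (alphaNode α₀ αL L (l + i)) * s / T α)‖ ^ 2 ≤ κ * P := by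
      simp only [P]
      rw [Finset.mul_sum]
      refine Finset.sum_le_sum fun i hi => ?_
      have hi' := Finset.mem_range.1 hi
      have hTi := hTpos _ (hsub (hnode i hi'))
      set β := alphaNode α₀ αL L (l + i)
      -- the curve meets the parameter `β` at a rescaled time
      have e : ∫ s in (0 : ℝ)..T α, ‖V (β, T β * s / T α)‖ ^ 2 =
          T α / T β * ∫ s in (0 : ℝ)..T β, ‖V (β, s)‖ ^ 2 := by
        rw [integral_eq_mul_integral_unit, integral_eq_mul_integral_unit _ (T β), ← mul_assoc,
          div_mul_cancel₀ _ hTi.ne']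
        congr 1
        refine intervalIntegral.integral_congr fun s _ => ?_
        rw [mul_left_comm, mul_div_cancel_left₀ _ hTα.ne']
      rw [e]
      refine mul_le_mul_of_nonneg_right ?_ (hPi i hi')
      have h3 : T α ≤ T μ₁ := hmax hα'
      have h4 : T μ₀ ≤ T β := hmin (hsub (hnode i hi'))
      simp only [κ]
      gcongr
    refine h1.trans ?_
    have h5 : 0 ≤ K * ((1 + K₃) * P) := by positivity
    have h6 : 0 ≤ K * ((1 + κ) * (dAlpha α₀ αL L ^ (2 * m - 1) * J)) := by positivity
    have h7 : K * (dAlpha α₀ αL L ^ (2 * m - 1) * ∫ s in (0 : ℝ)..T α, R s) ≤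
        K * (dAlpha α₀ αL L ^ (2 * m - 1) * (K₃ * J)) := by gcongr
    have h8 := mul_le_mul_of_nonneg_left h2 hK.le
    linarith

/-! ### The proper orthogonal decomposition -/

section POD

variable {d : ℕ} {Ω : Set (Space d)}

/-- The weak gradient as a continuous linear map. -/
noncomputable def gradL (Ω : Set (Space d)) : H10 Ω →L[ℝ] L2Vec Ω :=
  (WithLp.sndL 2 ℝ (L2 Ω) (L2Vec Ω)).comp (H10 Ω).subtypeL

/-- The inclusion of `H¹₀(Ω)` in `L²(Ω)` as a continuous linear map. -/
noncomputable def toL2L (Ω : Set (Space d)) : H10 Ω →L[ℝ] L2 Ω :=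
  (WithLp.fstL 2 ℝ (L2 Ω) (L2Vec Ω)).comp (H10 Ω).subtypeL

theorem gradL_apply (v : H10 Ω) : gradL Ω v = grad v := rfl

theorem grad_sub (v w : H10 Ω) : grad (v - w) = grad v - grad w := rfl

theorem toL2_sub (v w : H10 Ω) : toL2 (v - w) = toL2 v - toL2 w := rfl

theorem grad_smul (c : ℝ) (v : H10 Ω) : grad (c • v) = c • grad v := rfl

theorem grad_sum {ι : Type} (s : Finset ι) (v : ι → H10 Ω) :
    grad (∑ i ∈ s, v i) = ∑ i ∈ s, grad (v i) := map_sum (gradL Ω) v s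

variable {ι : Type} [Fintype ι] (y : ι → H10 Ω) (D : SpectralData (correlationMatrix y))

/-- The indices of the first `r` modes. -/
def firstModes (n r : ℕ) : Finset (Fin n) := Finset.univ.filter fun k => (k : ℕ) < r

theorem mem_firstModes {n r : ℕ} {k : Fin n} : k ∈ firstModes n r ↔ (k : ℕ) < r := by
  simp [firstModes]

/-- The orthogonal projection for `(∇·, ∇·)` onto the span of the first `r` POD modes, provided
that the first `r` eigenvalues are positive, so that these modes are orthonormal. -/
noncomputable def podProj (r : ℕ) : H10 Ω →L[ℝ] H10 Ω :=
  ∑ k ∈ firstModes (Fintype.card ι) r,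
    ((innerSL ℝ (grad (podMode y D k))).comp (gradL Ω)).smulRight (podMode y D k)

theorem podProj_apply (r : ℕ) (v : H10 Ω) : podProj y D r v =
    ∑ k ∈ firstModes (Fintype.card ι) r,
      ⟪grad (podMode y D k), grad v⟫_ℝ • podMode y D k := by
  simp [podProj, _root_.sum_apply, gradL_apply]

theorem podProj_mem (r : ℕ) (v : H10 Ω) : podProj y D r v ∈ podSpace y D r := by
  rw [podProj_apply]
  refine Submodule.sum_mem _ fun k hk => Submodule.smul_mem _ _ (Submodule.subset_span ?_)
  exact ⟨k, mem_firstModes.1 hk, rfl⟩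

theorem podSpace_le (r : ℕ) {W : Submodule ℝ (H10 Ω)} (h : ∀ i, y i ∈ W) : podSpace y D r ≤ W := by
  refine Submodule.span_le.2 ?_
  rintro _ ⟨k, -, rfl⟩
  exact W.smul_mem _ (W.sum_mem fun j _ => W.smul_mem _ (h j))

variable {y D}

theorem eigval_pos {r : ℕ} (hr : r ≤ D.numPos) {k : Fin (Fintype.card ι)} (hk : (k : ℕ) < r) :
    0 < D.eigval k := by
  by_contra h
  have hsub : {j : Fin (Fintype.card ι) | 0 < D.eigval j} ⊆ (Finset.Iio k : Finset _) := by
    intro j hj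
    rw [Finset.coe_Iio, mem_Iio]
    by_contra hjk
    exact h (lt_of_lt_of_le hj (D.antitone (not_lt.1 hjk)))
  have := Set.ncard_le_ncard hsub (Finset.finite_toSet _)
  rw [Set.ncard_coe_finset, Fin.card_Iio] at this
  have h2 : D.numPos ≤ k := this
  omega

theorem eigval_nonpos {k : Fin (Fintype.card ι)} (hk : D.numPos ≤ k) : D.eigval k ≤ 0 := by
  by_contra h
  have hsub : ((Finset.Iic k : Finset (Fin (Fintype.card ι))) : Set _) ⊆
      {j : Fin (Fintype.card ι) | 0 < D.eigval j} := by
    intro j hj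
    rw [Finset.coe_Iic, mem_Iic] at hj
    exact lt_of_lt_of_le (not_le.1 h) (D.antitone hj)
  have := Set.ncard_le_ncard hsub (Set.toFinite _)
  rw [Set.ncard_coe_finset, Fin.card_Iic] at this
  have h2 : (k : ℕ) + 1 ≤ D.numPos := this
  omega

theorem card_pos_of_lt {k : Fin (Fintype.card ι)} : (0 : ℝ) < Fintype.card ι := by
  exact_mod_cast (Nat.zero_le _).trans_lt k.2

/-- The Fourier coefficients of the snapshots, by the eigenvalue equation. -/
theorem inner_snapshot_mode {k : Fin (Fintype.card ι)} (hk : 0 < D.eigval k) (i : ι) :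
    ⟪grad (y i), grad (podMode y D k)⟫_ℝ =
      √(Fintype.card ι : ℝ) * √(D.eigval k) * D.eigvec k i := by
  have hN : (0 : ℝ) < Fintype.card ι := card_pos_of_lt (k := k)
  have h1 : ∑ j, D.eigvec k j * ⟪grad (y i), grad (y j)⟫_ℝ =
      Fintype.card ι * (D.eigval k * D.eigvec k i) := by
    have h2 := congrFun (D.mulVec_eq k) i
    simp only [Matrix.mulVec, dotProduct, correlationMatrix, Matrix.of_apply, Pi.smul_apply,
      smul_eq_mul] at h2
    rw [← h2, Finset.mul_sum]
    refine Finset.sum_congr rfl fun j _ => ?_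
    field_simp
  rw [podMode, grad_smul, grad_sum, inner_smul_right, inner_sum]
  simp_rw [grad_smul, inner_smul_right]
  rw [h1]
  have e1 := Real.mul_self_sqrt hN.le
  have e2 := Real.mul_self_sqrt hk.le
  have n1 := (Real.sqrt_pos.2 hN).ne'
  have n2 := (Real.sqrt_pos.2 hk).ne'
  calc _ = 1 / (√(Fintype.card ι : ℝ) * √(D.eigval k)) *
        ((√(Fintype.card ι : ℝ) * √(Fintype.card ι : ℝ)) *
          ((√(D.eigval k) * √(D.eigval k)) * D.eigvec k i)) := by rw [e1, e2]
    _ = _ := by field_simp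

/-- The gradients of the POD modes are orthonormal. -/
theorem inner_mode_mode {k l : Fin (Fintype.card ι)} (hk : 0 < D.eigval k) (hl : 0 < D.eigval l) :
    ⟪grad (podMode y D k), grad (podMode y D l)⟫_ℝ = if k = l then 1 else 0 := by
  have hN : (0 : ℝ) < Fintype.card ι := card_pos_of_lt (k := k)
  have n1 := (Real.sqrt_pos.2 hN).ne'
  have n2 := (Real.sqrt_pos.2 hk).ne'
  have h1 : ⟪grad (podMode y D k), grad (podMode y D l)⟫_ℝ =
      (√(D.eigval l) / √(D.eigval k)) * ⟪D.eigvec l, D.eigvec k⟫_ℝ := by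
    conv_lhs => rw [podMode, grad_smul, grad_sum, real_inner_smul_left, sum_inner]
    simp_rw [grad_smul, real_inner_smul_left, inner_snapshot_mode hl]
    rw [PiLp.inner_apply, Finset.mul_sum, Finset.mul_sum]
    refine Finset.sum_congr rfl fun i _ => ?_
    simp only [RCLike.inner_apply, conj_trivial]
    field_simp
  rw [h1, orthonormal_iff_ite.1 D.eigvec.orthonormal]
  by_cases hkl : k = l
  · subst hkl
    simp [n2]
  · simp [hkl, Ne.symm hkl]

theorem inner_sub_podProj_mode {r : ℕ} (hr : r ≤ D.numPos) (v : H10 Ω)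
    {l : Fin (Fintype.card ι)} (hl : (l : ℕ) < r) :
    ⟪grad (v - podProj y D r v), grad (podMode y D l)⟫_ℝ = 0 := by
  rw [grad_sub, inner_sub_left, podProj_apply, grad_sum, sum_inner]
  simp_rw [grad_smul, real_inner_smul_left]
  rw [Finset.sum_eq_single l]
  · rw [inner_mode_mode (eigval_pos hr hl) (eigval_pos hr hl), if_pos rfl, mul_one,
      real_inner_comm, sub_self]
  · intro k hk hkl
    rw [inner_mode_mode (eigval_pos hr (mem_firstModes.1 hk)) (eigval_pos hr hl),
      if_neg hkl, mul_zero]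
  · intro h
    exact absurd (mem_firstModes.2 hl) h

theorem inner_sub_podProj {r : ℕ} (hr : r ≤ D.numPos) (v : H10 Ω) {z : H10 Ω}
    (hz : z ∈ podSpace y D r) : ⟪grad (v - podProj y D r v), grad z⟫_ℝ = 0 := by
  induction hz using Submodule.span_induction with
  | mem z hz =>
    obtain ⟨k, hk, rfl⟩ := hz
    exact inner_sub_podProj_mode hr v hk
  | zero => exact inner_zero_right _
  | add a b _ _ ha hb =>
    rw [show grad (a + b) = grad a + grad b from rfl, inner_add_right, ha, hb, add_zero]
  | smul c a _ ha => rw [grad_smul, inner_smul_right, ha, mul_zero]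

/-- Pythagoras' theorem for the projection, whose modes are orthonormal. -/
theorem norm_sq_sub_podProj {r : ℕ} (hr : r ≤ D.numPos) (v : H10 Ω) :
    ‖grad (v - podProj y D r v)‖ ^ 2 = ‖grad v‖ ^ 2 -
      ∑ k ∈ firstModes (Fintype.card ι) r, ⟪grad v, grad (podMode y D k)⟫_ℝ ^ 2 := by
  have h1 := inner_sub_podProj hr v (podProj_mem y D r v)
  have h2 : ⟪grad (podProj y D r v), grad v⟫_ℝ =
      ∑ k ∈ firstModes (Fintype.card ι) r, ⟪grad v, grad (podMode y D k)⟫_ℝ ^ 2 := by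
    rw [podProj_apply, grad_sum, sum_inner]
    refine Finset.sum_congr rfl fun k _ => ?_
    rw [grad_smul, real_inner_smul_left, real_inner_comm, sq]
  rw [← h2, ← real_inner_self_eq_norm_sq, ← real_inner_self_eq_norm_sq]
  conv_lhs => rw [grad_sub v (podProj y D r v), inner_sub_right, ← grad_sub, h1, sub_zero, grad_sub,
    inner_sub_left]

theorem norm_sub_podProj_le {r : ℕ} (hr : r ≤ D.numPos) (v : H10 Ω) :
    ‖grad (v - podProj y D r v)‖ ≤ ‖grad v‖ := by
  have h := norm_sq_sub_podProj hr v
  have h2 : 0 ≤ ∑ k ∈ firstModes (Fintype.card ι) r,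
    ⟪grad v, grad (podMode y D k)⟫_ℝ ^ 2 := Finset.sum_nonneg fun _ _ => sq_nonneg _
  exact le_of_sq_le_sq (by linarith) (norm_nonneg _)

theorem trace_eq_sum_eigval {S : Matrix ι ι ℝ} (D : SpectralData S) :
    ∑ i, S i i = ∑ k, D.eigval k := by
  classical
  have h1 := LinearMap.trace_eq_sum_inner (Matrix.toEuclideanLin S) D.eigvec
  have h2 := LinearMap.trace_eq_sum_inner (Matrix.toEuclideanLin S) (EuclideanSpace.basisFun ι ℝ)
  rw [h1] at h2
  have h3 : ∀ k, ⟪D.eigvec k, Matrix.toEuclideanLin S (D.eigvec k)⟫_ℝ = D.eigval k := by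
    intro k
    have : Matrix.toEuclideanLin S (D.eigvec k) = D.eigval k • D.eigvec k := by
      rw [Matrix.toLpLin_apply, D.mulVec_eq k]; rfl
    rw [this, inner_smul_right, real_inner_self_eq_norm_sq, D.eigvec.norm_eq_one]
    simp
  simp_rw [h3] at h2
  rw [h2]
  refine Finset.sum_congr rfl fun i _ => ?_
  simp [EuclideanSpace.basisFun_apply, Matrix.toLpLin_apply, EuclideanSpace.inner_single_left]

/-- The mean square error of the projection of the snapshots is at most the sum of the remaining
positive eigenvalues: it is the trace of the correlation matrix minus the first `r` eigenvalues. -/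
theorem mean_norm_sq_sub_podProj_le {r : ℕ} (hr : r ≤ D.numPos) :
    (1 / (Fintype.card ι : ℝ)) * ∑ i, ‖grad (y i - podProj y D r (y i))‖ ^ 2 ≤ D.tail r := by
  -- without snapshots both sides vanish
  classical
  rcases Nat.eq_zero_or_pos (Fintype.card ι) with h0 | hpos
  · have : IsEmpty ι := Fintype.card_eq_zero_iff.1 h0
    have : IsEmpty (Fin (Fintype.card ι)) := by rw [h0]; infer_instance
    simp [SpectralData.tail]
  have hN : (0 : ℝ) < Fintype.card ι := by exact_mod_cast hpos
  have h1 : ∑ i, ‖grad (y i)‖ ^ 2 = Fintype.card ι * ∑ k, D.eigval k := by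
    rw [← trace_eq_sum_eigval D, Finset.mul_sum]
    refine Finset.sum_congr rfl fun i _ => ?_
    simp only [correlationMatrix, Matrix.of_apply]
    rw [real_inner_self_eq_norm_sq]
    field_simp
  have h2 : ∑ i, ∑ k ∈ firstModes (Fintype.card ι) r,
      ⟪grad (y i), grad (podMode y D k)⟫_ℝ ^ 2 =
      Fintype.card ι * ∑ k ∈ firstModes (Fintype.card ι) r, D.eigval k := by
    rw [Finset.sum_comm, Finset.mul_sum]
    refine Finset.sum_congr rfl fun k hk => ?_
    have hk' := eigval_pos hr (mem_firstModes.1 hk)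
    simp_rw [inner_snapshot_mode hk', mul_pow, Real.sq_sqrt hN.le, Real.sq_sqrt hk'.le]
    rw [← Finset.mul_sum]
    have : ∑ i, D.eigvec k i ^ 2 = 1 := by
      have h3 := EuclideanSpace.norm_sq_eq (D.eigvec k)
      rw [D.eigvec.norm_eq_one] at h3
      simpa using h3.symm
    rw [this, mul_one]
  simp_rw [norm_sq_sub_podProj hr]
  rw [Finset.sum_sub_distrib, h1, h2, ← mul_sub, ← mul_assoc, one_div_mul_cancel hN.ne', one_mul]
  rw [firstModes, Finset.sum_filter, ← Finset.sum_sub_distrib]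
  refine Finset.sum_le_sum fun k _ => ?_
  by_cases hk : (k : ℕ) < r
  · simp [hk, not_le.2 hk]
  · by_cases hk2 : (k : ℕ) < D.numPos
    · simp [hk, not_lt.1 hk, hk2]
    · simpa [hk, hk2] using eigval_nonpos (not_lt.1 hk2)

end POD

/-! ### The error of the Galerkin method in a subspace -/

/-- A form of Gronwall's inequality. -/
theorem gronwall_integral {φ φ' ρ : ℝ → ℝ} {T κ : ℝ} (hT : 0 ≤ T) (hκ : 0 ≤ κ)
    (hφ : ContinuousOn φ (Icc 0 T)) (h0 : φ 0 ≤ 0)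
    (hd : ∀ t ∈ Ioo 0 T, HasDerivAt φ (φ' t) t) (hρ : ContinuousOn ρ (Icc 0 T))
    (hρ0 : ∀ t ∈ Icc 0 T, 0 ≤ ρ t) (hle : ∀ t ∈ Ioo 0 T, φ' t ≤ κ * φ t + ρ t)
    {t : ℝ} (ht : t ∈ Icc 0 T) : φ t ≤ Real.exp (κ * T) * ∫ s in (0 : ℝ)..T, ρ s := by
  set ρ' : ℝ → ℝ := fun t => ρ (projIcc 0 T hT t : ℝ)
  have hρ' : Continuous ρ' := hρ.comp_continuous
    (continuous_subtype_val.comp continuous_projIcc) fun t => (projIcc 0 T hT t).2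
  have hρ'0 : ∀ t, 0 ≤ ρ' t := fun t => hρ0 _ (projIcc 0 T hT t).2
  have heq : ∀ t ∈ Icc 0 T, ρ' t = ρ t := fun t ht => by
    simp only [ρ', projIcc_of_mem hT ht]
  set ψ : ℝ → ℝ := fun t => Real.exp (-(κ * t)) * φ t - ∫ s in (0 : ℝ)..t, ρ' s
  have hψd : ∀ t ∈ Ioo 0 T, HasDerivAt ψ (-κ * Real.exp (-(κ * t)) * φ t +
      Real.exp (-(κ * t)) * φ' t - ρ' t) t := by
    intro t ht
    have h1 : HasDerivAt (fun t => Real.exp (-(κ * t))) (-κ * Real.exp (-(κ * t))) t := by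
      have := (((hasDerivAt_id t).const_mul κ).neg).exp
      refine this.congr_deriv ?_
      simp only [Pi.neg_apply, id]; ring
    exact (h1.mul (hd t ht)).sub (hρ'.integral_hasStrictDerivAt 0 t).hasDerivAt
  have hanti : AntitoneOn ψ (Icc 0 T) := by
    refine antitoneOn_of_deriv_nonpos (convex_Icc 0 T) ?_ ?_ ?_
    · have h1 : Continuous fun t => ∫ s in (0 : ℝ)..t, ρ' s :=
        continuous_iff_continuousAt.2 fun t =>
          (hρ'.integral_hasStrictDerivAt 0 t).hasDerivAt.continuousAt
      exact ((by fun_prop : Continuous fun t => Real.exp (-(κ * t))).continuousOn.mul hφ).sub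
        h1.continuousOn
    · intro t ht
      rw [interior_Icc] at ht
      exact (hψd t ht).differentiableAt.differentiableWithinAt
    · intro t ht
      rw [interior_Icc] at ht
      rw [(hψd t ht).deriv]
      have h1 := hle t ht
      have h2 := heq t (Ioo_subset_Icc_self ht)
      have h3 : 0 < Real.exp (-(κ * t)) := Real.exp_pos _
      have h4 : Real.exp (-(κ * t)) ≤ 1 :=
        Real.exp_le_one_iff.2 (by have := mul_nonneg hκ ht.1.le; linarith)
      have h5 := mul_le_mul_of_nonneg_left h1 h3.le
      have h6 := mul_le_mul_of_nonneg_right h4 (hρ'0 t)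
      rw [← h2] at h5
      linarith
  have h1 := hanti ⟨le_rfl, hT⟩ ht ht.1
  simp only [ψ, mul_zero, neg_zero, Real.exp_zero, one_mul, intervalIntegral.integral_same,
    sub_zero] at h1
  have h2 : ∫ s in (0 : ℝ)..t, ρ' s ≤ ∫ s in (0 : ℝ)..T, ρ' s := by
    apply intervalIntegral.integral_mono_interval le_rfl ht.1 ht.2
    · exact Filter.Eventually.of_forall hρ'0
    · exact hρ'.intervalIntegrable _ _
  have h3 : ∫ s in (0 : ℝ)..T, ρ' s = ∫ s in (0 : ℝ)..T, ρ s :=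
    intervalIntegral.integral_congr fun s hs => heq s (by rwa [uIcc_of_le hT] at hs)
  have h4 : Real.exp (-(κ * t)) * φ t ≤ ∫ s in (0 : ℝ)..T, ρ s := by linarith
  have h5 : φ t = Real.exp (κ * t) * (Real.exp (-(κ * t)) * φ t) := by
    rw [← mul_assoc, ← Real.exp_add]; simp
  have h6 : 0 ≤ ∫ s in (0 : ℝ)..T, ρ s := intervalIntegral.integral_nonneg hT hρ0
  rw [h5]
  calc _ ≤ Real.exp (κ * t) * ∫ s in (0 : ℝ)..T, ρ s := by gcongr
    _ ≤ _ := by gcongr; exact ht.2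

theorem abs_integral_nonlinearity_sub_le {d : ℕ} {Ω : Set (Space d)} (hΩ : Bornology.IsBounded Ω)
    {g : ℝ → ℝ} {Λ : NNReal} (hg : LipschitzWith Λ g) (a b v : L2 Ω) :
    |(∫ x in Ω, g (a x) * v x) - ∫ x in Ω, g (b x) * v x| ≤ Λ * ‖a - b‖ * ‖v‖ := by
  have : IsFiniteMeasure (volume.restrict Ω) := ⟨by
    rw [Measure.restrict_apply_univ]; exact hΩ.measure_lt_top⟩
  have hg' : LipschitzWith Λ fun x => g x - g 0 := fun x y => by
    simpa [edist_dist, Real.dist_eq] using hg x y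
  have h0 : (fun x => g x - g 0) 0 = 0 := sub_self _
  have key : ∀ a : L2 Ω, ∫ x in Ω, g (a x) * v x =
      ⟪v, hg'.compLp h0 a⟫_ℝ + g 0 * ∫ x in Ω, v x := by
    intro a
    have hv : Integrable (fun x => v x) (volume.restrict Ω) := (Lp.memLp v).integrable one_le_two
    rw [L2.inner_def, ← integral_const_mul,
      ← integral_add (L2.integrable_inner (𝕜 := ℝ) v (hg'.compLp h0 a)) (hv.const_mul _)]
    refine integral_congr_ae ?_
    filter_upwards [hg'.coeFn_compLp h0 a] with x hx
    rw [hx]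
    simp only [Function.comp, RCLike.inner_apply, conj_trivial]
    ring
  rw [key, key, add_sub_add_right_eq_sub, ← inner_sub_right]
  calc _ ≤ ‖v‖ * ‖hg'.compLp h0 a - hg'.compLp h0 b‖ := abs_real_inner_le_norm _ _
    _ ≤ ‖v‖ * (Λ * ‖a - b‖) := by
        gcongr
        exact hg'.norm_compLp_sub_le h0 a b
    _ = _ := by ring

/-- The differential inequality for the square of the `L²` norm of `r - p`, where `r` is the
solution in the subspace and `p` the projection of the solution `u`. The unfavourable terms do not
depend on `ν`, as `∇(u - p)` is orthogonal to `∇(r - p)`. -/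
theorem energy_inequality {d : ℕ} {Ω : Set (Space d)} (hΩ : Bornology.IsBounded Ω) {ν : ℝ}
    (hν : 0 < ν) {g : ℝ → ℝ} {Λ : NNReal} (hg : LipschitzWith Λ g) {f : L2 Ω}
    {r u p r' u' p' : H10 Ω}
    (E1 : ⟪toL2 r', toL2 (r - p)⟫_ℝ + ν * ⟪grad r, grad (r - p)⟫_ℝ
      + ∫ x in Ω, g (toL2 r x) * toL2 (r - p) x = ⟪f, toL2 (r - p)⟫_ℝ)
    (E2 : ⟪toL2 u', toL2 (r - p)⟫_ℝ + ν * ⟪grad u, grad (r - p)⟫_ℝ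
      + ∫ x in Ω, g (toL2 u x) * toL2 (r - p) x = ⟪f, toL2 (r - p)⟫_ℝ)
    (horth : ⟪grad (u - p), grad (r - p)⟫_ℝ = 0) :
    2 * ⟪toL2 (r - p), toL2 (r' - p')⟫_ℝ ≤ (1 + 3 * Λ) * ‖toL2 (r - p)‖ ^ 2 +
      (‖toL2 (u' - p')‖ ^ 2 + Λ * ‖toL2 (u - p)‖ ^ 2) := by
  have hN := abs_integral_nonlinearity_sub_le hΩ hg (toL2 r) (toL2 u) (toL2 (r - p))
  have hsplit : toL2 r - toL2 u = toL2 (r - p) - toL2 (u - p) := by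
    rw [← toL2_sub, ← toL2_sub, sub_sub_sub_cancel_right]
  have hgrad : ⟪grad r, grad (r - p)⟫_ℝ - ⟪grad u, grad (r - p)⟫_ℝ = ‖grad (r - p)‖ ^ 2 := by
    rw [← inner_sub_left, ← real_inner_self_eq_norm_sq]
    have h3 : grad r - grad u = grad (r - p) - grad (u - p) := by
      rw [← grad_sub, ← grad_sub, sub_sub_sub_cancel_right]
    rw [h3, inner_sub_left, horth, sub_zero]
  have hdt : ⟪toL2 r', toL2 (r - p)⟫_ℝ - ⟪toL2 u', toL2 (r - p)⟫_ℝ =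
      ⟪toL2 (r - p), toL2 (r' - p')⟫_ℝ - ⟪toL2 (u' - p'), toL2 (r - p)⟫_ℝ := by
    rw [real_inner_comm (toL2 (r' - p')), ← inner_sub_left, ← inner_sub_left,
      ← toL2_sub, ← toL2_sub, sub_sub_sub_cancel_right]
  have hzz : ⟪toL2 (u' - p'), toL2 (r - p)⟫_ℝ ≤ ‖toL2 (u' - p')‖ * ‖toL2 (r - p)‖ :=
    real_inner_le_norm _ _
  have hnn : ‖toL2 r - toL2 u‖ ≤ ‖toL2 (r - p)‖ + ‖toL2 (u - p)‖ := by
    rw [hsplit]; exact norm_sub_le _ _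
  have h7 : ν * ⟪grad r, grad (r - p)⟫_ℝ - ν * ⟪grad u, grad (r - p)⟫_ℝ =
      ν * ‖grad (r - p)‖ ^ 2 := by rw [← mul_sub, hgrad]
  have hνg : 0 ≤ ν * ‖grad (r - p)‖ ^ 2 := by positivity
  have hN2 := (abs_le.1 hN).1
  have he : 0 ≤ ‖toL2 (r - p)‖ := norm_nonneg _
  generalize ‖toL2 (r - p)‖ = e at *
  generalize ‖toL2 (u - p)‖ = z at *
  generalize ‖toL2 (u' - p')‖ = z' at *
  have h4 : Λ * ‖toL2 r - toL2 u‖ * e ≤ Λ * ((e + z) * e) := by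
    rw [mul_assoc]; gcongr
  have h5 : Λ * (2 * ((e + z) * e)) ≤ Λ * (3 * e ^ 2 + z ^ 2) := by
    gcongr
    nlinarith [sq_nonneg (e - z)]
  have h6 : 2 * (z' * e) ≤ z' ^ 2 + e ^ 2 := by nlinarith [sq_nonneg (e - z')]
  linarith

/-- The energy estimate: the error of the Galerkin method in a subspace `U` is bounded, uniformly
in `ν`, by the error of the projection onto `U` of the solution and of its time derivative. -/
theorem norm_sq_galerkin_error_le {d : ℕ} {Ω : Set (Space d)} (hΩ : Bornology.IsBounded Ω)
    {Cp : ℝ} (hCp : IsPoincareConstant Ω Cp) {U W : Submodule ℝ (H10 Ω)} (hUW : U ≤ W)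
    {P : H10 Ω →L[ℝ] H10 Ω} (hPU : ∀ v, P v ∈ U)
    (horth : ∀ v, ∀ z ∈ U, ⟪grad (v - P v), grad z⟫_ℝ = 0)
    {ν : ℝ} (hν : 0 < ν) {g : ℝ → ℝ} {Λ : NNReal} (hg : LipschitzWith Λ g) {f : ℝ → L2 Ω} {T : ℝ}
    (hT : 0 < T) {uh ur : ℝ → H10 Ω} (huh : IsGalerkinSolution W ν g f T uh)
    (hur : IsGalerkinSolution U ν g f T ur) (h0 : IsH10Projection U (uh 0) (ur 0))
    {uh' : ℝ → H10 Ω} (hd : ∀ t ∈ Icc 0 T, HasDerivWithinAt uh (uh' t) (Icc 0 T) t)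
    (hc : ContinuousOn uh' (Icc 0 T)) {t : ℝ} (ht : t ∈ Icc 0 T) :
    ‖toL2 (ur t - uh t)‖ ^ 2 ≤ 2 * Cp ^ 2 * ‖grad (uh t - P (uh t))‖ ^ 2 +
      2 * (Real.exp ((1 + 3 * Λ) * T) * (Cp ^ 2 * (1 + Λ))) *
        ∫ s in (0 : ℝ)..T, (‖grad (uh s - P (uh s))‖ ^ 2 + ‖grad (uh' s - P (uh' s))‖ ^ 2) := by
  have hpoin : ∀ v : H10 Ω, ‖toL2 v‖ ^ 2 ≤ Cp ^ 2 * ‖grad v‖ ^ 2 := fun v => by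
    rw [← mul_pow]; exact pow_le_pow_left₀ (norm_nonneg _) (hCp v) 2
  set e : ℝ → H10 Ω := fun t => ur t - P (uh t)
  have heU : ∀ t ∈ Icc 0 T, e t ∈ U := fun t ht => U.sub_mem (hur.1 t ht) (hPU _)
  set z : ℝ → H10 Ω := fun t => uh t - P (uh t)
  set z' : ℝ → H10 Ω := fun t => uh' t - P (uh' t)
  have huhc : ContinuousOn uh (Icc 0 T) := huh.2.1
  have hzc : ContinuousOn z (Icc 0 T) := huhc.sub (P.continuous.comp_continuousOn huhc)
  have hz'c : ContinuousOn z' (Icc 0 T) := hc.sub (P.continuous.comp_continuousOn hc)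
  have hec : ContinuousOn e (Icc 0 T) := hur.2.1.sub (P.continuous.comp_continuousOn huhc)
  have hnc : ∀ {w : ℝ → H10 Ω}, ContinuousOn w (Icc 0 T) →
      ContinuousOn (fun t => ‖toL2 (w t)‖ ^ 2) (Icc 0 T) := fun hw =>
    ((toL2L Ω).continuous.comp_continuousOn hw).norm.pow 2
  have hgc : ∀ {w : ℝ → H10 Ω}, ContinuousOn w (Icc 0 T) →
      ContinuousOn (fun t => ‖grad (w t)‖ ^ 2) (Icc 0 T) := fun hw =>
    ((gradL Ω).continuous.comp_continuousOn hw).norm.pow 2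
  set φ : ℝ → ℝ := fun t => ‖toL2 (e t)‖ ^ 2
  set ρ : ℝ → ℝ := fun t => ‖toL2 (z' t)‖ ^ 2 + Λ * ‖toL2 (z t)‖ ^ 2
  -- both `ur 0` and `P (uh 0)` are projections of `uh 0`, and `grad` is injective by Poincaré
  have hφ0 : φ 0 ≤ 0 := by
    have hzero : (0 : ℝ) ∈ Icc 0 T := ⟨le_rfl, hT.le⟩
    have h1 : ⟪grad (e 0), grad (e 0)⟫_ℝ = 0 := by
      have h2 := h0.2 _ (heU 0 hzero)
      have h3 := horth (uh 0) _ (heU 0 hzero)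
      have h4 : grad (e 0) = grad (uh 0 - P (uh 0)) - grad (uh 0 - ur 0) := by
        rw [← grad_sub, sub_sub_sub_cancel_left]
      conv_lhs => rw [h4]
      rw [inner_sub_left, ← h4, h2, h3, sub_zero]
    rw [real_inner_self_eq_norm_sq] at h1
    have := hpoin (e 0)
    rw [h1, mul_zero] at this
    exact this
  have hder : ∀ t ∈ Ioo 0 T, ∃ φ', HasDerivAt φ φ' t ∧ φ' ≤ (1 + 3 * Λ) * φ t + ρ t := by
    intro t ht
    have htI : t ∈ Icc 0 T := Ioo_subset_Icc_self ht
    have hnhds : Icc 0 T ∈ nhds t := Icc_mem_nhds ht.1 ht.2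
    obtain ⟨ur', hur', hurE⟩ := hur.2.2 t ⟨ht.1, ht.2.le⟩
    obtain ⟨uh'', huh', huhE⟩ := huh.2.2 t ⟨ht.1, ht.2.le⟩
    obtain rfl : uh'' = uh' t :=
      ((uniqueDiffOn_Icc hT) t htI).eq_deriv _ huh' (hd t htI)
    have h1 : HasDerivAt e (ur' - P (uh' t)) t :=
      (hur'.hasDerivAt hnhds).sub (P.hasFDerivAt.comp_hasDerivAt t (huh'.hasDerivAt hnhds))
    have h2 : HasDerivAt (fun t => toL2 (e t)) (toL2 (ur' - P (uh' t))) t :=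
      (toL2L Ω).hasFDerivAt.comp_hasDerivAt t h1
    refine ⟨_, h2.norm_sq, ?_⟩
    have E1 := hurE _ (heU t htI)
    have E2 := huhE _ (hUW (heU t htI))
    exact energy_inequality hΩ hν hg E1 E2 (horth (uh t) _ (heU t htI))
  choose! φ' hφ' hφle using hder
  have hρc : ContinuousOn ρ (Icc 0 T) := (hnc hz'c).add (continuousOn_const.mul (hnc hzc))
  have hgr := gronwall_integral hT.le (κ := 1 + 3 * Λ) (by positivity) (hnc hec) hφ0 hφ' hρc
    (fun t _ => by simp only [ρ]; positivity) hφle ht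
  set Θ : ℝ → ℝ := fun s => ‖grad (z s)‖ ^ 2 + ‖grad (z' s)‖ ^ 2
  have hΘc : ContinuousOn Θ (Icc 0 T) := (hgc hzc).add (hgc hz'c)
  have hρΘ : ∫ s in (0 : ℝ)..T, ρ s ≤ (Cp ^ 2 * (1 + Λ)) * ∫ s in (0 : ℝ)..T, Θ s := by
    rw [← intervalIntegral.integral_const_mul]
    refine intervalIntegral.integral_mono_on hT.le
      (ContinuousOn.intervalIntegrable (by rwa [uIcc_of_le hT.le]))
      (ContinuousOn.intervalIntegrable (by
        rw [uIcc_of_le hT.le]; exact continuousOn_const.mul hΘc)) fun s _ => ?_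
    have h1 := hpoin (z s)
    have h2 := hpoin (z' s)
    have h3 := mul_le_mul_of_nonneg_left h1 (show (0 : ℝ) ≤ Λ from Λ.2)
    have h4 : 0 ≤ Cp ^ 2 * ‖grad (z s)‖ ^ 2 := by positivity
    have h5 : 0 ≤ Λ * (Cp ^ 2 * ‖grad (z' s)‖ ^ 2) := by positivity
    simp only [ρ, Θ]
    linarith
  have hfin : ‖toL2 (ur t - uh t)‖ ^ 2 ≤ 2 * ‖toL2 (e t)‖ ^ 2 + 2 * ‖toL2 (z t)‖ ^ 2 := by
    have h1 : toL2 (ur t - uh t) = toL2 (e t) - toL2 (z t) := by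
      rw [← toL2_sub, sub_sub_sub_cancel_right]
    have h2 : ‖toL2 (ur t - uh t)‖ ^ 2 ≤ (‖toL2 (e t)‖ + ‖toL2 (z t)‖) ^ 2 := by
      rw [h1]; exact pow_le_pow_left₀ (norm_nonneg _) (norm_sub_le _ _) 2
    nlinarith [sq_nonneg (‖toL2 (e t)‖ - ‖toL2 (z t)‖)]
  have h8 : φ t ≤ Real.exp ((1 + 3 * Λ) * T) *
      ((Cp ^ 2 * (1 + Λ)) * ∫ s in (0 : ℝ)..T, Θ s) := hgr.trans (by gcongr)
  have h9 := hpoin (z t)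
  simp only [φ] at h8
  linarith

/-! ### The projection error from the snapshots -/

theorem integral_norm_sq_nonneg {X : Type} [NormedAddCommGroup X] {a b : ℝ} (hab : a ≤ b)
    (f : ℝ → X) : 0 ≤ ∫ t in a..b, ‖f t‖ ^ 2 :=
  intervalIntegral.integral_nonneg hab fun _ _ => sq_nonneg _

theorem le_dTime {α₀ αL : ℝ} {T : ℝ → ℝ} {M L l : ℕ} (hl : l ≤ L) :
    T (alphaNode α₀ αL L l) / M ≤ dTime α₀ αL T M L :=
  le_ciSup (f := fun l : Fin (L + 1) => T (alphaNode α₀ αL L l) / M)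
    (Set.finite_range _).bddAbove ⟨l, by omega⟩

theorem contDiffOn_time {X : Type} [NormedAddCommGroup X] [NormedSpace ℝ X] {α₀ αL : ℝ}
    {T : ℝ → ℝ} {n : WithTop ℕ∞} {V : ℝ × ℝ → X} (hV : ContDiffOn ℝ n V (region α₀ αL T)) {α : ℝ}
    (hα : α ∈ Icc α₀ αL) : ContDiffOn ℝ n (fun t => V (α, t)) (Icc 0 (T α)) :=
  hV.comp (contDiffOn_const.prodMk contDiffOn_id) fun _ ht => ⟨hα, ht⟩

theorem hasDerivWithinAt_time {X : Type} [NormedAddCommGroup X] [NormedSpace ℝ X] {α₀ αL : ℝ}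
    {T : ℝ → ℝ} {V : ℝ × ℝ → X} (hV : DifferentiableOn ℝ V (region α₀ αL T)) {α t : ℝ}
    (hα : α ∈ Icc α₀ αL) (ht : t ∈ Icc 0 (T α)) :
    HasDerivWithinAt (fun t => V (α, t)) (fderivWithin ℝ V (region α₀ αL T) (α, t) (0, 1))
      (Icc 0 (T α)) t := by
  have h1 : HasDerivWithinAt (fun t : ℝ => (α, t)) ((0 : ℝ), (1 : ℝ)) (Icc 0 (T α)) t :=
    (hasDerivWithinAt_const t _ α).prodMk (hasDerivWithinAt_id t _)
  exact (hV (α, t) ⟨hα, ht⟩).hasFDerivWithinAt.comp_hasDerivWithinAt t h1 fun s hs => ⟨hα, hs⟩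

/-- The curves through the nodes `j T / M` of the time grids. -/
theorem contDiffOn_node {X : Type} [NormedAddCommGroup X] [NormedSpace ℝ X] {α₀ αL : ℝ}
    {T : ℝ → ℝ} (hT : ContDiffOn ℝ ∞ T (Icc α₀ αL)) (hTpos : ∀ α ∈ Icc α₀ αL, 0 < T α) {n : ℕ}
    {V : ℝ × ℝ → X} (hV : ContDiffOn ℝ n V (region α₀ αL T)) {j M : ℕ} (hM : 0 < M) (hj : j ≤ M) :
    ContDiffOn ℝ n (fun μ => V (μ, j * (T μ / M))) (Icc α₀ αL) := by
  refine hV.comp (contDiffOn_id.prodMk ?_) fun μ hμ => ⟨hμ, ?_⟩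
  · exact contDiffOn_const.mul ((hT.of_le (by exact_mod_cast le_top)).div_const _)
  · have h := hTpos μ hμ
    have hM0 : (0 : ℝ) < M := by exact_mod_cast hM
    have hj' : (j : ℝ) ≤ M := by exact_mod_cast hj
    refine ⟨by positivity, ?_⟩
    calc (j : ℝ) * (T μ / M) ≤ M * (T μ / M) := by gcongr
      _ = T μ := by field_simp

theorem one_sub_gammaExp {m : ℕ} (hm : 2 ≤ m) :
    (1 - 1 / (2 * m : ℝ)) * (1 - 1 / (2 * m : ℝ)) = 1 - gammaExp m := by
  have : (m : ℝ) ≠ 0 := by positivity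
  simp only [gammaExp]; field_simp; ring

theorem one_sub_betaExp {m : ℕ} :
    (1 - gammaExp m) * (1 - 1 / (m : ℝ)) = 1 - betaExp m := by
  simp only [betaExp]; ring

/-- The bound for all snapshots from their mean square `τ`: the discrete Agmon inequality in the
parameter bounds the mean square over time of the snapshots for one parameter, and the one in time
then bounds the single snapshots. -/
theorem exists_snapshot_bound (m : ℕ) (hm : 2 ≤ m) {α₀ αL : ℝ} (hα : α₀ < αL) {T : ℝ → ℝ}
    (hT : ContDiffOn ℝ ∞ T (Icc α₀ αL)) (hTpos : ∀ α ∈ Icc α₀ αL, 0 < T α) :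
    ∃ K : ℝ, 0 < K ∧ ∀ {X : Type} [NormedAddCommGroup X] [NormedSpace ℝ X] [CompleteSpace X]
      {V : ℝ × ℝ → X} {M L : ℕ} {A B τ : ℝ}, ContDiffOn ℝ m V (region α₀ αL T) →
      1 ≤ M → 1 ≤ L → 0 ≤ A → 0 ≤ B →
      (∀ j ≤ M, ∑ i ∈ Finset.range (m + 1), ∫ μ in α₀..αL,
        ‖iteratedDerivWithin i (fun μ => V (μ, j * (T μ / M))) (Icc α₀ αL) μ‖ ^ 2 ≤ A ^ 2) →
      (∀ l ≤ L, ∑ i ∈ Finset.range (m + 1), ∫ t in (0 : ℝ)..T (alphaNode α₀ αL L l),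
        ‖iteratedDerivWithin i (fun t => V (alphaNode α₀ αL L l, t))
          (Icc 0 (T (alphaNode α₀ αL L l))) t‖ ^ 2 ≤ B ^ 2) →
      ((1 / (M + 1 : ℝ)) * ∑ j ∈ Finset.range (M + 1), (1 / (L + 1 : ℝ)) *
        ∑ l ∈ Finset.range (L + 1),
          ‖V (alphaNode α₀ αL L l, j * (T (alphaNode α₀ αL L l) / M))‖ ^ 2) ≤ τ →
      ∀ j ≤ M, ∀ l ≤ L, ‖V (alphaNode α₀ αL L l, j * (T (alphaNode α₀ αL L l) / M))‖ ^ 2 ≤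
        K * (A ^ ((1 - 1 / (2 * (m : ℝ))) * (1 / (m : ℝ))) * B ^ (1 / (m : ℝ))
          * τ ^ (1 - gammaExp m)) := by
  obtain ⟨μ₀, hμ₀, hmin⟩ := isCompact_Icc.exists_isMinOn (nonempty_Icc.2 hα.le) hT.continuousOn
  obtain ⟨μ₁, hμ₁, hmax⟩ := isCompact_Icc.exists_isMaxOn (nonempty_Icc.2 hα.le) hT.continuousOn
  obtain ⟨K₁, hK₁0, hK₁⟩ := exists_discrete_agmon m hm (T₀ := T μ₀) (T₁ := T μ₁) (hTpos μ₀ hμ₀)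
  obtain ⟨K₂, hK₂0, hK₂⟩ := exists_discrete_agmon m hm (T₀ := αL - α₀) (T₁ := αL - α₀)
    (sub_pos.2 hα)
  have hm0 : (0 : ℝ) < m := by exact_mod_cast (by omega : 0 < m)
  have hm2 : (2 : ℝ) ≤ m := by exact_mod_cast hm
  set θ : ℝ := 1 - 1 / (2 * m : ℝ)
  have hθ0 : 0 ≤ θ := by
    simp only [θ]; rw [sub_nonneg, div_le_one (by positivity)]; linarith
  have hθ1 : θ ≤ 1 := by simp only [θ]; linarith [show 0 ≤ 1 / (2 * m : ℝ) by positivity]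
  refine ⟨K₁ * K₂ ^ θ, by positivity, ?_⟩
  intro X _ _ _ V M L A B τ hV hM hL hA0 hB0 hA hB hτ j hj l hl
  have hM0 : (0 : ℝ) < M := by exact_mod_cast hM
  have hL0 : (0 : ℝ) < L := by exact_mod_cast hL
  set z : ℕ → ℕ → ℝ := fun j l => ‖V (alphaNode α₀ αL L l, j * (T (alphaNode α₀ αL L l) / M))‖ ^ 2
  have hz0 : ∀ j l, 0 ≤ z j l := fun _ _ => sq_nonneg _
  set w : ℕ → ℝ := fun j => (1 / (L + 1 : ℝ)) * ∑ l ∈ Finset.range (L + 1), z j l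
  have hw0 : ∀ j, 0 ≤ w j := fun j =>
    mul_nonneg (by positivity) (Finset.sum_nonneg fun _ _ => hz0 _ _)
  -- the inequality in the parameter
  have hparam : ∀ j ≤ M, z j l ≤ K₂ * (w j ^ θ * (A ^ 2) ^ (1 / (2 * m : ℝ))) := by
    intro j hj
    have hLd : L * dAlpha α₀ αL L = αL - α₀ := by simp only [dAlpha]; field_simp
    have hend : α₀ + L * dAlpha α₀ αL L = αL := by rw [hLd]; ring
    have hchain := IsDerivChain.of_contDiffOn hα (contDiffOn_node hT hTpos hV hM hj)
    have h1 := hK₂ (A := α₀) (h := dAlpha α₀ αL L) (M := L) (j := l) (b := A ^ 2)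
      (by rw [hend]; exact hchain) (dAlpha_pos hα hL) hLd.ge hLd.le hL hl
      (by rw [hend]; exact hA j hj)
    simp only [iteratedDerivWithin_zero] at h1
    exact h1
  -- the inequality in time
  set α := alphaNode α₀ αL L l
  have hα' : α ∈ Icc α₀ αL := alphaNode_mem hα hl
  have hTα := hTpos α hα'
  have htime : z j l ≤ K₁ * (((1 / (M + 1 : ℝ)) * ∑ i ∈ Finset.range (M + 1), z i l) ^ θ
      * (B ^ 2) ^ (1 / (2 * m : ℝ))) := by
    have hMh : M * (T α / M) = T α := by field_simp
    have hchain := IsDerivChain.of_contDiffOn hTα (contDiffOn_time hV hα')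
    have h1 := hK₁ (A := 0) (h := T α / M) (M := M) (j := j) (b := B ^ 2)
      (by rw [hMh, zero_add]; exact hchain) (by positivity) (by rw [hMh]; exact hmin hα')
      (by rw [hMh]; exact hmax hα') hM hj (by rw [hMh, zero_add]; exact hB l hl)
    simpa only [iteratedDerivWithin_zero, zero_add] using h1
  have hjensen : (1 / (M + 1 : ℝ)) * ∑ i ∈ Finset.range (M + 1), w i ^ θ ≤
      ((1 / (M + 1 : ℝ)) * ∑ i ∈ Finset.range (M + 1), w i) ^ θ := by
    have := (Real.concaveOn_rpow hθ0 hθ1).le_map_sum (t := Finset.range (M + 1))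
      (w := fun _ => 1 / (M + 1 : ℝ)) (p := w) (fun _ _ => by positivity)
      (by simp; field_simp) (fun i _ => hw0 i)
    simpa only [smul_eq_mul, Finset.mul_sum] using this
  have hmean : (1 / (M + 1 : ℝ)) * ∑ i ∈ Finset.range (M + 1), z i l ≤
      K₂ * (A ^ 2) ^ (1 / (2 * m : ℝ)) * τ ^ θ := by
    have h1 : ∑ i ∈ Finset.range (M + 1), z i l ≤
        K₂ * (A ^ 2) ^ (1 / (2 * m : ℝ)) * ∑ i ∈ Finset.range (M + 1), w i ^ θ := by
      rw [Finset.mul_sum]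
      refine Finset.sum_le_sum fun i hi => (hparam i ?_).trans (le_of_eq (by ring))
      have := Finset.mem_range.1 hi
      omega
    have h2 : ((1 / (M + 1 : ℝ)) * ∑ i ∈ Finset.range (M + 1), w i) ^ θ ≤ τ ^ θ :=
      Real.rpow_le_rpow (mul_nonneg (by positivity) (Finset.sum_nonneg fun _ _ => hw0 _)) hτ hθ0
    have hcoef : 0 ≤ K₂ * (A ^ 2) ^ (1 / (2 * m : ℝ)) := by positivity
    calc _ ≤ (1 / (M + 1 : ℝ)) *
          (K₂ * (A ^ 2) ^ (1 / (2 * m : ℝ)) * ∑ i ∈ Finset.range (M + 1), w i ^ θ) := by gcongr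
      _ = K₂ * (A ^ 2) ^ (1 / (2 * m : ℝ)) *
          ((1 / (M + 1 : ℝ)) * ∑ i ∈ Finset.range (M + 1), w i ^ θ) := by ring
      _ ≤ _ := mul_le_mul_of_nonneg_left (hjensen.trans h2) hcoef
  have hτ0 : 0 ≤ τ := le_trans (mul_nonneg (by positivity) (Finset.sum_nonneg fun _ _ => hw0 _)) hτ
  have hzmean : 0 ≤ (1 / (M + 1 : ℝ)) * ∑ i ∈ Finset.range (M + 1), z i l :=
    mul_nonneg (by positivity) (Finset.sum_nonneg fun _ _ => hz0 _ _)
  have hA2 : (A ^ 2) ^ (1 / (2 * m : ℝ)) = A ^ (1 / (m : ℝ)) := by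
    rw [← Real.rpow_natCast, ← Real.rpow_mul hA0]; congr 1; push_cast; field_simp
  have hB2 : (B ^ 2) ^ (1 / (2 * m : ℝ)) = B ^ (1 / (m : ℝ)) := by
    rw [← Real.rpow_natCast, ← Real.rpow_mul hB0]; congr 1; push_cast; field_simp
  change z j l ≤ _
  calc z j l ≤ _ := htime
    _ ≤ K₁ * ((K₂ * (A ^ 2) ^ (1 / (2 * m : ℝ)) * τ ^ θ) ^ θ * (B ^ 2) ^ (1 / (2 * m : ℝ))) := by
        gcongr
    _ = _ := by
        rw [hA2, hB2, Real.mul_rpow (by positivity) (by positivity),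
          Real.mul_rpow hK₂0.le (by positivity), ← Real.rpow_mul hA0, ← Real.rpow_mul hτ0,
          one_sub_gammaExp hm, mul_comm (1 / (m : ℝ)) θ]
        ring

/-- The error of the projection of `V` (at one time, in `L²` in time, and for the time derivative
in `L²` in time) for all parameters, from the mean square `τ` of its values at the nodes of the
grid. Here `A` and `B` bound the norms of `V` in the parameter and in time, `R` the time derivatives
of order `q + 1`, and `S₀` and `S₁` the mixed derivatives. -/
theorem exists_projection_error_bound (q m : ℕ) (hq : 2 ≤ q) (hm : 2 ≤ m) {α₀ αL : ℝ}
    (hα : α₀ < αL) {T : ℝ → ℝ} (hT : ContDiffOn ℝ ∞ T (Icc α₀ αL))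
    (hTpos : ∀ α ∈ Icc α₀ αL, 0 < T α) :
    ∃ K : ℝ, 0 < K ∧ ∀ {X : Type} [NormedAddCommGroup X] [NormedSpace ℝ X] [CompleteSpace X]
      {V : ℝ × ℝ → X} {M L l : ℕ} {A B τ α t : ℝ} {S₀ S₁ : ℝ × ℝ → ℝ} {R : ℕ → ℝ},
      ContDiffOn ℝ ((max q m + 1 : ℕ) : WithTop ℕ∞) V (region α₀ αL T) →
      q ≤ M → 0 ≤ A → 0 ≤ B →
      (∀ j ≤ M, ∑ i ∈ Finset.range (m + 1), ∫ μ in α₀..αL,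
        ‖iteratedDerivWithin i (fun μ => V (μ, j * (T μ / M))) (Icc α₀ αL) μ‖ ^ 2 ≤ A ^ 2) →
      (∀ l ≤ L, ∑ i ∈ Finset.range (m + 1), ∫ t in (0 : ℝ)..T (alphaNode α₀ αL L l),
        ‖iteratedDerivWithin i (fun t => V (alphaNode α₀ αL L l, t))
          (Icc 0 (T (alphaNode α₀ αL L l))) t‖ ^ 2 ≤ B ^ 2) →
      ((1 / (M + 1 : ℝ)) * ∑ j ∈ Finset.range (M + 1), (1 / (L + 1 : ℝ)) *
        ∑ l ∈ Finset.range (L + 1),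
          ‖V (alphaNode α₀ αL L l, j * (T (alphaNode α₀ αL L l) / M))‖ ^ 2) ≤ τ →
      (∀ l ≤ L, ∫ t in (0 : ℝ)..T (alphaNode α₀ αL L l),
        ‖iteratedDerivWithin (q + 1) (fun t => V (alphaNode α₀ αL L l, t))
          (Icc 0 (T (alphaNode α₀ αL L l))) t‖ ^ 2 ≤ R l) →
      ContinuousOn S₀ (region α₀ αL T) → ContinuousOn S₁ (region α₀ αL T) →
      (∀ p, 0 ≤ S₀ p) → (∀ p, 0 ≤ S₁ p) →
      (∀ n ≤ m, ∀ i ≤ n, ∀ p ∈ region α₀ αL T,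
        ‖iteratedFDerivWithin ℝ n V (region α₀ αL T) p (mixedDir n i)‖ ^ 2 ≤ S₀ p ∧
        ‖iteratedFDerivWithin ℝ n V (region α₀ αL T) p (mixedDir n i)‖ ^ 2 ≤ S₁ p ∧
        ‖iteratedFDerivWithin ℝ (n + 1) V (region α₀ αL T) p (mixedDir (n + 1) (i + 1))‖ ^ 2
          ≤ S₁ p) →
      l + m ≤ L + 1 → α ∈ Icc α₀ αL →
      α ∈ Icc (alphaNode α₀ αL L l) (alphaNode α₀ αL L (l + m - 1)) → t ∈ Icc 0 (T α) →
      ∀ c : ℝ, c = A ^ ((1 - 1 / (2 * (m : ℝ))) * (1 / (m : ℝ))) * B ^ (1 / (m : ℝ)) →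
      ‖V (α, t)‖ ^ 2 + (∫ s in (0 : ℝ)..T α, (‖V (α, s)‖ ^ 2 +
          ‖fderivWithin ℝ V (region α₀ αL T) (α, s) (0, 1)‖ ^ 2)) ≤
        K * (c * τ ^ (1 - gammaExp m)
          + c ^ (1 - 1 / (m : ℝ)) * B ^ (2 / (m : ℝ)) * τ ^ (1 - betaExp m)
          + (∑ j ∈ Finset.Icc l (l + m - 1), R j) * dTime α₀ αL T M L ^ (2 * q)
          + ((∫ μ in alphaNode α₀ αL L l..alphaNode α₀ αL L (l + m - 1),
                ∫ t in (0 : ℝ)..T μ, S₁ (μ, t))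
            + ∫ μ in alphaNode α₀ αL L l..alphaNode α₀ αL L (l + m - 1), S₀ (μ, T μ * t / T α))
              * dAlpha α₀ αL L ^ (2 * m - 1)) := by
  obtain ⟨μ₀, hμ₀, hmin⟩ := isCompact_Icc.exists_isMinOn (nonempty_Icc.2 hα.le) hT.continuousOn
  obtain ⟨μ₁, hμ₁, hmax⟩ := isCompact_Icc.exists_isMaxOn (nonempty_Icc.2 hα.le) hT.continuousOn
  have hT1 := hTpos μ₁ hμ₁
  obtain ⟨K₁, hK₁0, hK₁⟩ := exists_snapshot_bound m hm hα hT hTpos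
  obtain ⟨K₂, hK₂0, hK₂⟩ := exists_pointwise_bound q hq (T μ₁)
  obtain ⟨K₃, hK₃0, hK₃⟩ := exists_discrete_gagliardoNirenberg q m hq hm (T₀ := T μ₀)
    (T₁ := T μ₁) (hTpos μ₀ hμ₀)
  obtain ⟨K₄, hK₄0, hK₄⟩ := exists_parameter_interpolation m hm hα hT hTpos
  have hm0 : (0 : ℝ) < m := by exact_mod_cast (by omega : 0 < m)
  set ϑ : ℝ := 1 - 1 / (m : ℝ)
  have hϑ : 0 ≤ ϑ := by
    simp only [ϑ]; rw [sub_nonneg, div_le_one hm0]; exact_mod_cast (by omega : 1 ≤ m)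
  set k₁ := m * (K₂ * K₁) + K₂ + 4 ^ m
  set k₂ := T μ₁ * (m * (K₂ * K₁) + K₂) + 4 ^ m
  set k₃ := m * (K₃ * K₁ ^ ϑ) + K₃ + 4 ^ m
  refine ⟨K₄ * (k₁ + k₂ + k₃), by positivity, ?_⟩
  intro X _ _ _ V M L l A B τ α t S₀ S₁ R hV hqM hA0 hB0 hA hB hτ hR hS₀ hS₁ hS₀0 hS₁0 hmix hl hα'
    hαl ht c hc
  have hM : 0 < M := by omega
  have hL : 0 < L := by omega
  have hM0 : (0 : ℝ) < M := by exact_mod_cast hM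
  have hTα := hTpos α hα'
  have hVm : ContDiffOn ℝ m V (region α₀ αL T) :=
    hV.of_le (by exact_mod_cast (le_max_right q m).trans (Nat.le_succ _))
  have hVm1 : ContDiffOn ℝ ((m + 1 : ℕ) : WithTop ℕ∞) V (region α₀ αL T) :=
    hV.of_le (by exact_mod_cast Nat.succ_le_succ (le_max_right q m))
  have hVd : DifferentiableOn ℝ V (region α₀ αL T) :=
    hV.differentiableOn (by simp)
  have hU := uniqueDiffOn_region hα hT hTpos
  have hcl := region_subset_closure_interior hα hT.continuousOn hTpos
  have hc0 : 0 ≤ c := by rw [hc]; positivity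
  have hτ0 : 0 ≤ τ := le_trans (mul_nonneg (by positivity) (Finset.sum_nonneg fun _ _ =>
    mul_nonneg (by positivity) (Finset.sum_nonneg fun _ _ => sq_nonneg _))) hτ
  set a := c * τ ^ (1 - gammaExp m)
  have ha0 : 0 ≤ a := by positivity
  set b := c ^ ϑ * B ^ (2 / (m : ℝ)) * τ ^ (1 - betaExp m)
  have hb0 : 0 ≤ b := by positivity
  have hnodes := hK₁ hVm hM hL hA0 hB0 hA hB hτ
  rw [← hc] at hnodes
  have hpow : (K₁ * a) ^ ϑ * (B ^ 2) ^ (1 / (m : ℝ)) = K₁ ^ ϑ * b := by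
    have hB2 : (B ^ 2) ^ (1 / (m : ℝ)) = B ^ (2 / (m : ℝ)) := by
      rw [← Real.rpow_natCast, ← Real.rpow_mul hB0]; congr 1; push_cast; ring
    simp only [a, b]
    rw [hB2, Real.mul_rpow hK₁0.le ha0, Real.mul_rpow hc0 (by positivity), ← Real.rpow_mul hτ0,
      one_sub_betaExp]
    ring
  set η := dTime α₀ αL T M L ^ (2 * q)
  have hη0 : 0 ≤ η := by simp only [η]; rw [pow_mul]; positivity
  -- the derivative in time
  set W : ℝ × ℝ → X := fun p => fderivWithin ℝ V (region α₀ αL T) p (0, 1)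
  have hRi0 : ∀ i ≤ L, 0 ≤ R i := fun i hi =>
    (integral_norm_sq_nonneg (hTpos _ (alphaNode_mem hα hi)).le _).trans (hR i hi)
  -- interpolation in time for the parameters of the grid
  have hgrid : ∀ i ≤ L, (∀ s ∈ Icc 0 (T (alphaNode α₀ αL L i)),
      ‖V (alphaNode α₀ αL L i, s)‖ ^ 2 ≤ K₂ * K₁ * a + K₂ * (R i * η)) ∧
      ∫ s in (0 : ℝ)..T (alphaNode α₀ αL L i), ‖W (alphaNode α₀ αL L i, s)‖ ^ 2 ≤
        K₃ * K₁ ^ ϑ * b + K₃ * (R i * η) := by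
    intro i hi
    set β := alphaNode α₀ αL L i
    have hβ : β ∈ Icc α₀ αL := alphaNode_mem hα hi
    have hTβ := hTpos β hβ
    have hMh : M * (T β / M) = T β := by field_simp
    have hh : 0 < T β / M := by positivity
    have hchain := IsDerivChain.of_contDiffOn hTβ (contDiffOn_time hV hβ)
    have hη : (T β / M) ^ (2 * q) ≤ η := pow_le_pow_left₀ hh.le (le_dTime hi) _
    have hηR : (T β / M) ^ (2 * q) * (∫ t in (0 : ℝ)..T β, ‖iteratedDerivWithin (q + 1)
        (fun t => V (β, t)) (Icc 0 (T β)) t‖ ^ 2) ≤ R i * η := by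
      rw [mul_comm (R i)]
      exact mul_le_mul hη (hR i hi) (integral_norm_sq_nonneg hTβ.le _) hη0
    constructor
    · intro s hs
      have h1 := hK₂ (h := T β / M) (x := K₁ * a) (t := s) (M := M)
        (by rw [hMh]; exact hchain.of_le (by omega)) hh (by rw [hMh]; exact hmax hβ) hqM
        (fun j hj => by simpa only [iteratedDerivWithin_zero] using hnodes j hj i hi)
        (by rwa [hMh])
      rw [hMh] at h1
      simp only [iteratedDerivWithin_zero] at h1
      refine h1.trans ?_
      have := mul_le_mul_of_nonneg_left hηR hK₂0.le
      linarith
    · have h1 := hK₃ (h := T β / M) (x := K₁ * a) (b := B ^ 2) (M := M)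
        (by rw [hMh]; exact hchain) hh (by rw [hMh]; exact hmin hβ)
        (by rw [hMh]; exact hmax hβ) hqM (by positivity)
        (fun j hj => by simpa only [iteratedDerivWithin_zero] using hnodes j hj i hi)
        (by rw [hMh]; exact hB i hi)
      rw [hMh] at h1
      have h2 : ∫ s in (0 : ℝ)..T β, ‖W (β, s)‖ ^ 2 =
          ∫ s in (0 : ℝ)..T β, ‖iteratedDerivWithin 1 (fun t => V (β, t)) (Icc 0 (T β)) s‖ ^ 2 := by
        refine intervalIntegral.integral_congr fun s hs => ?_
        rw [uIcc_of_le hTβ.le] at hs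
        simp only [W]
        rw [iteratedDerivWithin_one, (hasDerivWithinAt_time hVd hβ hs).derivWithin
          ((uniqueDiffOn_Icc hTβ) s hs)]
      rw [h2]
      refine h1.trans ?_
      change K₃ * ((K₁ * a) ^ ϑ * _ + _) ≤ _
      rw [hpow]
      have := mul_le_mul_of_nonneg_left hηR hK₃0.le
      linarith
  set ρ := (∑ j ∈ Finset.Icc l (l + m - 1), R j) * η
  have hρ : ∑ i ∈ Finset.range m, R (l + i) * η = ρ := by
    simp only [ρ]
    rw [← Finset.sum_mul]
    congr 1
    have : Finset.Icc l (l + m - 1) = Finset.Ico l (l + m) := by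
      ext j; simp only [Finset.mem_Icc, Finset.mem_Ico]; omega
    rw [this, Finset.sum_Ico_eq_sum_range, Nat.add_sub_cancel_left]
  have hρ0 : 0 ≤ ρ := by
    rw [← hρ]
    exact Finset.sum_nonneg fun i hi =>
      mul_nonneg (hRi0 _ (by have := Finset.mem_range.1 hi; omega)) hη0
  have hsum : ∀ {f : ℕ → ℝ} {u v : ℝ}, (∀ i < m, f i ≤ u + v * (R (l + i) * η)) →
      ∑ i ∈ Finset.range m, f i ≤ m * u + v * ρ := by
    intro f u v hf
    refine (Finset.sum_le_sum fun i hi => hf i (Finset.mem_range.1 hi)).trans ?_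
    rw [Finset.sum_add_distrib, ← Finset.mul_sum, hρ]
    simp
  -- all derivatives are controlled by the mixed ones
  have hnorm : ∀ {U : ℝ × ℝ → X} {S : ℝ × ℝ → ℝ}, ContDiffOn ℝ m U (region α₀ αL T) →
      (∀ p, 0 ≤ S p) → (∀ n ≤ m, ∀ i ≤ n, ∀ p ∈ region α₀ αL T,
        ‖iteratedFDerivWithin ℝ n U (region α₀ αL T) p (mixedDir n i)‖ ^ 2 ≤ S p) →
      ∀ n ≤ m, ∀ p ∈ region α₀ αL T,
        ‖iteratedFDerivWithin ℝ n U (region α₀ αL T) p‖ ^ 2 ≤ 4 ^ m * S p := by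
    intro U S hUm hS0 hS n hn p hp
    have h1 := norm_iteratedFDerivWithin_le_of_mixedDir hU hcl (hUm.of_le (by exact_mod_cast hn))
      hp (Real.sqrt_nonneg (S p)) fun i hi => Real.le_sqrt_of_sq_le (hS n hn i hi p hp)
    have h2 := pow_le_pow_left₀ (norm_nonneg _) h1 2
    have h3 : (4 : ℝ) ^ n ≤ 4 ^ m := pow_le_pow_right₀ (by norm_num) hn
    calc _ ≤ _ := h2
      _ = 4 ^ n * S p := by
        rw [mul_pow, Real.sq_sqrt (hS0 p), ← pow_mul, mul_comm n 2, pow_mul]; norm_num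
      _ ≤ 4 ^ m * S p := mul_le_mul_of_nonneg_right h3 (hS0 p)
  have hWm : ContDiffOn ℝ m W (region α₀ αL T) :=
    (hVm1.fderivWithin hU (by exact_mod_cast le_rfl)).clm_apply contDiffOn_const
  have hWmix : ∀ n ≤ m, ∀ i ≤ n, ∀ p ∈ region α₀ αL T,
      ‖iteratedFDerivWithin ℝ n W (region α₀ αL T) p (mixedDir n i)‖ ^ 2 ≤ S₁ p := by
    intro n hn i hi p hp
    rw [iteratedFDerivWithin_timeDeriv hU hcl
      (hVm1.of_le (by exact_mod_cast Nat.succ_le_succ hn)) hi hp]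
    exact (hmix n hn i hi p hp).2.2
  set x := alphaNode α₀ αL L l
  set y := alphaNode α₀ αL L (l + m - 1)
  have hxy : x ≤ y := hαl.1.trans hαl.2
  have hsub : Icc x y ⊆ Icc α₀ αL :=
    Icc_subset_Icc (alphaNode_mem hα (by omega)).1 (alphaNode_mem hα (by omega)).2
  set J₀ := ∫ μ in x..y, S₀ (μ, T μ * t / T α)
  set J₁ := ∫ μ in x..y, ∫ t in (0 : ℝ)..T μ, S₁ (μ, t)
  have hJ₀ : 0 ≤ J₀ := intervalIntegral.integral_nonneg hxy fun _ _ => hS₀0 _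
  have hJ₁ : 0 ≤ J₁ := intervalIntegral.integral_nonneg hxy fun μ hμ =>
    intervalIntegral.integral_nonneg (hTpos μ (hsub hμ)).le fun _ _ => hS₁0 _
  have hd := dAlpha_pos hα hL
  set δ := dAlpha α₀ αL L ^ (2 * m - 1)
  have hδ : 0 ≤ δ := by positivity
  have hpt := (hK₄ (S := fun p => 4 ^ m * S₀ p) hVm (continuousOn_const.mul hS₀)
    (fun p => mul_nonneg (by positivity) (hS₀0 p))
    (hnorm hVm hS₀0 fun n hn i hi p hp => (hmix n hn i hi p hp).1) hl hα' hαl).1 t ht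
  have hV2 := (hK₄ (S := fun p => 4 ^ m * S₁ p) hVm (continuousOn_const.mul hS₁)
    (fun p => mul_nonneg (by positivity) (hS₁0 p))
    (hnorm hVm hS₁0 fun n hn i hi p hp => (hmix n hn i hi p hp).2.1) hl hα' hαl).2
  have hW2 := (hK₄ (S := fun p => 4 ^ m * S₁ p) hWm (continuousOn_const.mul hS₁)
    (fun p => mul_nonneg (by positivity) (hS₁0 p)) (hnorm hWm hS₁0 hWmix) hl hα' hαl).2
  simp only [intervalIntegral.integral_const_mul] at hpt hV2 hW2
  set Z := a + b + ρ + (J₁ + J₀) * δ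
  have hJδ₀ : 0 ≤ J₀ * δ := mul_nonneg hJ₀ hδ
  have hJδ₁ : 0 ≤ J₁ * δ := mul_nonneg hJ₁ hδ
  have hZ : Z = a + b + ρ + (J₁ * δ + J₀ * δ) := by simp only [Z]; ring
  have haZ : a ≤ Z := by linarith
  have hbZ : b ≤ Z := by linarith
  have hρZ : ρ ≤ Z := by linarith
  have hJ₀Z : J₀ * δ ≤ Z := by linarith
  have hJ₁Z : J₁ * δ ≤ Z := by linarith
  have h4m : (0 : ℝ) ≤ 4 ^ m := by positivity
  -- each of the three quantities is bounded by the values at `m` grid parameters and a remainder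
  have bound₁ : ‖V (α, t)‖ ^ 2 ≤ K₄ * (k₁ * Z) := by
    refine hpt.trans (mul_le_mul_of_nonneg_left ?_ hK₄0.le)
    have h1 := hsum (f := fun i =>
      ‖V (alphaNode α₀ αL L (l + i), T (alphaNode α₀ αL L (l + i)) * t / T α)‖ ^ 2)
      (u := K₂ * K₁ * a) (v := K₂) fun i hi => by
        have hiL : l + i ≤ L := by omega
        have h2 := regionMap_mem hTpos (p := (alphaNode α₀ αL L (l + i), t / T α))
          ⟨alphaNode_mem hα hiL, div_nonneg ht.1 hTα.le, (div_le_one hTα).2 ht.2⟩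
        refine (hgrid (l + i) hiL).1 _ ?_
        simpa only [regionMap, mul_div_assoc] using h2.2
    have e1 : m * (K₂ * K₁) * a ≤ m * (K₂ * K₁) * Z := by gcongr
    have e2 : K₂ * ρ ≤ K₂ * Z := by gcongr
    have e3 : 4 ^ m * (J₀ * δ) ≤ 4 ^ m * Z := mul_le_mul_of_nonneg_left hJ₀Z h4m
    simp only [k₁]
    change _ + δ * (4 ^ m * J₀) ≤ _
    linarith
  have bound₂ : ∫ s in (0 : ℝ)..T α, ‖V (α, s)‖ ^ 2 ≤ K₄ * (k₂ * Z) := by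
    refine hV2.trans (mul_le_mul_of_nonneg_left ?_ hK₄0.le)
    have h1 := hsum (f := fun i => ∫ s in (0 : ℝ)..T (alphaNode α₀ αL L (l + i)),
      ‖V (alphaNode α₀ αL L (l + i), s)‖ ^ 2)
      (u := T μ₁ * (K₂ * K₁ * a)) (v := T μ₁ * K₂) fun i hi => by
        have hiL : l + i ≤ L := by omega
        have hβ := alphaNode_mem hα hiL
        have hTβ := hTpos _ hβ
        have h2 := intervalIntegral.integral_mono_on hTβ.le
          (ContinuousOn.intervalIntegrable (by
            rw [uIcc_of_le hTβ.le]
            exact (contDiffOn_time hV hβ).continuousOn.norm.pow 2))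
          (continuous_const.intervalIntegrable (μ := volume) _ _)
          (hgrid (l + i) hiL).1
        rw [intervalIntegral.integral_const, smul_eq_mul, sub_zero] at h2
        have h3 : T (alphaNode α₀ αL L (l + i)) ≤ T μ₁ := hmax hβ
        have h4 : 0 ≤ K₂ * K₁ * a + K₂ * (R (l + i) * η) := by
          have := hRi0 _ hiL
          positivity
        have h5 := mul_le_mul_of_nonneg_right h3 h4
        refine h2.trans (h5.trans (le_of_eq (by ring)))
    have e1 : T μ₁ * (m * (K₂ * K₁)) * a ≤ T μ₁ * (m * (K₂ * K₁)) * Z := by gcongr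
    have e2 : T μ₁ * K₂ * ρ ≤ T μ₁ * K₂ * Z := by gcongr
    have e3 : 4 ^ m * (J₁ * δ) ≤ 4 ^ m * Z := mul_le_mul_of_nonneg_left hJ₁Z h4m
    simp only [k₂]
    change _ + δ * (4 ^ m * J₁) ≤ _
    linarith
  have bound₃ : ∫ s in (0 : ℝ)..T α, ‖W (α, s)‖ ^ 2 ≤ K₄ * (k₃ * Z) := by
    refine hW2.trans (mul_le_mul_of_nonneg_left ?_ hK₄0.le)
    have h1 := hsum (f := fun i => ∫ s in (0 : ℝ)..T (alphaNode α₀ αL L (l + i)),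
      ‖W (alphaNode α₀ αL L (l + i), s)‖ ^ 2)
      (u := K₃ * K₁ ^ ϑ * b) (v := K₃) fun i hi => (hgrid (l + i) (by omega)).2
    have e1 : m * (K₃ * K₁ ^ ϑ) * b ≤ m * (K₃ * K₁ ^ ϑ) * Z := by gcongr
    have e2 : K₃ * ρ ≤ K₃ * Z := by gcongr
    have e3 : 4 ^ m * (J₁ * δ) ≤ 4 ^ m * Z := mul_le_mul_of_nonneg_left hJ₁Z h4m
    simp only [k₃]
    change _ + δ * (4 ^ m * J₁) ≤ _
    linarith
  have hcont : ∀ {U : ℝ × ℝ → X}, ContDiffOn ℝ m U (region α₀ αL T) →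
      IntervalIntegrable (fun s => ‖U (α, s)‖ ^ 2) volume 0 (T α) := fun hUm =>
    ContinuousOn.intervalIntegrable (by
      rw [uIcc_of_le hTα.le]
      exact (contDiffOn_time hUm hα').continuousOn.norm.pow 2)
  have hadd : ∫ s in (0 : ℝ)..T α, (‖V (α, s)‖ ^ 2 + ‖W (α, s)‖ ^ 2) =
      (∫ s in (0 : ℝ)..T α, ‖V (α, s)‖ ^ 2) + ∫ s in (0 : ℝ)..T α, ‖W (α, s)‖ ^ 2 :=
    intervalIntegral.integral_add (hcont hVm) (hcont hWm)
  change ‖V (α, t)‖ ^ 2 + (∫ s in (0 : ℝ)..T α, (‖V (α, s)‖ ^ 2 + ‖W (α, s)‖ ^ 2)) ≤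
    K₄ * (k₁ + k₂ + k₃) * Z
  rw [hadd]
  linarith

/-! ### The error of the reduced order model -/

section

variable {d : ℕ} {Ω : Set (Space d)} {X : Type} [NormedAddCommGroup X] [NormedSpace ℝ X]

theorem iteratedDerivWithin_clm_comp (G : H10 Ω →L[ℝ] X) {n i : ℕ} {a b : ℝ} (hab : a < b)
    {w : ℝ → H10 Ω} (hw : ContDiffOn ℝ n w (Icc a b)) (hi : i ≤ n) {s : ℝ} (hs : s ∈ Icc a b) :
    iteratedDerivWithin i (fun s => G (w s)) (Icc a b) s =
      G (iteratedDerivWithin i w (Icc a b) s) := by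
  have h := G.iteratedFDerivWithin_comp_left (hw s hs) (uniqueDiffOn_Icc hab) hs
    (i := i) (by exact_mod_cast hi)
  rw [iteratedDerivWithin_eq_iteratedFDerivWithin, iteratedDerivWithin_eq_iteratedFDerivWithin]
  exact congrArg (fun F => F fun _ => (1 : ℝ)) h

theorem continuousOn_norm_sq_grad_iteratedDerivWithin {n i : ℕ} {a b : ℝ} (hab : a < b)
    {w : ℝ → H10 Ω} (hw : ContDiffOn ℝ n w (Icc a b)) (hi : i ≤ n) :
    ContinuousOn (fun s => ‖grad (iteratedDerivWithin i w (Icc a b) s)‖ ^ 2) (Icc a b) :=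
  (((gradL Ω).continuous.comp_continuousOn (hw.continuousOn_iteratedDerivWithin
    (by exact_mod_cast hi) (uniqueDiffOn_Icc hab))).norm).pow 2

theorem integral_norm_sq_clm_comp_le {G : H10 Ω →L[ℝ] X} (hG : ∀ v, ‖G v‖ ≤ ‖grad v‖) {n i : ℕ}
    {a b : ℝ} (hab : a < b) {w : ℝ → H10 Ω} (hw : ContDiffOn ℝ n w (Icc a b)) (hi : i ≤ n) :
    ∫ s in a..b, ‖iteratedDerivWithin i (fun s => G (w s)) (Icc a b) s‖ ^ 2 ≤
      ∫ s in a..b, ‖grad (iteratedDerivWithin i w (Icc a b) s)‖ ^ 2 := by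
  have hGw : ContDiffOn ℝ n (fun s => G (w s)) (Icc a b) := G.contDiff.comp_contDiffOn hw
  refine intervalIntegral.integral_mono_on hab.le
    (ContinuousOn.intervalIntegrable ?_) (ContinuousOn.intervalIntegrable ?_) fun s hs => ?_
  · rw [uIcc_of_le hab.le]
    exact ((hGw.continuousOn_iteratedDerivWithin (by exact_mod_cast hi)
      (uniqueDiffOn_Icc hab)).norm).pow 2
  · rw [uIcc_of_le hab.le]
    exact continuousOn_norm_sq_grad_iteratedDerivWithin hab hw hi
  · rw [iteratedDerivWithin_clm_comp G hab hw hi hs]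
    exact pow_le_pow_left₀ (norm_nonneg _) (hG _) 2

theorem sum_integral_clm_comp_le {G : H10 Ω →L[ℝ] X} (hG : ∀ v, ‖G v‖ ≤ ‖grad v‖) {m : ℕ}
    {a b : ℝ} (hab : a < b) {w : ℝ → H10 Ω} (hw : ContDiffOn ℝ m w (Icc a b)) :
    ∑ i ∈ Finset.range (m + 1),
      ∫ s in a..b, ‖iteratedDerivWithin i (fun s => G (w s)) (Icc a b) s‖ ^ 2 ≤
      sobolevNorm m a b w ^ 2 := by
  rw [sobolevNorm, Real.sq_sqrt (Finset.sum_nonneg fun i _ =>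
    integral_norm_sq_nonneg hab.le _)]
  exact Finset.sum_le_sum fun i hi =>
    integral_norm_sq_clm_comp_le hG hab hw (Finset.mem_range_succ_iff.1 hi)

theorem sobolevNorm_nonneg {m : ℕ} {a b : ℝ} {w : ℝ → H10 Ω} : 0 ≤ sobolevNorm m a b w :=
  Real.sqrt_nonneg _

theorem timeNorm_nonneg {m L : ℕ} {α₀ αL : ℝ} {T : ℝ → ℝ} {u : ℝ → ℝ → H10 Ω} :
    0 ≤ timeNorm m α₀ αL T L u := Real.iSup_nonneg fun _ => sobolevNorm_nonneg

theorem paramNorm_nonneg {m M : ℕ} {α₀ αL : ℝ} {T : ℝ → ℝ} {u : ℝ → ℝ → H10 Ω} :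
    0 ≤ paramNorm m α₀ αL T M u := Real.iSup_nonneg fun _ => sobolevNorm_nonneg

theorem sobolevNorm_le_timeNorm {m L l : ℕ} {α₀ αL : ℝ} {T : ℝ → ℝ} {u : ℝ → ℝ → H10 Ω}
    (hl : l ≤ L) : sobolevNorm m 0 (T (alphaNode α₀ αL L l)) (u (alphaNode α₀ αL L l)) ≤
      timeNorm m α₀ αL T L u :=
  le_ciSup (f := fun l : Fin (L + 1) =>
    sobolevNorm m 0 (T (alphaNode α₀ αL L l)) (u (alphaNode α₀ αL L l)))
    (Set.finite_range _).bddAbove ⟨l, by omega⟩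

theorem sobolevNorm_le_paramNorm {m M j : ℕ} {α₀ αL : ℝ} {T : ℝ → ℝ} {u : ℝ → ℝ → H10 Ω}
    (hj : j ≤ M) : sobolevNorm m α₀ αL (fun μ => u μ ((j : ℝ) * (T μ / M))) ≤
      paramNorm m α₀ αL T M u :=
  le_ciSup (f := fun j : Fin (M + 1) => sobolevNorm m α₀ αL (fun μ => u μ ((j : ℝ) * (T μ / M))))
    (Set.finite_range _).bddAbove ⟨j, by omega⟩

/-- The mean over the snapshots as an iterated mean over the time and parameter nodes. -/
theorem mean_snapshots {α₀ αL : ℝ} {T : ℝ → ℝ} {M L : ℕ} {u : ℝ → ℝ → H10 Ω} (φ : H10 Ω → ℝ) :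
    (1 / (Fintype.card (Fin (M + 1) × Fin (L + 1)) : ℝ)) *
        ∑ p, φ (snapshots α₀ αL T M L u p) =
      (1 / (M + 1 : ℝ)) * ∑ j ∈ Finset.range (M + 1), (1 / (L + 1 : ℝ)) *
        ∑ l ∈ Finset.range (L + 1),
          φ (u (alphaNode α₀ αL L l) (j * (T (alphaNode α₀ αL L l) / M))) := by
  rw [Fintype.card_prod, Fintype.card_fin, Fintype.card_fin, Fintype.sum_prod_type,
    ← Finset.mul_sum]
  simp only [Finset.sum_range, snapshots]
  push_cast
  rw [← mul_assoc]
  congr 1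
  rw [div_mul_div_comm, one_mul]

theorem integral_norm_sq_timeDeriv_succ_le {q : ℕ} {T : ℝ} (hT : 0 < T)
    {u : ℝ → H10 Ω} (hu : ContDiffOn ℝ ((q + 1 : ℕ) : WithTop ℕ∞) u (Icc 0 T)) :
    ∫ t in (0 : ℝ)..T, ‖grad (timeDeriv T (q + 1) u t)‖ ^ 2 ≤
      (⨆ t : Icc (0 : ℝ) T, ‖grad (timeDeriv T q u t)‖ ^ 2) + ∫ t in (0 : ℝ)..T,
        (‖grad (timeDeriv T q u t)‖ ^ 2 + ‖grad (timeDeriv T (q + 1) u t)‖ ^ 2) := by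
  have h0 : 0 ≤ ⨆ t : Icc (0 : ℝ) T, ‖grad (timeDeriv T q u t)‖ ^ 2 :=
    Real.iSup_nonneg fun _ => sq_nonneg _
  have h1 := continuousOn_norm_sq_grad_iteratedDerivWithin hT hu (Nat.le_succ q)
  have h2 := continuousOn_norm_sq_grad_iteratedDerivWithin hT hu le_rfl
  have h3 := intervalIntegral.integral_mono_on (μ := volume) hT.le
    (ContinuousOn.intervalIntegrable (by rw [uIcc_of_le hT.le]; exact h2))
    (ContinuousOn.intervalIntegrable (by rw [uIcc_of_le hT.le]; exact h1.add h2))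
    fun s _ => le_add_of_nonneg_left (sq_nonneg _)
  simp only [timeDeriv] at h0 ⊢
  linarith

theorem mixedDeriv_eq (I : Set (ℝ × ℝ)) (i j : ℕ) (u : ℝ → ℝ → H10 Ω) (p : ℝ × ℝ) :
    mixedDeriv I i j u p.1 p.2 =
      iteratedFDerivWithin ℝ (i + j) (fun p : ℝ × ℝ => u p.1 p.2) I p (mixedDir (i + j) i) := rfl

theorem continuousOn_norm_sq_mixedDeriv {I : Set (ℝ × ℝ)} (hI : UniqueDiffOn ℝ I) {n i j : ℕ}
    {u : ℝ → ℝ → H10 Ω} (hu : ContDiffOn ℝ n (fun p : ℝ × ℝ => u p.1 p.2) I) (hn : i + j ≤ n) :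
    ContinuousOn (fun p : ℝ × ℝ => ‖grad (mixedDeriv I i j u p.1 p.2)‖ ^ 2) I := by
  have h := hu.continuousOn_iteratedFDerivWithin (m := i + j) (by exact_mod_cast hn) hI
  have h2 : ContinuousOn (fun p => iteratedFDerivWithin ℝ (i + j) (fun p : ℝ × ℝ => u p.1 p.2) I p
      (mixedDir (i + j) i)) I :=
    (ContinuousMultilinearMap.apply ℝ (fun _ : Fin (i + j) => ℝ × ℝ) (H10 Ω)
      (mixedDir (i + j) i)).continuous.comp_continuousOn h
  exact ((gradL Ω).continuous.comp_continuousOn h2).norm.pow 2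

theorem norm_sq_mixedDeriv_clm_comp_le {G : H10 Ω →L[ℝ] X} (hG : ∀ v, ‖G v‖ ≤ ‖grad v‖)
    {I : Set (ℝ × ℝ)} (hI : UniqueDiffOn ℝ I) {N n i : ℕ} {u : ℝ → ℝ → H10 Ω}
    (hu : ContDiffOn ℝ N (fun p : ℝ × ℝ => u p.1 p.2) I) (hn : n ≤ N) (hi : i ≤ n) {p : ℝ × ℝ}
    (hp : p ∈ I) :
    ‖iteratedFDerivWithin ℝ n (fun p : ℝ × ℝ => G (u p.1 p.2)) I p (mixedDir n i)‖ ^ 2 ≤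
      ‖grad (mixedDeriv I i (n - i) u p.1 p.2)‖ ^ 2 := by
  obtain ⟨j, rfl⟩ := Nat.exists_eq_add_of_le hi
  have h := G.iteratedFDerivWithin_comp_left (hu p hp) hI hp (i := i + j) (by exact_mod_cast hn)
  rw [Nat.add_sub_cancel_left, mixedDeriv_eq]
  refine pow_le_pow_left₀ (norm_nonneg _) (le_trans (le_of_eq ?_) (hG _)) 2
  exact congrArg (fun F => ‖F (mixedDir (i + j) i)‖) h

/-- A term of the double sum over `i + j ≤ m` is at most the sum. -/
theorem le_sum_sum_of_add_le {m i j : ℕ} (hij : i + j ≤ m) {φ : ℕ → ℕ → ℝ}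
    (hφ : ∀ i j, 0 ≤ φ i j) :
    φ i j ≤ ∑ i ∈ Finset.range (m + 1), ∑ j ∈ Finset.range (m + 1 - i), φ i j :=
  (Finset.single_le_sum (f := φ i) (fun j _ => hφ i j) (Finset.mem_range.2 (by omega))).trans
    (Finset.single_le_sum (f := fun i => ∑ j ∈ Finset.range (m + 1 - i), φ i j)
      (fun i _ => Finset.sum_nonneg fun j _ => hφ i j) (Finset.mem_range.2 (by omega)))

/-- The bound for `∇(I - P)u_h` and its time derivative, in terms of the derivatives of `u_h`. -/
theorem exists_pod_projection_error_bound (q m : ℕ) (hq : 2 ≤ q) (hm : 2 ≤ m) {α₀ αL : ℝ}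
    (hα : α₀ < αL) {T : ℝ → ℝ} (hT : ContDiffOn ℝ ∞ T (Icc α₀ αL))
    (hTpos : ∀ α ∈ Icc α₀ αL, 0 < T α) :
    ∃ K : ℝ, 0 < K ∧ ∀ {d : ℕ} {Ω : Set (Space d)} {uh : ℝ → ℝ → H10 Ω} {M L l r : ℕ} {α t : ℝ},
      ContDiffOn ℝ ((max q m + 1 : ℕ) : WithTop ℕ∞) (fun p : ℝ × ℝ => uh p.1 p.2)
        (region α₀ αL T) → q ≤ M →
      ∀ D : SpectralData (correlationMatrix (snapshots α₀ αL T M L uh)), r ≤ D.numPos →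
      l + m ≤ L + 1 → α ∈ Icc α₀ αL →
      α ∈ Icc (alphaNode α₀ αL L l) (alphaNode α₀ αL L (l + m - 1)) → t ∈ Icc 0 (T α) →
      ∀ P, P = podProj (snapshots α₀ αL T M L uh) D r →
      ∀ uh' : ℝ → H10 Ω, (∀ s, uh' s = fderivWithin ℝ (fun p : ℝ × ℝ => uh p.1 p.2)
        (region α₀ αL T) (α, s) (0, 1)) →
      ‖grad (uh α t - P (uh α t))‖ ^ 2 + (∫ s in (0 : ℝ)..T α,
          (‖grad (uh α s - P (uh α s))‖ ^ 2 + ‖grad (uh' s - P (uh' s))‖ ^ 2)) ≤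
        K * (snapshotFactor m α₀ αL T M L uh * D.tail r ^ (1 - gammaExp m)
          + quotientFactor m α₀ αL T M L uh * D.tail r ^ (1 - betaExp m)
          + timeConst q m l α₀ αL T L uh * dTime α₀ αL T M L ^ (2 * q)
          + paramConst m l α₀ αL T L uh α t * dAlpha α₀ αL L ^ (2 * m - 1)) := by
  obtain ⟨K, hK0, hK⟩ := exists_projection_error_bound q m hq hm hα hT hTpos
  refine ⟨K, hK0, ?_⟩
  intro d Ω uh M L l r α t huh hM D hr hl hα' hαl ht P hP uh' huh'
  set I := region α₀ αL T
  have hI : UniqueDiffOn ℝ I := uniqueDiffOn_region hα hT hTpos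
  set G : H10 Ω →L[ℝ] L2Vec Ω := (gradL Ω).comp (ContinuousLinearMap.id ℝ _ - P)
  have hGP : ∀ v, G v = grad (v - P v) := fun _ => rfl
  have hG : ∀ v, ‖G v‖ ≤ ‖grad v‖ := fun v => by
    rw [hGP, hP]; exact norm_sub_podProj_le hr v
  have hV : ContDiffOn ℝ ((max q m + 1 : ℕ) : WithTop ℕ∞)
    (fun p : ℝ × ℝ => G (uh p.1 p.2)) I := G.contDiff.comp_contDiffOn huh
  have hnode : ∀ l ≤ L, alphaNode α₀ αL L l ∈ Icc α₀ αL := fun l hl => alphaNode_mem hα hl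
  have hm1 : m ≤ max q m + 1 := (le_max_right q m).trans (Nat.le_succ _)
  have hq1 : q + 1 ≤ max q m + 1 := Nat.succ_le_succ (le_max_left q m)
  have huhm : ContDiffOn ℝ m (fun p : ℝ × ℝ => uh p.1 p.2) I :=
    huh.of_le (by exact_mod_cast hm1)
  have huhq : ContDiffOn ℝ ((q + 1 : ℕ) : WithTop ℕ∞) (fun p : ℝ × ℝ => uh p.1 p.2) I :=
    huh.of_le (by exact_mod_cast hq1)
  have hG' : ∀ s ∈ Icc 0 (T α), fderivWithin ℝ (fun p : ℝ × ℝ => G (uh p.1 p.2)) I (α, s) (0, 1) =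
      G (uh' s) := by
    intro s hs
    have h1 := (huh.differentiableOn (by simp) (α, s) ⟨hα', hs⟩).hasFDerivWithinAt
    have h2 := (G.hasFDerivAt.comp_hasFDerivWithinAt (α, s) h1).fderivWithin (hI (α, s) ⟨hα', hs⟩)
    rw [huh' s]
    exact congrArg (fun F => F ((0 : ℝ), (1 : ℝ))) h2
  have key := hK (V := fun p : ℝ × ℝ => G (uh p.1 p.2)) (M := M) (L := L) (l := l)
    (A := paramNorm m α₀ αL T M uh) (B := timeNorm m α₀ αL T L uh) (τ := D.tail r) (α := α) (t := t)
    (S₀ := fun p => ∑ i ∈ Finset.range (m + 1), ∑ j ∈ Finset.range (m + 1 - i),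
      ‖grad (mixedDeriv I i j uh p.1 p.2)‖ ^ 2)
    (S₁ := fun p => ∑ i ∈ Finset.range (m + 1), ∑ j ∈ Finset.range (m + 1 - i),
      (‖grad (mixedDeriv I (i + 1) j uh p.1 p.2)‖ ^ 2 +
        ‖grad (mixedDeriv I i j uh p.1 p.2)‖ ^ 2))
    (R := fun j => (⨆ t : Icc (0 : ℝ) (T (alphaNode α₀ αL L j)),
        ‖grad (timeDeriv (T (alphaNode α₀ αL L j)) q (uh (alphaNode α₀ αL L j)) t)‖ ^ 2)
      + ∫ t in (0 : ℝ)..T (alphaNode α₀ αL L j),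
        (‖grad (timeDeriv (T (alphaNode α₀ αL L j)) q (uh (alphaNode α₀ αL L j)) t)‖ ^ 2
          + ‖grad (timeDeriv (T (alphaNode α₀ αL L j)) (q + 1)
              (uh (alphaNode α₀ αL L j)) t)‖ ^ 2))
    hV hM paramNorm_nonneg timeNorm_nonneg ?_ ?_ ?_ ?_ ?_ ?_ ?_ ?_ ?_ hl hα' hαl ht _ rfl
  · refine le_trans (le_of_eq ?_) key
    congr 1
    refine intervalIntegral.integral_congr fun s hs => ?_
    rw [uIcc_of_le (hTpos α hα').le] at hs
    change _ = _ + ‖fderivWithin ℝ (fun p : ℝ × ℝ => G (uh p.1 p.2)) I (α, s) (0, 1)‖ ^ 2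
    rw [hG' s hs]
    rfl
  · intro j hj
    exact (sum_integral_clm_comp_le hG hα (w := fun μ => uh μ (j * (T μ / M)))
      (contDiffOn_node hT hTpos huhm (by omega) hj)).trans
      (pow_le_pow_left₀ sobolevNorm_nonneg (sobolevNorm_le_paramNorm hj) 2)
  · intro j hj
    exact (sum_integral_clm_comp_le hG (hTpos _ (hnode j hj))
      (contDiffOn_time huhm (hnode j hj))).trans
      (pow_le_pow_left₀ sobolevNorm_nonneg (sobolevNorm_le_timeNorm hj) 2)
  · have h := mean_norm_sq_sub_podProj_le hr
    rw [← hP] at h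
    exact (mean_snapshots fun v => ‖grad (v - P v)‖ ^ 2).symm.le.trans h
  · intro j hj
    have hj' := hnode j hj
    have hu := contDiffOn_time huhq hj'
    exact (integral_norm_sq_clm_comp_le hG (hTpos _ hj') hu le_rfl).trans
      (integral_norm_sq_timeDeriv_succ_le (hTpos _ hj') hu)
  · refine continuousOn_finsetSum _ fun i hi => continuousOn_finsetSum _ fun j hj =>
      continuousOn_norm_sq_mixedDeriv hI huh ?_
    rw [Finset.mem_range] at hi hj
    omega
  · refine continuousOn_finsetSum _ fun i hi => continuousOn_finsetSum _ fun j hj =>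
      (continuousOn_norm_sq_mixedDeriv hI huh ?_).add (continuousOn_norm_sq_mixedDeriv hI huh ?_)
    all_goals rw [Finset.mem_range] at hi hj; omega
  · exact fun p => Finset.sum_nonneg fun i _ => Finset.sum_nonneg fun j _ => sq_nonneg _
  · exact fun p => Finset.sum_nonneg fun i _ => Finset.sum_nonneg fun j _ =>
      add_nonneg (sq_nonneg _) (sq_nonneg _)
  · intro n hn i hi p hp
    have h1 := norm_sq_mixedDeriv_clm_comp_le hG hI huh (n := n) (by omega) hi hp
    have h2 := norm_sq_mixedDeriv_clm_comp_le hG hI huh (n := n + 1) (i := i + 1) (by omega)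
      (by omega) hp
    rw [Nat.add_sub_add_right] at h2
    refine ⟨h1.trans ?_, h1.trans ?_, h2.trans ?_⟩
    · exact le_sum_sum_of_add_le (i := i) (j := n - i) (by omega)
        (φ := fun i j => ‖grad (mixedDeriv I i j uh p.1 p.2)‖ ^ 2) fun _ _ => sq_nonneg _
    · exact (le_add_of_nonneg_left (sq_nonneg _)).trans
        (le_sum_sum_of_add_le (i := i) (j := n - i) (by omega)
        (φ := fun i j => ‖grad (mixedDeriv I (i + 1) j uh p.1 p.2)‖ ^ 2 +
          ‖grad (mixedDeriv I i j uh p.1 p.2)‖ ^ 2)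
        fun _ _ => add_nonneg (sq_nonneg _) (sq_nonneg _))
    · exact (le_add_of_nonneg_right (sq_nonneg _)).trans
        (le_sum_sum_of_add_le (i := i) (j := n - i) (by omega)
        (φ := fun i j => ‖grad (mixedDeriv I (i + 1) j uh p.1 p.2)‖ ^ 2 +
          ‖grad (mixedDeriv I i j uh p.1 p.2)‖ ^ 2)
        fun _ _ => add_nonneg (sq_nonneg _) (sq_nonneg _))

theorem tail_nonneg {ι : Type} [Fintype ι] {y : ι → H10 Ω}
    {D : SpectralData (correlationMatrix y)} {r : ℕ} : 0 ≤ D.tail r := by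
  refine Finset.sum_nonneg fun k _ => ?_
  split_ifs with h
  · exact (eigval_pos le_rfl h.2).le
  · exact le_rfl

theorem snapshotFactor_nonneg {m M L : ℕ} {α₀ αL : ℝ} {T : ℝ → ℝ} {u : ℝ → ℝ → H10 Ω} :
    0 ≤ snapshotFactor m α₀ αL T M L u :=
  mul_nonneg (Real.rpow_nonneg paramNorm_nonneg _) (Real.rpow_nonneg timeNorm_nonneg _)

theorem quotientFactor_nonneg {m M L : ℕ} {α₀ αL : ℝ} {T : ℝ → ℝ} {u : ℝ → ℝ → H10 Ω} :
    0 ≤ quotientFactor m α₀ αL T M L u :=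
  mul_nonneg (Real.rpow_nonneg snapshotFactor_nonneg _) (Real.rpow_nonneg timeNorm_nonneg _)

end

end PODROM

theorem mainTheorem3
    (α₀ αL : ℝ) (hα : α₀ < αL) (T : ℝ → ℝ) (hT : ContDiffOn ℝ ∞ T (Set.Icc α₀ αL))
    (hTpos : ∀ α ∈ Set.Icc α₀ αL, 0 < T α)
    (Cp : ℝ) (Λ : NNReal) (q m : ℕ) (hq : 2 ≤ q) (hm : 2 ≤ m) :
    ∃ C : ℝ, 0 < C ∧
      ∀ (d : ℕ) (_ : 1 ≤ d) (_ : d ≤ 3)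
        (Ω : Set (PODROM.Space d)) (_ : IsOpen Ω) (_ : IsConnected Ω)
        (_ : Bornology.IsBounded Ω) (_ : PODROM.IsPoincareConstant Ω Cp)
        (ν : ℝ → ℝ) (_ : ∀ α ∈ Set.Icc α₀ αL, 0 < ν α)
        (g : ℝ → ℝ → ℝ) (_ : ∀ α ∈ Set.Icc α₀ αL, LipschitzWith Λ (g α))
        (f : ℝ → ℝ → PODROM.L2 Ω) (u₀ : ℝ → PODROM.Space d → ℝ)
        (K : Geometry.SimplicialComplex ℝ (PODROM.Space d)) (_ : PODROM.IsPartition Ω K)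
        (k : ℕ) (_ : 1 ≤ k)
        (uh : ℝ → ℝ → PODROM.H10 Ω)
        (_ : ∀ α ∈ Set.Icc α₀ αL,
          PODROM.IsGalerkinSolution (PODROM.feSpace Ω K k) (ν α) (g α) (f α) (T α) (uh α) ∧
          PODROM.IsLagrangeInterpolant K k (u₀ α) (uh α 0))
        (_ : ContDiffOn ℝ ((max q m + 1 : ℕ) : WithTop ℕ∞) (fun p : ℝ × ℝ => uh p.1 p.2)
          (PODROM.region α₀ αL T))
        (M L : ℕ) (_ : q ≤ M)
        (D : PODROM.SpectralData
          (PODROM.correlationMatrix (PODROM.snapshots α₀ αL T M L uh)))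
        (r : ℕ) (_ : 1 ≤ r) (_ : r ≤ D.numPos)
        (α : ℝ) (_ : α ∈ Set.Icc α₀ αL)
        (ur : ℝ → PODROM.H10 Ω)
        (_ : PODROM.IsGalerkinSolution
          (PODROM.podSpace (PODROM.snapshots α₀ αL T M L uh) D r) (ν α) (g α) (f α) (T α) ur)
        (_ : PODROM.IsH10Projection
          (PODROM.podSpace (PODROM.snapshots α₀ αL T M L uh) D r) (uh α 0) (ur 0))
        (l : ℕ) (_ : l + m ≤ L + 1)
        (_ : α ∈ Set.Icc (PODROM.alphaNode α₀ αL L l) (PODROM.alphaNode α₀ αL L (l + m - 1)))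
        (t : ℝ) (_ : t ∈ Set.Icc 0 (T α)),
        ‖PODROM.toL2 (ur t - uh α t)‖ ^ 2 ≤
          C * ((m : ℝ) + 1 + q * m) *
              (PODROM.snapshotFactor m α₀ αL T M L uh * D.tail r ^ (1 - PODROM.gammaExp m)
                + PODROM.quotientFactor m α₀ αL T M L uh * D.tail r ^ (1 - PODROM.betaExp m))
            + C * PODROM.timeConst q m l α₀ αL T L uh * PODROM.dTime α₀ αL T M L ^ (2 * q)
            + C * PODROM.paramConst m l α₀ αL T L uh α t
                * PODROM.dAlpha α₀ αL L ^ (2 * m - 1) := by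
  obtain ⟨K₀, hK₀0, hK₀⟩ := PODROM.exists_pod_projection_error_bound q m hq hm hα hT hTpos
  obtain ⟨μ₁, hμ₁, hmax⟩ := isCompact_Icc.exists_isMaxOn (nonempty_Icc.2 hα.le) hT.continuousOn
  refine ⟨(2 * Cp ^ 2 + 2 * (Real.exp ((1 + 3 * Λ) * T μ₁) * (Cp ^ 2 * (1 + Λ))) + 1) * K₀,
    by positivity, ?_⟩
  intro d _ _ Ω _ _ hΩ hCp ν hν g hg f u₀ 𝒦 _ k _ uh huh hsmooth M L hM D r _ hr α hα' ur hur h0 l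
    hl hαl t ht
  set τ := D.tail r
  set P := PODROM.podProj (PODROM.snapshots α₀ αL T M L uh) D r with hP
  set uh' : ℝ → PODROM.H10 Ω := fun s => fderivWithin ℝ (fun p : ℝ × ℝ => uh p.1 p.2)
    (PODROM.region α₀ αL T) (α, s) (0, 1) with huh'
  have hTα := hTpos α hα'
  have hI := PODROM.uniqueDiffOn_region hα hT hTpos
  have hbound := hK₀ hsmooth hM D hr hl hα' hαl ht P rfl uh' fun _ => rfl
  -- the snapshots, hence the reduced space, lie in the finite element space
  have hUW : PODROM.podSpace (PODROM.snapshots α₀ αL T M L uh) D r ≤ PODROM.feSpace Ω 𝒦 k := by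
    refine PODROM.podSpace_le _ D r fun p => ?_
    have hp := PODROM.alphaNode_mem (L := L) hα (Nat.lt_succ_iff.1 p.2.isLt)
    have hTp := hTpos _ hp
    have hM0 : (0 : ℝ) < M := by exact_mod_cast (by omega : 0 < M)
    have hj : (p.1 : ℝ) ≤ M := by exact_mod_cast Nat.lt_succ_iff.1 p.1.isLt
    refine (huh _ hp).1.1 _ ⟨by positivity, ?_⟩
    calc (p.1 : ℝ) * (T (PODROM.alphaNode α₀ αL L p.2) / M)
        ≤ M * (T (PODROM.alphaNode α₀ αL L p.2) / M) := by gcongr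
      _ = T (PODROM.alphaNode α₀ αL L p.2) := by field_simp
  have hd : ∀ s ∈ Set.Icc 0 (T α), HasDerivWithinAt (uh α) (uh' s) (Set.Icc 0 (T α)) s :=
    fun s hs => PODROM.hasDerivWithinAt_time (hsmooth.differentiableOn (by simp)) hα' hs
  have hc : ContinuousOn uh' (Set.Icc 0 (T α)) := by
    have h1 := hsmooth.continuousOn_fderivWithin hI (by simp)
    exact (h1.comp (continuousOn_const.prodMk continuousOn_id) fun s hs => ⟨hα', hs⟩).clm_apply
      continuousOn_const
  have herr := PODROM.norm_sq_galerkin_error_le hΩ hCp hUW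
    (PODROM.podProj_mem (PODROM.snapshots α₀ αL T M L uh) D r)
    (fun v z hz => PODROM.inner_sub_podProj hr v hz) (hν α hα') (hg α hα') hTα (huh α hα').1 hur h0
    hd hc ht
  have hexp : Real.exp ((1 + 3 * Λ) * T α) ≤ Real.exp ((1 + 3 * Λ) * T μ₁) := by
    have : T α ≤ T μ₁ := hmax hα'
    gcongr
  set E := Real.exp ((1 + 3 * Λ) * T μ₁)
  set a := ‖PODROM.grad (uh α t - P (uh α t))‖ ^ 2
  set b := ∫ s in (0 : ℝ)..T α, (‖PODROM.grad (uh α s - P (uh α s))‖ ^ 2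
    + ‖PODROM.grad (uh' s - P (uh' s))‖ ^ 2)
  have ha : 0 ≤ a := sq_nonneg _
  have hb : 0 ≤ b := intervalIntegral.integral_nonneg hTα.le fun s _ =>
    add_nonneg (sq_nonneg _) (sq_nonneg _)
  have hE : 0 ≤ 2 * (E * (Cp ^ 2 * (1 + (Λ : ℝ)))) := by positivity
  have h1 : ‖PODROM.toL2 (ur t - uh α t)‖ ^ 2 ≤
      (2 * Cp ^ 2 + 2 * (E * (Cp ^ 2 * (1 + Λ))) + 1) * (a + b) := by
    refine herr.trans ?_
    have h2 : 2 * (Real.exp ((1 + 3 * Λ) * T α) * (Cp ^ 2 * (1 + Λ))) * b ≤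
        2 * (E * (Cp ^ 2 * (1 + Λ))) * b := by gcongr
    have h3 : 0 ≤ 2 * Cp ^ 2 * b := by positivity
    have h4 := mul_nonneg hE ha
    linarith
  set Q := 2 * Cp ^ 2 + 2 * (E * (Cp ^ 2 * (1 + (Λ : ℝ)))) + 1
  have hQ : 0 ≤ Q := by positivity
  set Z := PODROM.snapshotFactor m α₀ αL T M L uh * τ ^ (1 - PODROM.gammaExp m)
    + PODROM.quotientFactor m α₀ αL T M L uh * τ ^ (1 - PODROM.betaExp m)
  have hZ : 0 ≤ Z := by
    have hτ : 0 ≤ τ := PODROM.tail_nonneg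
    exact add_nonneg (mul_nonneg PODROM.snapshotFactor_nonneg (Real.rpow_nonneg hτ _))
      (mul_nonneg PODROM.quotientFactor_nonneg (Real.rpow_nonneg hτ _))
  have h2 : Q * K₀ * 1 * Z ≤ Q * K₀ * ((m : ℝ) + 1 + q * m) * Z := by
    have h3 : (1 : ℝ) ≤ (m : ℝ) + 1 + q * m := by
      have : (0 : ℝ) ≤ (m : ℝ) + q * m := by positivity
      linarith
    gcongr
  have h3 := mul_le_mul_of_nonneg_left hbound hQ
  linarith
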